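/- **Setting.** Let $\mathcal P$ be a finite nonempty set of (labelled) prototiles in $\mathbb R^d$: each is homeomorphic to a closed ball, contains the origin in its interior, and has boundary of box-counting dimension strictly less than $d$ (there are $0\le s<d$ and $K$ such that for $0<\varepsilon\le 1$ the boundary of every prototile is covered by at most $K\varepsilon^{-s}$ balls of radius $\varepsilon$). A tile is a translate $t=p+x$ of a prototile $p$, and $\mathbf x(t)=x$ is its puncture; a partial tiling is a set of tiles with pairwise disjoint interiors, a patch is a finite partial tiling, and a tiling is a partial tiling that covers $\mathbb R^d$. Let $\omega$ be a substitution: for some $\lambda>1$ it assigns to each $p\in\mathcal P$ a partial tiling $\omega(p)$ with support $\lambda p$, and it is extended by $\omega(p+x)=\omega(p)+\lambda x$. Let $\Omega$ be the set of tilings $T$ such that every patch in $T$ is contained in a translate of some $\omega^n(p)$. Assume: 1. (primitivity) for some $N$, $\omega^N(p)$ contains a translate of $q$ for all $p,q\in\mathcal P$; 2. (finite local complexity) for every $T\in\Omega$ and $R>0$, the patches in $T$ whose support has diameter less than $R$ are finite in number up to translation; 3. $\omega:\Omega\to\Omega$ is injective; 4. ($\omega$ forces its border) for some $n$ and every $p\in\mathcal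 P$: whenever $T,T'\in\Omega$, $\omega^n(p)+x\subset T$ and $\omega^n(p)+x'\subset T'$, the set of tiles of $T$ meeting $\operatorname{supp}(\omega^n(p)+x)$, translated by $-x$, equals the set of tiles of $T'$ meeting $\operatorname{supp}(\omega^n(p)+x')$, translated by $-x'$. Let $\Omega_{\rm punc}$ be the set of $T\in\Omega$ that have a tile with puncture $0$, and let $\mathcal R_{\rm punc}=\{(T,T+x): x\in\mathbb R^d,\ T,T+x\in\Omega_{\rm punc}\}$ be the groupoid of translational equivalence, with the topology generated by the sets $\{(T,T+\mathbf x(t_1)-\mathbf x(t_2)) : P-\mathbf x(t_1)\subset T\}$, where $P$ is a patch in a tiling of $\Omega$ and $t_1,t_2\in P$. Let $A_\omega=C^*_r(\mathcal R_{\rm punc})$ be its reduced C*-algebra. Let $G$ be a finite symmetry group for $(\mathcal P,\omega)$: a finite subgroup of $O(d,\mathbb R)$ acting on $\mathcal P$ by $p\mapsto gp$ with $\omega(gp)=g\,\omega(p)$. Let $\alpha$ be the action of $G$ on $A_\omega$ induced by $(T,T')\mapsto (gT,gT')$, i.e. $\alpha_g(f)(T,T')=f(g^{-1}T,g^{-1}T')$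 for $f\in C_c(\mathcal R_{\rm punc})$. **Theorem.** If $G$ acts freely on $\mathcal P$ (that is, $gp=p$ for some $p\in\mathcal P$ implies $g=e$), then the induced action $\alpha$ of $G$ on $A_\omega$ has the weak Rokhlin property of Matui and Sato. That is: $A_\omega$ is a unital simple C*-algebra whose space $\mathfrak T(A_\omega)$ of normalized traces is nonempty, and there is a sequence $(f_n)$ in $A_\omega$ with $0\le f_n\le 1$ such that $\|f_na-af_n\|\to 0$ for every $a\in A_\omega$, $\|\alpha_g(f_n)\alpha_h(f_n)\|\to 0$ for all $g\ne h$ in $G$, and $$\lim_{n\to\infty}\ \sup_{\tau\in\mathfrak T(A_\omega)}\bigl|\tau(f_n)-(\#G)^{-1}\bigr|=0 .$$ -/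

import Mathlib

open Set Filter Topology

noncomputable section

namespace SubstTiling

/-- Euclidean space of dimension `d`. -/
abbrev Euc (d : ℕ) : Type := EuclideanSpace ℝ (Fin d)

/-- The orthogonal group of `ℝ^d`. -/
abbrev OrthGroup (d : ℕ) : Type := Euc d ≃ₗᵢ[ℝ] Euc d

/-- A tile: the translate `p + x` of the prototile with label `p` by the vector `x`.
The vector `x` is the puncture of the tile. -/
abbrev Tile (d : ℕ) (ι : Type*) : Type _ := ι × Euc d

section Translation

variable {d : ℕ} {ι : Type*}

/-- The translate `t + x` of a tile. -/
def Tile.translate (x : Euc d) (t : Tile d ι) : Tile d ι := (t.1, t.2 + x)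

/-- The translate `P + x` of a collection of tiles. -/
def translate (x : Euc d) (P : Set (Tile d ι)) : Set (Tile d ι) := Tile.translate x '' P

/-- The tile `g t = g p + g x` for `t = p + x`, where `g` is orthogonal and acts on labels. -/
def Tile.rotate {G : Subgroup (OrthGroup d)} [MulAction G ι] (g : G) (t : Tile d ι) : Tile d ι :=
  (g • t.1, (g : OrthGroup d) t.2)

/-- The collection of tiles `g P = {g t | t ∈ P}`. -/
def rotate {G : Subgroup (OrthGroup d)} [MulAction G ι] (g : G) (P : Set (Tile d ι)) :
    Set (Tile d ι) := Tile.rotate g '' P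

/-- The union of a collection of labelled tiles, where `shape p` is the set of points of the
prototile with label `p`. -/
def support (shape : ι → Set (Euc d)) (P : Set (Tile d ι)) : Set (Euc d) :=
  ⋃ t ∈ P, (fun y => y + t.2) '' shape t.1

/-- A partial tiling: distinct (labelled) tiles have disjoint interiors. -/
def IsPartialTiling (shape : ι → Set (Euc d)) (P : Set (Tile d ι)) : Prop :=
  ∀ t ∈ P, ∀ t' ∈ P, t ≠ t' →
    Disjoint (interior ((fun y => y + t.2) '' shape t.1))
      (interior ((fun y => y + t'.2) '' shape t'.1))

end Translation

/-- A substitution tiling system in `ℝ^d` whose prototiles are labelled by `ι`. -/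
structure SubstitutionSystem (d : ℕ) (ι : Type*) where
  /-- the set of points of a prototile -/
  shape : ι → Set (Euc d)
  /-- prototiles are homeomorphic to the closed unit ball -/
  ball_homeo : ∀ p, Nonempty (shape p ≃ₜ Metric.closedBall (0 : Euc d) 1)
  /-- prototiles contain the origin in their interior -/
  zero_mem : ∀ p, (0 : Euc d) ∈ interior (shape p)
  /-- the boundaries of the prototiles have capacity (box-counting dimension) less than `d` -/
  capacity : ∃ s K : ℝ, 0 ≤ s ∧ s < d ∧ ∀ ε : ℝ, 0 < ε → ε ≤ 1 → ∀ p, ∃ C : Finset (Euc d),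
    (C.card : ℝ) ≤ K * ε ^ (-s) ∧ frontier (shape p) ⊆ ⋃ c ∈ C, Metric.ball c ε
  /-- the expansion constant -/
  scale : ℝ
  one_lt_scale : 1 < scale
  /-- the substitution rule on prototiles -/
  subst : ι → Set (Tile d ι)
  subst_partial : ∀ p, IsPartialTiling shape (subst p)
  subst_support : ∀ p, support shape (subst p) = (fun y => scale • y) '' shape p

namespace SubstitutionSystem

variable {d : ℕ} {ι : Type*} (S : SubstitutionSystem d ι)

/-- The set of points of a tile. -/
def carrier (t : Tile d ι) : Set (Euc d) := (fun y => y + t.2) '' S.shape t.1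

/-- The union of the tiles of `P`. -/
def supp (P : Set (Tile d ι)) : Set (Euc d) := support S.shape P

/-- The tiles of `T` that meet `U`. -/
def tilesMeeting (T : Set (Tile d ι)) (U : Set (Euc d)) : Set (Tile d ι) :=
  {t | t ∈ T ∧ (S.carrier t ∩ U).Nonempty}

/-- A tiling is a partial tiling that covers `ℝ^d`. -/
def IsTiling (T : Set (Tile d ι)) : Prop := IsPartialTiling S.shape T ∧ S.supp T = univ

/-- The substitution on collections of tiles, determined by `ω(p + x) = ω(p) + λ x`. -/
def substMap (P : Set (Tile d ι)) : Set (Tile d ι) :=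
  ⋃ t ∈ P, translate (S.scale • t.2) (S.subst t.1)

/-- The `n`-th order supertile `ω^n(p)` of a prototile `p`. -/
def supertile (n : ℕ) (p : ι) : Set (Tile d ι) := S.substMap^[n] {(p, 0)}

/-- The continuous hull `Ω`: the tilings all of whose patches (finite subsets)
lie in some `ω^n(p) + x`. -/
def hull : Set (Set (Tile d ι)) :=
  {T | S.IsTiling T ∧ ∀ P ⊆ T, P.Finite → ∃ (x : Euc d) (p : ι) (n : ℕ),
    P ⊆ translate x (S.supertile n p)}

/-- Primitivity: for some `N`, every `ω^N(p)` contains a translate of every prototile. -/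
def IsPrimitive : Prop := ∃ N : ℕ, ∀ p q : ι, ∃ x : Euc d, ((q, x) : Tile d ι) ∈ S.supertile N p

/-- Finite local complexity of every tiling in the hull: up to translation there are finitely many
patches with support of diameter less than `R`. -/
def HasFLC : Prop :=
  ∀ T ∈ S.hull, ∀ R : ℝ, 0 < R → ∃ F : Set (Set (Tile d ι)), F.Finite ∧
    ∀ P ⊆ T, P.Finite → Metric.diam (S.supp P) < R → ∃ Q ∈ F, ∃ x : Euc d, P = translate x Q

/-- The substitution is injective on the hull. -/
def IsInjective : Prop := Set.InjOn S.substMap S.hull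

/-- The substitution forces its border. -/
def ForcesBorder : Prop :=
  ∃ n : ℕ, ∀ p : ι, ∀ T ∈ S.hull, ∀ T' ∈ S.hull, ∀ x x' : Euc d,
    translate x (S.supertile n p) ⊆ T → translate x' (S.supertile n p) ⊆ T' →
      translate (-x) (S.tilesMeeting T (S.supp (translate x (S.supertile n p)))) =
        translate (-x') (S.tilesMeeting T' (S.supp (translate x' (S.supertile n p))))

/-- `G ≤ O(d)`, acting on the labels of the prototiles, is a symmetry group: the prototile
labelled `g p` is the image under `g` of the prototile labelled `p`, and `ω(g p) = g ω(p)`. -/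
structure IsSymmetryGroup (G : Subgroup (OrthGroup d)) [MulAction G ι] : Prop where
  shape_smul : ∀ (g : G) (p : ι), S.shape (g • p) = (g : OrthGroup d) '' S.shape p
  subst_smul : ∀ (g : G) (p : ι), S.subst (g • p) = rotate g (S.subst p)

/-- The punctured hull: tilings in the hull with a puncture at the origin. -/
def punctHull : Set (Set (Tile d ι)) := {T | T ∈ S.hull ∧ ∃ p : ι, ((p, 0) : Tile d ι) ∈ T}

/-- The groupoid `R_punc` of translational equivalence on the punctured hull; the element
`(T, T + x)` has range `T` and source `T + x`. -/
@[ext]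
structure RPunc where
  /-- the range of the element -/
  rng : Set (Tile d ι)
  /-- the source of the element -/
  src : Set (Tile d ι)
  rng_mem : rng ∈ S.punctHull
  src_mem : src ∈ S.punctHull
  rel : ∃ x : Euc d, src = translate x rng

/-- The set `V(P, t₁, t₂)` of all `(T, T + x(t₁) - x(t₂))` in `R_punc` with `P - x(t₁) ⊆ T`
(hence also `P - x(t₂) ⊆ T + x(t₁) - x(t₂)`). -/
def basicGraph (P : Set (Tile d ι)) (t₁ t₂ : Tile d ι) : Set S.RPunc :=
  {γ | translate (-t₁.2) P ⊆ γ.rng ∧ γ.src = translate (t₁.2 - t₂.2) γ.rng}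

/-- The topology of `R_punc` is generated by the sets `V(P, t₁, t₂)`, where `P` is a patch in a
tiling of the hull and `t₁, t₂ ∈ P`. -/
instance : TopologicalSpace S.RPunc :=
  TopologicalSpace.generateFrom
    {V | ∃ T ∈ S.hull, ∃ P ⊆ T, P.Finite ∧ ∃ t₁ ∈ P, ∃ t₂ ∈ P, V = S.basicGraph P t₁ t₂}

end SubstitutionSystem

section TranslationLemmas

variable {d : ℕ} {ι : Type*}

theorem translate_translate (x y : Euc d) (P : Set (Tile d ι)) :
    translate x (translate y P) = translate (y + x) P := by
  simp only [translate, image_image]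
  congr 1
  funext t
  simp [Tile.translate, add_assoc]

theorem translate_zero (P : Set (Tile d ι)) : translate 0 P = P := by
  have : Tile.translate (0 : Euc d) = (id : Tile d ι → Tile d ι) := by
    funext t; simp [Tile.translate]
  simp [translate, this]

variable {G : Subgroup (OrthGroup d)} [MulAction G ι]

theorem rotate_translate (g : G) (x : Euc d) (P : Set (Tile d ι)) :
    rotate g (translate x P) = translate ((g : OrthGroup d) x) (rotate g P) := by
  simp only [rotate, translate, image_image, Tile.rotate, Tile.translate, map_add]

theorem rotate_one (P : Set (Tile d ι)) : rotate (1 : G) P = P := by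
  have : Tile.rotate (1 : G) = (id : Tile d ι → Tile d ι) := by
    funext t; simp [Tile.rotate]
  simp [rotate, this]

theorem rotate_mul (g h : G) (P : Set (Tile d ι)) :
    rotate (g * h) P = rotate g (rotate h P) := by
  simp only [rotate, image_image]
  congr 1
  funext t
  simp [Tile.rotate, mul_smul]

theorem rotate_inv_rotate (g : G) (P : Set (Tile d ι)) : rotate g⁻¹ (rotate g P) = P := by
  rw [← rotate_mul, inv_mul_cancel, rotate_one]

theorem rotate_rotate_inv (g : G) (P : Set (Tile d ι)) : rotate g (rotate g⁻¹ P) = P := by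
  rw [← rotate_mul, mul_inv_cancel, rotate_one]

theorem rotate_mono (g : G) {P Q : Set (Tile d ι)} (h : P ⊆ Q) : rotate g P ⊆ rotate g Q :=
  image_mono h

end TranslationLemmas

namespace SubstitutionSystem

variable {d : ℕ} {ι : Type*} {S : SubstitutionSystem d ι}

namespace RPunc

/-- The product `γ η⁻¹` of groupoid elements with the same source. -/
def mulInv (γ η : S.RPunc) (h : η.src = γ.src) : S.RPunc where
  rng := γ.rng
  src := η.rng
  rng_mem := γ.rng_mem
  src_mem := η.rng_mem
  rel := by
    obtain ⟨x, hx⟩ := γ.rel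
    obtain ⟨y, hy⟩ := η.rel
    refine ⟨x - y, ?_⟩
    rw [sub_eq_add_neg, ← translate_translate, ← hx, ← h, hy, translate_translate,
      add_neg_cancel, translate_zero]

end RPunc

namespace IsSymmetryGroup

variable {G : Subgroup (OrthGroup d)} [MulAction G ι]

theorem carrier_rotate (hG : S.IsSymmetryGroup G) (g : G) (t : Tile d ι) :
    S.carrier (Tile.rotate g t) = (g : OrthGroup d) '' S.carrier t := by
  simp only [carrier, Tile.rotate, hG.shape_smul, image_image, map_add]

theorem isTiling_rotate (hG : S.IsSymmetryGroup G) (g : G) {T : Set (Tile d ι)}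
    (hT : S.IsTiling T) : S.IsTiling (rotate g T) := by
  have hint : ∀ t : Tile d ι, interior (S.carrier (Tile.rotate g t)) =
      (g : OrthGroup d) '' interior (S.carrier t) := fun t => by
    rw [hG.carrier_rotate]
    exact ((g : OrthGroup d).toHomeomorph.image_interior _).symm
  constructor
  · rintro _ ⟨t, ht, rfl⟩ _ ⟨t', ht', rfl⟩ hne
    change Disjoint (interior (S.carrier (Tile.rotate g t)))
      (interior (S.carrier (Tile.rotate g t')))
    rw [hint, hint]
    refine (disjoint_image_iff (g : OrthGroup d).injective).2 ?_
    exact hT.1 t ht t' ht' (fun h => hne (by rw [h]))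
  · have h : ∀ y, y ∈ S.supp T := fun y => by rw [hT.2]; trivial
    refine eq_univ_of_forall fun y => ?_
    obtain ⟨t, ht, hy⟩ := mem_iUnion₂.1 (h ((g : OrthGroup d).symm y))
    refine mem_iUnion₂.2 ⟨Tile.rotate g t, ⟨t, ht, rfl⟩, ?_⟩
    change y ∈ S.carrier (Tile.rotate g t)
    rw [hG.carrier_rotate]
    exact ⟨_, hy, by simp⟩

theorem substMap_rotate (hG : S.IsSymmetryGroup G) (g : G) (P : Set (Tile d ι)) :
    S.substMap (rotate g P) = rotate g (S.substMap P) := by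
  simp only [substMap, rotate, biUnion_image, image_iUnion₂]
  refine iUnion₂_congr fun t _ => ?_
  have h := rotate_translate g (S.scale • t.2) (S.subst t.1)
  rw [← hG.subst_smul] at h
  simpa [rotate, Tile.rotate] using h.symm

theorem supertile_smul (hG : S.IsSymmetryGroup G) (g : G) (n : ℕ) (p : ι) :
    S.supertile n (g • p) = rotate g (S.supertile n p) := by
  induction n with
  | zero => simp [supertile, rotate, Tile.rotate]
  | succ n ih =>
    simp only [supertile, Function.iterate_succ', Function.comp_apply] at ih ⊢
    rw [ih, hG.substMap_rotate]

theorem hull_rotate (hG : S.IsSymmetryGroup G) (g : G) {T : Set (Tile d ι)} (hT : T ∈ S.hull) :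
    rotate g T ∈ S.hull := by
  refine ⟨hG.isTiling_rotate g hT.1, fun P hP hfin => ?_⟩
  have hsub : rotate g⁻¹ P ⊆ T := by
    have := rotate_mono g⁻¹ hP
    rwa [rotate_inv_rotate] at this
  obtain ⟨x, p, n, h⟩ := hT.2 _ hsub (hfin.image _)
  refine ⟨(g : OrthGroup d) x, g • p, n, ?_⟩
  have := rotate_mono g h
  rwa [rotate_rotate_inv, rotate_translate, ← hG.supertile_smul] at this

theorem punctHull_rotate (hG : S.IsSymmetryGroup G) (g : G) {T : Set (Tile d ι)}
    (hT : T ∈ S.punctHull) : rotate g T ∈ S.punctHull := by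
  obtain ⟨p, hp⟩ := hT.2
  exact ⟨hG.hull_rotate g hT.1, g • p, (p, 0), hp, by simp [Tile.rotate]⟩

/-- The action `α_g(T, T') = (g T, g T')` on `R_punc`. -/
def actR (hG : S.IsSymmetryGroup G) (g : G) (γ : S.RPunc) : S.RPunc where
  rng := rotate g γ.rng
  src := rotate g γ.src
  rng_mem := hG.punctHull_rotate g γ.rng_mem
  src_mem := hG.punctHull_rotate g γ.src_mem
  rel := by
    obtain ⟨x, hx⟩ := γ.rel
    exact ⟨(g : OrthGroup d) x, by rw [hx, rotate_translate]⟩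

theorem actR_one (hG : S.IsSymmetryGroup G) (γ : S.RPunc) : hG.actR 1 γ = γ :=
  RPunc.ext (rotate_one _) (rotate_one _)

theorem actR_mul (hG : S.IsSymmetryGroup G) (g h : G) (γ : S.RPunc) :
    hG.actR (g * h) γ = hG.actR g (hG.actR h γ) :=
  RPunc.ext (rotate_mul _ _ _) (rotate_mul _ _ _)

theorem continuous_actR (hG : S.IsSymmetryGroup G) (g : G) : Continuous (hG.actR g) := by
  refine continuous_generateFrom_iff.2 ?_
  rintro _ ⟨T, hT, P, hP, hfin, t₁, ht₁, t₂, ht₂, rfl⟩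
  refine TopologicalSpace.isOpen_generateFrom_of_mem
    ⟨rotate g⁻¹ T, hG.hull_rotate _ hT, rotate g⁻¹ P, rotate_mono _ hP, hfin.image _,
      Tile.rotate g⁻¹ t₁, ⟨t₁, ht₁, rfl⟩, Tile.rotate g⁻¹ t₂, ⟨t₂, ht₂, rfl⟩, ?_⟩
  have hs : ∀ {A B : Set (Tile d ι)}, A ⊆ rotate g B ↔ rotate g⁻¹ A ⊆ B := fun {A B} =>
    ⟨fun h => by simpa [rotate_inv_rotate] using rotate_mono g⁻¹ h,
      fun h => by simpa [rotate_rotate_inv] using rotate_mono g h⟩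
  have he : ∀ {A B : Set (Tile d ι)}, rotate g A = B ↔ A = rotate g⁻¹ B := fun {A B} =>
    ⟨fun h => by rw [← h, rotate_inv_rotate], fun h => by rw [h, rotate_rotate_inv]⟩
  have hv : ∀ t : Tile d ι, (Tile.rotate g⁻¹ t).2 = ((g⁻¹ : G) : OrthGroup d) t.2 := fun _ => rfl
  ext γ
  simp only [basicGraph, mem_preimage, mem_ofPred_eq, actR, hs, he, rotate_translate,
    rotate_inv_rotate, hv, map_neg, map_sub]

/-- The action of `g` on `R_punc` as a homeomorphism. -/
def homeoR (hG : S.IsSymmetryGroup G) (g : G) : S.RPunc ≃ₜ S.RPunc where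
  toFun := hG.actR g
  invFun := hG.actR g⁻¹
  left_inv γ := by rw [← actR_mul, inv_mul_cancel, actR_one]
  right_inv γ := by rw [← actR_mul, mul_inv_cancel, actR_one]
  continuous_toFun := hG.continuous_actR g
  continuous_invFun := hG.continuous_actR g⁻¹

end IsSymmetryGroup

/-! ### The reduced C*-algebra of `R_punc` -/

variable (S) in
/-- The Hilbert space `ℓ²(R_punc)`, the direct sum over the units `x` of the spaces
`ℓ²(s⁻¹(x))` that carry the regular representations `λ_x`. -/
abbrev RegSpace : Type _ := lp (fun _ : S.RPunc => ℂ) 2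

/-- The bounded operator `a` is the direct sum over all units `x` of the operators `λ_x(f)`,
`(λ_x(f) ξ)(γ) = ∑_{s(η) = x} f(γ η⁻¹) ξ(η)` for `s(γ) = x`. -/
def IsRegRep (f : S.RPunc → ℂ) (a : S.RegSpace →L[ℂ] S.RegSpace) : Prop :=
  ∀ (ξ : S.RegSpace) (γ : S.RPunc),
    (a ξ : S.RPunc → ℂ) γ =
      ∑' η : {η : S.RPunc // η.src = γ.src}, f (γ.mulInv η.1 η.2) * (ξ : S.RPunc → ℂ) η.1

variable (S) in
/-- The operators `⊕_x λ_x(f)` for `f ∈ C_c(R_punc)`. -/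
def regOperators : Set (S.RegSpace →L[ℂ] S.RegSpace) :=
  {a | ∃ f : S.RPunc → ℂ, Continuous f ∧ HasCompactSupport f ∧ IsRegRep f a}

variable (S) in
/-- The concrete C*-algebra `A_ω` on `ℓ²(R_punc)`: the operator norm of `⊕_x λ_x(f)` is the
reduced norm `sup_x ‖λ_x(f)‖`, so the norm closure of the algebra of these operators is the
completion of `C_c(R_punc)` in the reduced norm. -/
def tilingSubalgebra : StarSubalgebra ℂ (S.RegSpace →L[ℂ] S.RegSpace) :=
  (StarAlgebra.adjoin ℂ S.regOperators).topologicalClosure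

variable (S) in
/-- The tiling C*-algebra `A_ω = C*_r(R_punc)`. -/
abbrev TilingAlgebra : Type _ := S.tilingSubalgebra

instance : IsClosed (S.tilingSubalgebra : Set (S.RegSpace →L[ℂ] S.RegSpace)) :=
  StarSubalgebra.isClosed_topologicalClosure _

end SubstitutionSystem

/-- The unitary of `ℓ²(X)` induced by a permutation `e` of `X`: `ξ ↦ ξ ∘ e⁻¹`. -/
def permUnitary {X : Type*} (e : X ≃ X) :
    lp (fun _ : X => ℂ) 2 ≃ₗᵢ[ℂ] lp (fun _ : X => ℂ) 2 :=
  have hmem : ∀ (e : X ≃ X) (ξ : lp (fun _ : X => ℂ) 2),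
      Memℓp (fun x => (ξ : X → ℂ) (e x)) 2 := fun e ξ => by
    have h := lp.memℓp ξ
    rw [memℓp_gen_iff (by norm_num)] at h ⊢
    exact e.summable_iff.2 h
  { toFun := fun ξ => ⟨fun x => (ξ : X → ℂ) (e.symm x), hmem e.symm ξ⟩
    invFun := fun ξ => ⟨fun x => (ξ : X → ℂ) (e x), hmem e ξ⟩
    map_add' := fun ξ η => by ext x; rfl
    map_smul' := fun c ξ => by ext x; rfl
    left_inv := fun ξ => by ext x; simp
    right_inv := fun ξ => by ext x; simp
    norm_map' := fun ξ => by
      rw [lp.norm_eq_tsum_rpow (by norm_num), lp.norm_eq_tsum_rpow (by norm_num)]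
      congr 1
      exact e.symm.tsum_eq (fun x => ‖(ξ : X → ℂ) x‖ ^ (2 : ENNReal).toReal) }

@[simp] theorem permUnitary_apply {X : Type*} (e : X ≃ X) (ξ : lp (fun _ : X => ℂ) 2) (x : X) :
    (permUnitary e ξ : X → ℂ) x = (ξ : X → ℂ) (e.symm x) := rfl

@[simp] theorem permUnitary_symm_apply {X : Type*} (e : X ≃ X) (ξ : lp (fun _ : X => ℂ) 2)
    (x : X) : ((permUnitary e).symm ξ : X → ℂ) x = (ξ : X → ℂ) (e x) := rfl

namespace SubstitutionSystem.IsSymmetryGroup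

variable {d : ℕ} {ι : Type*} {S : SubstitutionSystem d ι} {G : Subgroup (OrthGroup d)}
  [MulAction G ι]

/-- Conjugation of the operators on `ℓ²(R_punc)` by the unitary `ξ ↦ ξ ∘ α_g⁻¹`. -/
def conj (hG : S.IsSymmetryGroup G) (g : G) :
    (S.RegSpace →L[ℂ] S.RegSpace) ≃⋆ₐ[ℂ] (S.RegSpace →L[ℂ] S.RegSpace) :=
  (permUnitary (hG.homeoR g).toEquiv).conjStarAlgEquiv

theorem conj_apply_apply (hG : S.IsSymmetryGroup G) (g : G)
    (a : S.RegSpace →L[ℂ] S.RegSpace) (ξ : S.RegSpace) (γ : S.RPunc) :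
    (hG.conj g a ξ : S.RPunc → ℂ) γ =
      (a ((permUnitary (hG.homeoR g).toEquiv).symm ξ) : S.RPunc → ℂ) (hG.actR g⁻¹ γ) := rfl

/-- Conjugation carries `⊕_x λ_x(f)` to `⊕_x λ_x(f ∘ α_g⁻¹)`. -/
theorem conj_isRegRep (hG : S.IsSymmetryGroup G) (g : G) {f : S.RPunc → ℂ}
    {a : S.RegSpace →L[ℂ] S.RegSpace} (ha : IsRegRep f a) :
    IsRegRep (fun γ => f (hG.actR g⁻¹ γ)) (hG.conj g a) := by
  intro ξ γ
  rw [conj_apply_apply, ha]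
  let e : {η : S.RPunc // η.src = (hG.actR g⁻¹ γ).src} ≃ {η : S.RPunc // η.src = γ.src} :=
    { toFun := fun η => ⟨hG.actR g η.1, by
        change rotate g η.1.src = γ.src
        rw [η.2]; exact rotate_rotate_inv _ _⟩
      invFun := fun η => ⟨hG.actR g⁻¹ η.1, by
        change rotate g⁻¹ η.1.src = rotate g⁻¹ γ.src
        rw [η.2]⟩
      left_inv := fun η => Subtype.ext ((hG.homeoR g).symm_apply_apply η.1)
      right_inv := fun η => Subtype.ext ((hG.homeoR g).apply_symm_apply η.1) }
  rw [← e.tsum_eq]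
  refine tsum_congr fun η => ?_
  congr 2
  exact RPunc.ext rfl (rotate_inv_rotate g η.1.rng).symm

theorem conj_mem_regOperators (hG : S.IsSymmetryGroup G) (g : G)
    {a : S.RegSpace →L[ℂ] S.RegSpace} (ha : a ∈ S.regOperators) :
    hG.conj g a ∈ S.regOperators := by
  obtain ⟨f, hf, hc, h⟩ := ha
  exact ⟨_, hf.comp (hG.continuous_actR g⁻¹),
    hc.comp_homeomorph (hG.homeoR g⁻¹), hG.conj_isRegRep g h⟩

theorem conj_mem (hG : S.IsSymmetryGroup G) (g : G) {a : S.RegSpace →L[ℂ] S.RegSpace}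
    (ha : a ∈ S.tilingSubalgebra) : hG.conj g a ∈ S.tilingSubalgebra := by
  have hcont : Continuous (hG.conj g) := by
    change Continuous fun a => (permUnitary (hG.homeoR g).toEquiv).conjStarAlgEquiv a
    simp only [LinearIsometryEquiv.conjStarAlgEquiv_apply]
    fun_prop
  have hle : StarAlgebra.adjoin ℂ S.regOperators ≤
      S.tilingSubalgebra.comap (hG.conj g).toStarAlgHom := by
    refine StarAlgebra.adjoin_le fun b hb => ?_
    exact StarSubalgebra.le_topologicalClosure _
      (StarAlgebra.subset_adjoin ℂ _ (hG.conj_mem_regOperators g hb))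
  have hcl : IsClosed
      (S.tilingSubalgebra.comap (hG.conj g).toStarAlgHom : Set (S.RegSpace →L[ℂ] S.RegSpace)) :=
    (StarSubalgebra.isClosed_topologicalClosure _).preimage hcont
  exact StarSubalgebra.topologicalClosure_minimal hle hcl ha

theorem conj_one (hG : S.IsSymmetryGroup G) (a : S.RegSpace →L[ℂ] S.RegSpace) :
    hG.conj 1 a = a := by
  ext ξ γ
  rw [conj_apply_apply, inv_one, actR_one]
  have h : (permUnitary (hG.homeoR 1).toEquiv).symm ξ = ξ :=
    lp.ext (funext fun η => congrArg ξ (hG.actR_one η))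
  rw [h]

theorem conj_mul (hG : S.IsSymmetryGroup G) (g h : G) (a : S.RegSpace →L[ℂ] S.RegSpace) :
    hG.conj (g * h) a = hG.conj g (hG.conj h a) := by
  ext ξ γ
  rw [conj_apply_apply, conj_apply_apply, conj_apply_apply, mul_inv_rev, actR_mul]
  have h : (permUnitary (hG.homeoR (g * h)).toEquiv).symm ξ =
      (permUnitary (hG.homeoR h).toEquiv).symm ((permUnitary (hG.homeoR g).toEquiv).symm ξ) :=
    lp.ext (funext fun η => congrArg ξ (hG.actR_mul g h η))
  rw [h]

/-- The automorphism of `A_ω` induced by `g`, which sends `f ∈ C_c(R_punc)` to `f ∘ α_g⁻¹`. -/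
def autOf (hG : S.IsSymmetryGroup G) (g : G) : S.TilingAlgebra ≃⋆ₐ[ℂ] S.TilingAlgebra where
  toFun a := ⟨hG.conj g a.1, hG.conj_mem g a.2⟩
  invFun a := ⟨hG.conj g⁻¹ a.1, hG.conj_mem g⁻¹ a.2⟩
  left_inv a := Subtype.ext (by
    change hG.conj g⁻¹ (hG.conj g a.1) = a.1
    rw [← conj_mul, inv_mul_cancel, conj_one])
  right_inv a := Subtype.ext (by
    change hG.conj g (hG.conj g⁻¹ a.1) = a.1
    rw [← conj_mul, mul_inv_cancel, conj_one])
  map_mul' a b := Subtype.ext (map_mul (hG.conj g) a.1 b.1)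
  map_add' a b := Subtype.ext (map_add (hG.conj g) a.1 b.1)
  map_star' a := Subtype.ext (map_star (hG.conj g) a.1)
  map_smul' c a := Subtype.ext (map_smul (hG.conj g) c a.1)

/-- The induced action of the symmetry group `G` on `A_ω`. -/
def action (hG : S.IsSymmetryGroup G) : G →* (S.TilingAlgebra ≃⋆ₐ[ℂ] S.TilingAlgebra) where
  toFun := hG.autOf
  map_one' := StarAlgEquiv.ext fun a => Subtype.ext (hG.conj_one a.1)
  map_mul' g h := StarAlgEquiv.ext fun a => Subtype.ext (hG.conj_mul g h a.1)

end SubstitutionSystem.IsSymmetryGroup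

/-! ### The weak Rokhlin property -/

/-- Positive elements of a C*-algebra. -/
def IsPositiveElement {A : Type*} [CStarAlgebra A] (a : A) : Prop := ∃ b : A, a = star b * b

/-- Normalized traces (tracial states) on a unital C*-algebra. -/
structure IsNormalizedTrace {A : Type*} [CStarAlgebra A] (τ : A →ₗ[ℂ] ℂ) : Prop where
  nonneg : ∀ a : A, 0 ≤ (τ (star a * a)).re ∧ (τ (star a * a)).im = 0
  map_one : τ 1 = 1
  tracial : ∀ a b : A, τ (a * b) = τ (b * a)

/-- The weak Rokhlin property of Matui and Sato for an action of a finite group on a unital simple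
C*-algebra with a nonempty space of normalized traces. (For unital C*-algebras, being simple
in the sense of closed two-sided ideals and in the algebraic sense are equivalent.) -/
structure HasWeakRokhlinProperty {A : Type*} [CStarAlgebra A] {G : Type*} [Group G] [Finite G]
    (α : G →* (A ≃⋆ₐ[ℂ] A)) : Prop where
  simple : IsSimpleRing A
  exists_trace : ∃ τ : A →ₗ[ℂ] ℂ, IsNormalizedTrace τ
  exists_seq : ∃ f : ℕ → A,
    (∀ n, IsPositiveElement (f n) ∧ IsPositiveElement (1 - f n)) ∧
    (∀ a : A, Tendsto (fun n => ‖f n * a - a * f n‖) atTop (𝓝 0)) ∧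
    (∀ g h : G, g ≠ h → Tendsto (fun n => ‖α g (f n) * α h (f n)‖) atTop (𝓝 0)) ∧
    (∀ ε : ℝ, 0 < ε → ∃ N : ℕ, ∀ n ≥ N, ∀ τ : A →ₗ[ℂ] ℂ, IsNormalizedTrace τ →
      ‖τ (f n) - (Nat.card G : ℂ)⁻¹‖ < ε)

end SubstTiling

end

/-! Injectivity of `ω` on the hull, together with surjectivity (a compactness argument), gives every
tiling a unique decomposition into supertiles of each order `n`. A punctured tiling is thereby
assigned the type `p` of the order-`n` supertile around the origin and the position `z` of the
origin in it. The sets where `(p, z)` is constant, the cells, form a finite clopen partition of the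
punctured hull (`mem_cell_unique`, `exists_mem_cell`, `isClopen_cell`).

Since `G` acts freely on the labels, there is a set `D` of orbit representatives. The Rokhlin
elements are diagonal: on the cell `(p, z)` the function is `min(1, dist(z, boundary) / r)` if `p ∈
D`, and zero otherwise. Three facts make this work.

Commutation. The function is Lipschitz with constant `1 / r` inside a supertile and tends to zero at
the boundary, so a translation by `x` changes it by at most `‖x‖ / r`, even across supertiles
(`norm_rokhlinFun_sub_le`). The algebra is the closed span of the operators `φ V_x` with `φ`
diagonal and `V_x` a shift (`tiling_induction`), so commutators vanish as `r → ∞`.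

Orthogonality. Rotating a tiling by `g` rotates the type of its supertile, so distinct group
elements move the function to disjoint sets of types, and the products are exactly zero.

Traces. Cells of one supertile type are equivalent projections, so a trace is given on them by a
single number, the frequency of the type. Frequencies satisfy a recursion with a positive matrix,
whose normalized nonnegative solution is unique by a Perron-Frobenius argument
(`IsFrequency.unique`). Hence they are `G`-invariant, and the types in `D` carry exactly `1 / #G` of
the mass. The cut-off near the boundary costs little: the boundary has dimension less than `d`, so
for large `n` few punctures of a supertile lie within `r` of it
(`eventually_card_nearPunctures_le`). The bound does not depend on the trace.

Simplicity follows from minimality and the absence of periods: compressing `a* a` to a small clopen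
set recovers a diagonal projection in any nonzero ideal, and finitely many shifts of it dominate the
unit. A trace arises as an ultrafilter limit of averages over the punctures of large supertiles. -/

noncomputable section

namespace SubstTiling

/-! ### Translation of collections of tiles. -/

section Translate

variable {d : ℕ} {ι : Type*}

theorem mem_translate {x : Euc d} {P : Set (Tile d ι)} {t : Tile d ι} :
    t ∈ translate x P ↔ (t.1, t.2 - x) ∈ P := by
  constructor
  · rintro ⟨s, hs, rfl⟩
    simpa [Tile.translate] using hs
  · intro h
    exact ⟨_, h, by simp [Tile.translate]⟩

theorem translate_mono {x : Euc d} {P Q : Set (Tile d ι)} (h : P ⊆ Q) :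
    translate x P ⊆ translate x Q := image_mono h

theorem translate_neg_translate (x : Euc d) (P : Set (Tile d ι)) :
    translate (-x) (translate x P) = P := by
  rw [translate_translate, add_neg_cancel, translate_zero]

theorem translate_translate_neg (x : Euc d) (P : Set (Tile d ι)) :
    translate x (translate (-x) P) = P := by
  rw [translate_translate, neg_add_cancel, translate_zero]

theorem translate_subset_iff {x : Euc d} {P Q : Set (Tile d ι)} :
    translate x P ⊆ Q ↔ P ⊆ translate (-x) Q := by
  constructor
  · intro h
    simpa [translate_neg_translate] using translate_mono (x := -x) h
  · intro h
    simpa [translate_translate_neg] using translate_mono (x := x) h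

end Translate

/-! ### Tiles, their interiors, and partial tilings. -/

namespace SubstitutionSystem

variable {d : ℕ} {ι : Type*} (S : SubstitutionSystem d ι)

/-- The interior of the carrier of a tile. -/
def inner (t : Tile d ι) : Set (Euc d) := interior (S.carrier t)

theorem scale_pos : 0 < S.scale := zero_lt_one.trans S.one_lt_scale

theorem scale_pow_ne_zero (n : ℕ) : S.scale ^ n ≠ 0 := pow_ne_zero _ S.scale_pos.ne'

theorem mem_carrier {t : Tile d ι} {y : Euc d} : y ∈ S.carrier t ↔ y - t.2 ∈ S.shape t.1 := by
  constructor
  · rintro ⟨z, hz, rfl⟩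
    simpa using hz
  · intro h
    exact ⟨_, h, by simp⟩

theorem mem_inner {t : Tile d ι} {y : Euc d} :
    y ∈ S.inner t ↔ y - t.2 ∈ interior (S.shape t.1) := by
  have h : S.inner t = (Homeomorph.addRight t.2) '' interior (S.shape t.1) := by
    rw [(Homeomorph.addRight t.2).image_interior]; rfl
  rw [h]
  constructor
  · rintro ⟨z, hz, rfl⟩
    simpa using hz
  · intro h
    exact ⟨_, h, by simp⟩

theorem isOpen_inner (t : Tile d ι) : IsOpen (S.inner t) := isOpen_interior

theorem inner_subset (t : Tile d ι) : S.inner t ⊆ S.carrier t := interior_subset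

theorem snd_mem_inner (t : Tile d ι) : t.2 ∈ S.inner t := by
  rw [mem_inner, sub_self]; exact S.zero_mem _

theorem snd_mem_carrier (t : Tile d ι) : t.2 ∈ S.carrier t := S.inner_subset t (S.snd_mem_inner t)

theorem isCompact_shape (p : ι) : IsCompact (S.shape p) := by
  obtain ⟨e⟩ := S.ball_homeo p
  have : CompactSpace (Metric.closedBall (0 : Euc d) 1) :=
    isCompact_iff_compactSpace.1 (isCompact_closedBall _ _)
  exact isCompact_iff_compactSpace.2 e.symm.compactSpace

theorem isCompact_carrier (t : Tile d ι) : IsCompact (S.carrier t) :=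
  (S.isCompact_shape t.1).image (by fun_prop)

theorem mem_supp {P : Set (Tile d ι)} {y : Euc d} : y ∈ S.supp P ↔ ∃ t ∈ P, y ∈ S.carrier t := by
  simp [supp, support, carrier]

theorem supp_mono {P Q : Set (Tile d ι)} (h : P ⊆ Q) : S.supp P ⊆ S.supp Q :=
  biUnion_subset_biUnion_left h

theorem isPartialTiling_iff {P : Set (Tile d ι)} : IsPartialTiling S.shape P ↔
    ∀ t ∈ P, ∀ t' ∈ P, (S.inner t ∩ S.inner t').Nonempty → t = t' := by
  refine forall₂_congr fun t _ => forall₂_congr fun t' _ => ?_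
  rw [← not_disjoint_iff_nonempty_inter]
  exact not_imp_comm

variable {S} in
theorem _root_.SubstTiling.IsPartialTiling.eq_of_inter {P : Set (Tile d ι)}
    (hP : IsPartialTiling S.shape P) {t t' : Tile d ι} (ht : t ∈ P) (ht' : t' ∈ P)
    {y : Euc d} (hy : y ∈ S.inner t) (hy' : y ∈ S.inner t') : t = t' :=
  S.isPartialTiling_iff.1 hP t ht t' ht' ⟨y, hy, hy'⟩

variable {S} in
-- A puncture is interior to its tile, so two tiles with a common puncture overlap.
theorem _root_.SubstTiling.IsPartialTiling.eq_of_snd {P : Set (Tile d ι)}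
    (hP : IsPartialTiling S.shape P) {t t' : Tile d ι} (ht : t ∈ P) (ht' : t' ∈ P)
    (h : t.2 = t'.2) : t = t' :=
  hP.eq_of_inter ht ht' (S.snd_mem_inner t) (h ▸ S.snd_mem_inner t')

theorem _root_.SubstTiling.IsPartialTiling.mono {P Q : Set (Tile d ι)}
    {shape : ι → Set (Euc d)} (hP : IsPartialTiling shape P) (h : Q ⊆ P) :
    IsPartialTiling shape Q := fun t ht t' ht' => hP t (h ht) t' (h ht')

theorem mem_inner_translate {t : Tile d ι} {x y : Euc d} :
    y ∈ S.inner (t.1, t.2 - x) ↔ y + x ∈ S.inner t := by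
  simp only [mem_inner]; rw [show y - (t.2 - x) = y + x - t.2 by abel]

theorem mem_carrier_translate {t : Tile d ι} {x y : Euc d} :
    y ∈ S.carrier (t.1, t.2 - x) ↔ y + x ∈ S.carrier t := by
  simp only [mem_carrier]; rw [show y - (t.2 - x) = y + x - t.2 by abel]

variable {S} in
theorem _root_.SubstTiling.IsPartialTiling.translate {P : Set (Tile d ι)}
    (hP : IsPartialTiling S.shape P) (x : Euc d) :
    IsPartialTiling S.shape (SubstTiling.translate x P) := by
  rw [isPartialTiling_iff]
  rintro t ht t' ht' ⟨y, hy, hy'⟩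
  rw [mem_translate] at ht ht'
  have := hP.eq_of_inter ht ht' (y := y - x) (by rw [mem_inner_translate]; simpa using hy)
    (by rw [mem_inner_translate]; simpa using hy')
  simp only [Prod.mk.injEq, sub_left_inj] at this
  exact Prod.ext this.1 this.2

theorem mem_supp_translate {P : Set (Tile d ι)} {x y : Euc d} :
    y ∈ S.supp (translate x P) ↔ y - x ∈ S.supp P := by
  simp only [mem_supp]
  constructor
  · rintro ⟨t, ht, hy⟩
    exact ⟨_, mem_translate.1 ht, by rw [mem_carrier_translate]; simpa using hy⟩
  · rintro ⟨t, ht, hy⟩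
    refine ⟨(t.1, t.2 + x), mem_translate.2 (by simpa using ht), ?_⟩
    rw [mem_carrier] at hy ⊢
    rwa [show y - (t.1, t.2 + x).2 = y - x - t.2 by simp; abel]

theorem IsTiling.translate {S : SubstitutionSystem d ι} {T : Set (Tile d ι)} (hT : S.IsTiling T)
    (x : Euc d) : S.IsTiling (SubstTiling.translate x T) := by
  refine ⟨hT.1.translate x, eq_univ_of_forall fun y => ?_⟩
  rw [mem_supp_translate, hT.2]; trivial

/-! ### The substitution -/

theorem mem_substMap {P : Set (Tile d ι)} {t : Tile d ι} :
    t ∈ S.substMap P ↔ ∃ s ∈ P, (t.1, t.2 - S.scale • s.2) ∈ S.subst s.1 := by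
  simp [substMap, mem_translate]

theorem substMap_mono {P Q : Set (Tile d ι)} (h : P ⊆ Q) : S.substMap P ⊆ S.substMap Q :=
  biUnion_subset_biUnion_left h

theorem substMap_translate (x : Euc d) (P : Set (Tile d ι)) :
    S.substMap (translate x P) = translate (S.scale • x) (S.substMap P) := by
  ext t
  simp only [mem_substMap, mem_translate]
  constructor
  · rintro ⟨s, hs, ht⟩
    refine ⟨_, hs, ?_⟩
    simpa [smul_sub] using ht
  · rintro ⟨s, hs, ht⟩
    refine ⟨(s.1, s.2 + x), by simpa using hs, ?_⟩
    simpa [smul_add, sub_sub, add_comm] using ht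

theorem iterate_mono (n : ℕ) {P Q : Set (Tile d ι)} (h : P ⊆ Q) :
    S.substMap^[n] P ⊆ S.substMap^[n] Q := by
  induction n with
  | zero => exact h
  | succ n ih =>
    rw [Function.iterate_succ_apply', Function.iterate_succ_apply']
    exact S.substMap_mono ih

theorem iterate_translate (n : ℕ) (x : Euc d) (P : Set (Tile d ι)) :
    S.substMap^[n] (translate x P) = translate (S.scale ^ n • x) (S.substMap^[n] P) := by
  induction n with
  | zero => simp
  | succ n ih =>
    rw [Function.iterate_succ_apply', Function.iterate_succ_apply', ih, substMap_translate,
      smul_smul, pow_succ']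

theorem mem_iterate (n : ℕ) {P : Set (Tile d ι)} {t : Tile d ι} :
    t ∈ S.substMap^[n] P ↔ ∃ s ∈ P, (t.1, t.2 - S.scale ^ n • s.2) ∈ S.supertile n s.1 := by
  induction n generalizing t with
  | zero =>
    simp only [Function.iterate_zero, id, pow_zero, one_smul, supertile, mem_singleton_iff,
      Prod.mk.injEq, sub_eq_zero]
    constructor
    · exact fun h => ⟨t, h, rfl, rfl⟩
    · rintro ⟨s, hs, h1, h2⟩
      rwa [Prod.ext h1 h2]
  | succ n ih =>
    simp only [Function.iterate_succ_apply', supertile, mem_substMap]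
    constructor
    · rintro ⟨r, hr, h⟩
      obtain ⟨s, hs, h'⟩ := ih.1 hr
      exact ⟨s, hs, _, h', by simpa [smul_sub, smul_smul, pow_succ'] using h⟩
    · rintro ⟨s, hs, r, hr, h⟩
      refine ⟨(r.1, r.2 + S.scale ^ n • s.2), ih.2 ⟨s, hs, by simpa [supertile] using hr⟩, ?_⟩
      simpa [smul_add, smul_smul, pow_succ', sub_sub, add_comm] using h

theorem iterate_singleton (n : ℕ) (t : Tile d ι) :
    S.substMap^[n] {t} = translate (S.scale ^ n • t.2) (S.supertile n t.1) := by
  ext s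
  rw [mem_iterate, mem_translate]
  simp

theorem supertile_add (n k : ℕ) (p : ι) :
    S.supertile (n + k) p = S.substMap^[n] (S.supertile k p) :=
  Function.iterate_add_apply _ _ _ _

theorem supp_substMap (P : Set (Tile d ι)) :
    S.supp (S.substMap P) = (fun y => S.scale • y) '' S.supp P := by
  ext y
  have key : ∀ p (z : Euc d), z ∈ S.supp (S.subst p) ↔ S.scale⁻¹ • z ∈ S.shape p := fun p z => by
    rw [supp, S.subst_support]
    constructor
    · rintro ⟨w, hw, rfl⟩
      simpa [smul_smul, S.scale_pos.ne'] using hw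
    · exact fun h => ⟨_, h, by simp [smul_smul, S.scale_pos.ne']⟩
  have : y ∈ S.supp (S.substMap P) ↔ ∃ s ∈ P, y - S.scale • s.2 ∈ S.supp (S.subst s.1) := by
    rw [mem_supp]
    constructor
    · rintro ⟨t, ht, hy⟩
      obtain ⟨s, hs, h⟩ := S.mem_substMap.1 ht
      refine ⟨s, hs, S.mem_supp.2 ⟨_, h, ?_⟩⟩
      rw [mem_carrier_translate]; simpa using hy
    · rintro ⟨s, hs, h⟩
      obtain ⟨t, ht, h⟩ := S.mem_supp.1 h
      refine ⟨(t.1, t.2 + S.scale • s.2), S.mem_substMap.2 ⟨s, hs, by simpa using ht⟩, ?_⟩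
      have := S.mem_carrier_translate (t := (t.1, t.2 + S.scale • s.2)) (x := S.scale • s.2)
        (y := y - S.scale • s.2)
      simpa [h] using this
  rw [this]
  simp only [key, mem_image, mem_supp]
  constructor
  · rintro ⟨s, hs, h⟩
    refine ⟨S.scale⁻¹ • y, ⟨s, hs, S.mem_carrier.2 ?_⟩, by simp [smul_smul, S.scale_pos.ne']⟩
    simpa [smul_sub, smul_smul, S.scale_pos.ne'] using h
  · rintro ⟨z, ⟨s, hs, h⟩, rfl⟩
    refine ⟨s, hs, ?_⟩
    simpa [smul_sub, smul_smul, S.scale_pos.ne', mem_carrier] using h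

theorem supp_iterate (n : ℕ) (P : Set (Tile d ι)) :
    S.supp (S.substMap^[n] P) = (fun y => S.scale ^ n • y) '' S.supp P := by
  induction n with
  | zero => simp
  | succ n ih =>
    rw [Function.iterate_succ_apply', supp_substMap, ih, image_image]
    simp [smul_smul, pow_succ']

theorem supp_singleton (t : Tile d ι) : S.supp {t} = S.carrier t := by
  ext y; simp [mem_supp]

theorem supp_supertile (n : ℕ) (p : ι) :
    S.supp (S.supertile n p) = (fun y => S.scale ^ n • y) '' S.shape p := by
  rw [supertile, supp_iterate, supp_singleton]
  congr 1
  simp [carrier]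

/-- The interior of a tile of `ω^n(s)` lies in the dilated interior of `s`. -/
theorem inner_subset_of_mem_iterate (n : ℕ) {s t : Tile d ι} (h : t ∈ S.substMap^[n] {s}) :
    S.inner t ⊆ (fun y => S.scale ^ n • y) '' S.inner s := by
  have h1 : S.carrier t ⊆ (fun y => S.scale ^ n • y) '' S.carrier s := by
    rw [← supp_singleton, ← supp_singleton, ← supp_iterate]
    exact S.supp_mono (singleton_subset_iff.2 h)
  have h2 := (Homeomorph.smulOfNeZero (S.scale ^ n) (S.scale_pow_ne_zero n)).image_interior
    (S.carrier s)
  have h3 : (fun y => S.scale ^ n • y) '' S.inner s =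
    interior ((fun y => S.scale ^ n • y) '' S.carrier s) := h2
  rw [h3]
  exact interior_mono h1

/-- Tiles of `ω^n(s)` and `ω^n(s')` overlap only if `s` and `s'` do. -/
theorem inter_of_mem_iterate (n : ℕ) {s s' t t' : Tile d ι} (h : t ∈ S.substMap^[n] {s})
    (h' : t' ∈ S.substMap^[n] {s'}) {y : Euc d} (hy : y ∈ S.inner t) (hy' : y ∈ S.inner t') :
    ∃ z ∈ S.inner s, z ∈ S.inner s' := by
  obtain ⟨z, hz, rfl⟩ := S.inner_subset_of_mem_iterate n h hy
  obtain ⟨z', hz', he⟩ := S.inner_subset_of_mem_iterate n h' hy'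
  have : z' = z := smul_right_injective _ (S.scale_pow_ne_zero n) he
  exact ⟨z, hz, this ▸ hz'⟩

theorem mem_iterate' (n : ℕ) {P : Set (Tile d ι)} {t : Tile d ι} :
    t ∈ S.substMap^[n] P ↔ ∃ s ∈ P, t ∈ S.substMap^[n] {s} := by
  rw [mem_iterate]
  simp only [iterate_singleton, mem_translate]

variable {S} in
-- The puncture of the common descendant, scaled back by `λ^(-n)`, is interior to both candidate
-- ancestors.
theorem _root_.SubstTiling.IsPartialTiling.parent_unique {P : Set (Tile d ι)}
    (hP : IsPartialTiling S.shape P) {n : ℕ} {s s' t : Tile d ι} (hs : s ∈ P) (hs' : s' ∈ P)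
    (h : t ∈ S.substMap^[n] {s}) (h' : t ∈ S.substMap^[n] {s'}) : s = s' := by
  obtain ⟨z, hz, hz'⟩ := S.inter_of_mem_iterate n h h' (S.snd_mem_inner t) (S.snd_mem_inner t)
  exact hP.eq_of_inter hs hs' hz hz'

variable {S} in
theorem _root_.SubstTiling.IsPartialTiling.substMap {P : Set (Tile d ι)}
    (hP : IsPartialTiling S.shape P) : IsPartialTiling S.shape (S.substMap P) := by
  rw [isPartialTiling_iff]
  rintro t ht t' ht' ⟨y, hy, hy'⟩
  obtain ⟨s, hs, h⟩ := (S.mem_iterate' 1).1 ht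
  obtain ⟨s', hs', h'⟩ := (S.mem_iterate' 1).1 ht'
  obtain ⟨z, hz, hz'⟩ := S.inter_of_mem_iterate 1 h h' hy hy'
  obtain rfl := hP.eq_of_inter hs hs' hz hz'
  have : IsPartialTiling S.shape (S.substMap^[1] {s}) := by
    have : S.substMap^[1] {s} = translate (S.scale • s.2) (S.subst s.1) := by
      simp [SubstitutionSystem.substMap]
    rw [this]
    exact IsPartialTiling.translate (S.subst_partial _) _
  exact this.eq_of_inter h h' hy hy'

variable {S} in
theorem _root_.SubstTiling.IsPartialTiling.iterate {P : Set (Tile d ι)}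
    (hP : IsPartialTiling S.shape P) (n : ℕ) : IsPartialTiling S.shape (S.substMap^[n] P) := by
  induction n with
  | zero => exact hP
  | succ n ih => rw [Function.iterate_succ_apply']; exact ih.substMap

theorem isPartialTiling_supertile (n : ℕ) (p : ι) : IsPartialTiling S.shape (S.supertile n p) := by
  refine IsPartialTiling.iterate ?_ n
  rw [isPartialTiling_iff]
  rintro t rfl t' rfl _
  rfl

theorem IsTiling.iterate {S : SubstitutionSystem d ι} {T : Set (Tile d ι)} (hT : S.IsTiling T)
    (n : ℕ) : S.IsTiling (S.substMap^[n] T) := by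
  refine ⟨hT.1.iterate n, ?_⟩
  rw [supp_iterate, hT.2, image_univ]
  exact range_eq_univ.2 fun y => ⟨(S.scale ^ n)⁻¹ • y, by
    simp [smul_smul, S.scale_pow_ne_zero n]⟩

theorem finite_of_subset_iterate (n : ℕ) {P Q : Set (Tile d ι)} (hQ : Q.Finite)
    (h : Q ⊆ S.substMap^[n] P) : ∃ P' ⊆ P, P'.Finite ∧ Q ⊆ S.substMap^[n] P' := by
  have : ∀ t : Q, ∃ s ∈ P, t.1 ∈ S.substMap^[n] {s} := fun t => (S.mem_iterate' n).1 (h t.2)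
  choose f hf hf' using this
  have := hQ.to_subtype
  refine ⟨range f, range_subset_iff.2 hf, finite_range f, fun t ht => ?_⟩
  exact (S.mem_iterate' n).2 ⟨f ⟨t, ht⟩, mem_range_self _, hf' ⟨t, ht⟩⟩

/-! ### Metric bounds and measure -/

theorem dim_pos (S : SubstitutionSystem d ι) : 0 < d := by
  obtain ⟨s, K, h0, h1, -⟩ := S.capacity
  exact_mod_cast h0.trans_lt h1

theorem exists_inner_radius [Finite ι] :
    ∃ ρ : ℝ, 0 < ρ ∧ ∀ p, Metric.ball (0 : Euc d) ρ ⊆ interior (S.shape p) := by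
  have := fun p => Metric.isOpen_iff.1 isOpen_interior _ (S.zero_mem p)
  choose r hr h using this
  rcases isEmpty_or_nonempty ι with h0 | h0
  · exact ⟨1, one_pos, fun p => isEmptyElim p⟩
  · obtain ⟨p, hp⟩ := Finite.exists_min r
    exact ⟨r p, hr p, fun q => (Metric.ball_subset_ball (hp q)).trans (h q)⟩

theorem exists_outer_radius [Finite ι] :
    ∃ D : ℝ, 0 < D ∧ ∀ p, ∀ y ∈ S.shape p, ‖y‖ ≤ D := by
  have : Bornology.IsBounded (⋃ p, S.shape p) :=
    Bornology.isBounded_iUnion.2 fun p => (S.isCompact_shape p).isBounded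
  obtain ⟨D, hD, h⟩ := this.exists_pos_norm_le
  exact ⟨D, hD, fun p y hy => h y (mem_iUnion.2 ⟨p, hy⟩)⟩

theorem dist_le_of_mem_carrier {D : ℝ} (hD : ∀ p, ∀ y ∈ S.shape p, ‖y‖ ≤ D) {t : Tile d ι}
    {y : Euc d} (hy : y ∈ S.carrier t) : ‖y - t.2‖ ≤ D := hD _ _ (S.mem_carrier.1 hy)

open MeasureTheory in
-- At most `K ε^(-s)` balls of volume `c ε^d` cover the boundary, so its measure is at most `K c
-- ε^(d-s)`, which tends to zero because `s < d`.
theorem volume_frontier_shape (p : ι) : volume (frontier (S.shape p)) = 0 := by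
  obtain ⟨s, K, h0, h1, h⟩ := S.capacity
  have : Nonempty (Fin d) := ⟨⟨0, S.dim_pos⟩⟩
  set c := volume (Metric.ball (0 : Euc d) 1) with hc
  have hcfin : c ≠ ⊤ := measure_ball_lt_top.ne
  have hbound : ∀ ε : ℝ, 0 < ε → ε ≤ 1 →
      volume (frontier (S.shape p)) ≤ ENNReal.ofReal (K * ε ^ ((d : ℝ) - s)) * c := by
    intro ε hε hε1
    obtain ⟨C, hC, hcov⟩ := h ε hε hε1 p
    calc volume (frontier (S.shape p)) ≤ volume (⋃ x ∈ C, Metric.ball x ε) := measure_mono hcov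
      _ ≤ ∑ x ∈ C, volume (Metric.ball x ε) := measure_biUnion_finset_le _ _
      _ = ∑ x ∈ C, ENNReal.ofReal (ε ^ d) * c := by
          refine Finset.sum_congr rfl fun x _ => ?_
          rw [Measure.addHaar_ball _ _ hε.le]
          simp [c]
      _ = ENNReal.ofReal (C.card * ε ^ d) * c := by
          rw [Finset.sum_const, nsmul_eq_mul, ENNReal.ofReal_mul (by positivity), mul_assoc]
          simp
      _ ≤ _ := by
          gcongr ENNReal.ofReal ?_ * _
          calc (C.card : ℝ) * ε ^ d ≤ K * ε ^ (-s) * ε ^ d := by gcongr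
            _ = _ := by
              rw [mul_assoc, ← Real.rpow_natCast ε d, ← Real.rpow_add hε]
              ring_nf
  have hlim : Tendsto (fun ε : ℝ => ENNReal.ofReal (K * ε ^ ((d : ℝ) - s)) * c) (𝓝[>] 0)
      (𝓝 0) := by
    have h1 : Tendsto (fun ε : ℝ => ε ^ ((d : ℝ) - s)) (𝓝[>] 0) (𝓝 0) := by
      have := (Real.continuousAt_rpow_const 0 ((d : ℝ) - s) (Or.inr (by linarith))).tendsto
      rw [Real.zero_rpow (by linarith)] at this
      exact this.mono_left nhdsWithin_le_nhds
    have h2 := ENNReal.tendsto_ofReal (h1.const_mul K)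
    have h3 := ENNReal.Tendsto.mul_const h2 (Or.inr hcfin)
    simpa using h3
  refine le_antisymm (ge_of_tendsto hlim ?_) (zero_le)
  filter_upwards [Ioc_mem_nhdsGT (zero_lt_one' ℝ)] with ε hε
  exact hbound ε hε.1 hε.2

open MeasureTheory in
theorem volume_carrier_diff_inner (t : Tile d ι) : volume (S.carrier t \ S.inner t) = 0 := by
  have h : S.carrier t \ S.inner t ⊆ (fun y => y + t.2) '' frontier (S.shape t.1) := by
    rintro y ⟨hy, hy'⟩
    rw [mem_carrier] at hy
    rw [mem_inner] at hy'
    exact ⟨y - t.2, ⟨subset_closure hy, hy'⟩, by simp⟩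
  refine measure_mono_null h ?_
  rw [image_add_right, measure_preimage_add_right]
  exact S.volume_frontier_shape _

variable {S} in
theorem _root_.SubstTiling.IsPartialTiling.countable {P : Set (Tile d ι)}
    (hP : IsPartialTiling S.shape P) : P.Countable := by
  refine Set.PairwiseDisjoint.countable_of_isOpen (s := S.inner) ?_ (fun t _ => S.isOpen_inner t)
    (fun t _ => ⟨_, S.snd_mem_inner t⟩)
  intro t ht t' ht' hne
  exact hP t ht t' ht' hne

open MeasureTheory in
variable {S} in
/-- An open set covered by a partial tiling meets the interior of one of the tiles. -/
theorem _root_.SubstTiling.IsPartialTiling.exists_inner_inter {P : Set (Tile d ι)}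
    (hP : IsPartialTiling S.shape P) {U : Set (Euc d)} (hU : IsOpen U) (hne : U.Nonempty)
    (hsub : U ⊆ S.supp P) : ∃ t ∈ P, ∃ y ∈ U, y ∈ S.inner t := by
  by_contra! hcon
  -- Otherwise `U` would be covered by the countably many tile boundaries, which are null sets,
  -- although a nonempty open set has positive volume.
  have h : U ⊆ ⋃ t ∈ P, (S.carrier t \ S.inner t) := by
    intro y hy
    obtain ⟨t, ht, hyt⟩ := S.mem_supp.1 (hsub hy)
    exact mem_iUnion₂.2 ⟨t, ht, hyt, hcon t ht y hy⟩
  have h0 : volume U = 0 := measure_mono_null h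
    ((measure_biUnion_null_iff hP.countable).2 fun t _ => S.volume_carrier_diff_inner t)
  exact (hU.measure_pos volume hne).ne' h0

variable {S} in
-- The interior of `t` meets the interior of some tile of `P`, and overlapping tiles of `T`
-- coincide. This is how an inclusion of regions becomes an inclusion of patches.
theorem _root_.SubstTiling.IsPartialTiling.absorb {P T : Set (Tile d ι)}
    (hT : IsPartialTiling S.shape T) (hPT : P ⊆ T) {t : Tile d ι} (ht : t ∈ T)
    (hsub : S.inner t ⊆ S.supp P) : t ∈ P := by
  obtain ⟨s, hs, y, hy, hys⟩ := (hT.mono hPT).exists_inner_inter (S.isOpen_inner t)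
    ⟨_, S.snd_mem_inner t⟩ hsub
  rwa [hT.eq_of_inter ht (hPT hs) hy hys]

theorem IsTiling.eq_of_subset {S : SubstitutionSystem d ι} {T T' : Set (Tile d ι)}
    (hT : S.IsTiling T) (hT' : IsPartialTiling S.shape T') (h : T ⊆ T') : T = T' :=
  h.antisymm fun t ht => hT'.absorb h ht (by rw [hT.2]; exact subset_univ _)

end SubstitutionSystem

end SubstTiling

namespace SubstTiling
namespace SubstitutionSystem

variable {d : ℕ} {ι : Type*} (S : SubstitutionSystem d ι)

/-! ### Counting punctures -/

/-- If `s` missed the frontier, the interior of `t` and the complement of its closure would separate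
`s`. -/
theorem _root_.IsPreconnected.exists_mem_frontier {X : Type*} [TopologicalSpace X] {s t : Set X}
    (hs : IsPreconnected s) {x y : X} (hx : x ∈ s) (hxt : x ∈ t) (hy : y ∈ s) (hyt : y ∉ t) :
    ∃ z ∈ s, z ∈ frontier t := by
  by_contra! h
  have h1 : ∀ z ∈ s, z ∈ closure t → z ∈ interior t := fun z hz hc => by
    by_contra hi
    exact h z hz ⟨hc, hi⟩
  obtain ⟨z, hz, hz1, hz2⟩ := hs (interior t) (closure t)ᶜ isOpen_interior
    isClosed_closure.isOpen_compl
    (fun z hz => by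
      by_cases hc : z ∈ closure t
      · exact Or.inl (h1 z hz hc)
      · exact Or.inr hc)
    ⟨x, hx, h1 x hx (subset_closure hxt)⟩
    ⟨y, hy, fun hc => hyt (interior_subset (h1 y hy hc))⟩
  exact hz2 (subset_closure (interior_subset hz1))

open MeasureTheory in
/-- Packing bound: the number of punctures of a partial tiling in a ball of radius `R`. -/
theorem exists_packing_bound [Finite ι] (R : ℝ) : ∃ C : ℝ, 0 ≤ C ∧ ∀ P : Set (Tile d ι),
    IsPartialTiling S.shape P → ∀ (c : Euc d) (Z : Finset (Euc d)),
      (∀ z ∈ Z, ‖z - c‖ ≤ R ∧ ∃ q, ((q, z) : Tile d ι) ∈ P) → (Z.card : ℝ) ≤ C := by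
  obtain ⟨ρ, hρ, hball⟩ := S.exists_inner_radius
  -- Balls of radius `ρ` about the punctures lie inside the tiles, hence are disjoint, and they fit
  -- into a ball of radius `max R 0 + ρ`; the constant is the ratio of volumes. The maximum keeps it
  -- nonnegative for `R < 0`.
  refine ⟨((max R 0 + ρ) / ρ) ^ d, by positivity, fun P hP c Z hZ => ?_⟩
  have hin : ∀ t : Tile d ι, Metric.ball t.2 ρ ⊆ S.inner t := fun t y hy => by
    rw [mem_inner]
    exact hball _ (by simpa [dist_eq_norm] using hy)
  have : Nonempty (Fin d) := ⟨⟨0, S.dim_pos⟩⟩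
  set v := volume (Metric.ball (0 : Euc d) 1) with hv
  have hvfin : v ≠ ⊤ := measure_ball_lt_top.ne
  have hv0 : v ≠ 0 := (Metric.measure_ball_pos _ _ one_pos).ne'
  have hdisj : (Z : Set (Euc d)).PairwiseDisjoint fun z => Metric.ball z ρ := by
    intro z hz z' hz' hne
    obtain ⟨-, q, hq⟩ := hZ z hz
    obtain ⟨-, q', hq'⟩ := hZ z' hz'
    refine disjoint_left.2 fun y hy hy' => hne ?_
    have := hP.eq_of_inter hq hq' (hin (q, z) hy) (hin (q', z') hy')
    exact congrArg Prod.snd this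
  have hsub : (⋃ z ∈ Z, Metric.ball z ρ) ⊆ Metric.ball c (max R 0 + ρ) := by
    intro y hy
    obtain ⟨z, hz, hy⟩ := mem_iUnion₂.1 hy
    have h1 := (hZ z hz).1
    rw [Metric.mem_ball] at hy ⊢
    rw [← dist_eq_norm] at h1
    linarith [dist_triangle y z c, le_max_left R 0]
  have hd : Module.finrank ℝ (Euc d) = d := by simp
  have hle : (Z.card : ENNReal) * (ENNReal.ofReal (ρ ^ d) * v) ≤
      ENNReal.ofReal ((max R 0 + ρ) ^ d) * v := by
    calc _ = ∑ z ∈ Z, volume (Metric.ball z ρ) := by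
          rw [Finset.sum_congr rfl fun z _ => Measure.addHaar_ball volume z hρ.le, hd,
            Finset.sum_const, nsmul_eq_mul]
      _ = volume (⋃ z ∈ Z, Metric.ball z ρ) :=
          (measure_biUnion_finset hdisj fun z _ => Metric.isOpen_ball.measurableSet).symm
      _ ≤ volume (Metric.ball c (max R 0 + ρ)) := measure_mono hsub
      _ = _ := by rw [Measure.addHaar_ball _ _ (by positivity), hd]
  rw [← mul_assoc, ENNReal.mul_le_mul_iff_left hv0 hvfin, ← ENNReal.ofReal_natCast,
    ← ENNReal.ofReal_mul (by positivity), ENNReal.ofReal_le_ofReal_iff (by positivity)] at hle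
  rw [div_pow, le_div_iff₀ (by positivity)]
  exact hle

variable {S} in
theorem _root_.SubstTiling.IsPartialTiling.finite_of_norm_le [Finite ι] {P : Set (Tile d ι)}
    (hP : IsPartialTiling S.shape P) (R : ℝ) : {t ∈ P | ‖t.2‖ ≤ R}.Finite := by
  obtain ⟨C, -, hC⟩ := S.exists_packing_bound R
  have hfin : {z : Euc d | ‖z‖ ≤ R ∧ ∃ q, ((q, z) : Tile d ι) ∈ P}.Finite := by
    by_contra hinf
    obtain ⟨n, hn⟩ := exists_nat_gt C
    obtain ⟨Z, hZ, hcard⟩ := Set.Infinite.exists_subset_card_eq hinf n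
    have := hC P hP 0 Z fun z hz => by simpa using hZ hz
    rw [hcard] at this
    linarith
  refine (finite_univ.prod hfin).subset ?_
  rintro ⟨q, z⟩ ⟨ht, hz⟩
  exact ⟨trivial, hz, q, ht⟩

theorem norm_le_of_mem_supertile {D : ℝ} (hD : ∀ p, ∀ y ∈ S.shape p, ‖y‖ ≤ D) {n : ℕ} {p : ι}
    {y : Euc d} (hy : y ∈ S.supp (S.supertile n p)) : ‖y‖ ≤ S.scale ^ n * D := by
  rw [supp_supertile] at hy
  obtain ⟨z, hz, rfl⟩ := hy
  have hs := S.scale_pos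
  rw [norm_smul, Real.norm_of_nonneg (by positivity)]
  exact mul_le_mul_of_nonneg_left (hD p z hz) (by positivity)

theorem finite_supertile [Finite ι] (n : ℕ) (p : ι) : (S.supertile n p).Finite := by
  obtain ⟨D, -, hD⟩ := S.exists_outer_radius
  refine ((S.isPartialTiling_supertile n p).finite_of_norm_le (S.scale ^ n * D)).subset ?_
  exact fun t ht => ⟨ht, S.norm_le_of_mem_supertile hD (S.mem_supp.2 ⟨t, ht, S.snd_mem_carrier t⟩)⟩

theorem finite_punctures [Finite ι] (n : ℕ) (p : ι) :
    {z : Euc d | ∃ q, ((q, z) : Tile d ι) ∈ S.supertile n p}.Finite := by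
  refine ((S.finite_supertile n p).image Prod.snd).subset ?_
  rintro z ⟨q, h⟩
  exact ⟨_, h, rfl⟩

/-- The punctures of the supertile `ω^n(p)`. -/
def punctures [Finite ι] (n : ℕ) (p : ι) : Finset (Euc d) := (S.finite_punctures n p).toFinset

theorem mem_punctures [Finite ι] {n : ℕ} {p : ι} {z : Euc d} :
    z ∈ S.punctures n p ↔ ∃ q, ((q, z) : Tile d ι) ∈ S.supertile n p := by
  simp [punctures]

theorem supertile_nonempty (n : ℕ) (p : ι) : (S.supertile n p).Nonempty := by
  have : (0 : Euc d) ∈ S.supp (S.supertile n p) := by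
    rw [supp_supertile]
    exact ⟨0, interior_subset (S.zero_mem p), by simp⟩
  obtain ⟨t, ht, -⟩ := S.mem_supp.1 this
  exact ⟨t, ht⟩

theorem punctures_nonempty [Finite ι] (n : ℕ) (p : ι) : (S.punctures n p).Nonempty := by
  obtain ⟨t, ht⟩ := S.supertile_nonempty n p
  exact ⟨t.2, S.mem_punctures.2 ⟨t.1, ht⟩⟩

theorem isCompact_supp_supertile (n : ℕ) (p : ι) : IsCompact (S.supp (S.supertile n p)) := by
  rw [supp_supertile]
  exact (S.isCompact_shape p).image (by fun_prop)

theorem compl_supp_supertile_nonempty (n : ℕ) (p : ι) :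
    (S.supp (S.supertile n p))ᶜ.Nonempty := by
  have : Nonempty (Fin d) := ⟨⟨0, S.dim_pos⟩⟩
  have : Nontrivial (Euc d) := inferInstance
  rw [nonempty_compl]
  intro h
  exact NormedSpace.unbounded_univ ℝ (Euc d) (h ▸ (S.isCompact_supp_supertile n p).isBounded)

open MeasureTheory in
-- The supertile contains the ball of radius `λ^n ρ`, while every tile lies in the ball of radius
-- `D` about its puncture; the volumes are compared.
theorem exists_card_punctures_lower [Finite ι] :
    ∃ c : ℝ, 0 < c ∧ ∀ n p, c * (S.scale ^ n) ^ d ≤ (S.punctures n p).card := by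
  obtain ⟨ρ, hρ, hball⟩ := S.exists_inner_radius
  obtain ⟨D, hD0, hD⟩ := S.exists_outer_radius
  refine ⟨(ρ / D) ^ d, by positivity, fun n p => ?_⟩
  have hs := S.scale_pos
  have : Nonempty (Fin d) := ⟨⟨0, S.dim_pos⟩⟩
  set v := volume (Metric.ball (0 : Euc d) 1) with hv
  have hvfin : v ≠ ⊤ := measure_ball_lt_top.ne
  have hv0 : v ≠ 0 := (Metric.measure_ball_pos _ _ one_pos).ne'
  have hd : Module.finrank ℝ (Euc d) = d := by simp
  have hsub : Metric.ball (0 : Euc d) (S.scale ^ n * ρ) ⊆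
      ⋃ z ∈ S.punctures n p, Metric.closedBall z D := by
    intro y hy
    have : y ∈ S.supp (S.supertile n p) := by
      rw [supp_supertile]
      refine ⟨(S.scale ^ n)⁻¹ • y, interior_subset (hball p ?_), by
        simp [smul_smul, S.scale_pow_ne_zero n]⟩
      rw [mem_ball_zero_iff] at hy ⊢
      rw [norm_smul, Real.norm_of_nonneg (by positivity), inv_mul_lt_iff₀ (by positivity)]
      exact hy
    obtain ⟨t, ht, hy⟩ := S.mem_supp.1 this
    refine mem_iUnion₂.2 ⟨t.2, S.mem_punctures.2 ⟨t.1, ht⟩, ?_⟩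
    rw [Metric.mem_closedBall, dist_eq_norm]
    exact S.dist_le_of_mem_carrier hD hy
  have hle : ENNReal.ofReal ((S.scale ^ n * ρ) ^ d) * v ≤
      ((S.punctures n p).card : ENNReal) * (ENNReal.ofReal (D ^ d) * v) := by
    calc _ = volume (Metric.ball (0 : Euc d) (S.scale ^ n * ρ)) := by
          rw [Measure.addHaar_ball _ _ (by positivity), hd]
      _ ≤ volume (⋃ z ∈ S.punctures n p, Metric.closedBall z D) := measure_mono hsub
      _ ≤ ∑ z ∈ S.punctures n p, volume (Metric.closedBall z D) := measure_biUnion_finset_le _ _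
      _ = _ := by
          rw [Finset.sum_congr rfl fun z _ => Measure.addHaar_closedBall volume z hD0.le, hd,
            Finset.sum_const, nsmul_eq_mul]
  rw [← mul_assoc, ENNReal.mul_le_mul_iff_left hv0 hvfin, ← ENNReal.ofReal_natCast,
    ← ENNReal.ofReal_mul (by positivity), ENNReal.ofReal_le_ofReal_iff (by positivity)] at hle
  rw [div_pow, div_mul_eq_mul_div, div_le_iff₀ (by positivity), ← mul_pow, mul_comm ρ]
  exact hle

open Classical in
/-- The punctures of `ω^n(p)` at distance less than `r` from the complement of `ω^n(p)`. -/
def nearPunctures [Finite ι] (n : ℕ) (p : ι) (r : ℝ) : Finset (Euc d) :=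
  {z ∈ S.punctures n p | Metric.infDist z (S.supp (S.supertile n p))ᶜ < r}

theorem mem_nearPunctures [Finite ι] {n : ℕ} {p : ι} {r : ℝ} {z : Euc d} :
    z ∈ S.nearPunctures n p r ↔
      z ∈ S.punctures n p ∧ Metric.infDist z (S.supp (S.supertile n p))ᶜ < r := by
  classical
  rw [nearPunctures, Finset.mem_filter]

/-- The boundary of a prototile is covered by about `λ^(ns)` balls of radius `λ^(-n)`, which become
unit balls after expansion. Each puncture near the boundary is within `r + 1` of one of the expanded
centres, and the packing bound limits how many share a centre. -/
theorem exists_card_nearPunctures_upper [Finite ι] : ∃ s : ℝ, s < d ∧ ∀ r : ℝ,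
    ∃ C : ℝ, ∀ n p, ((S.nearPunctures n p r).card : ℝ) ≤ C * (S.scale ^ n) ^ s := by
  classical
  obtain ⟨s, K, h0, h1, h⟩ := S.capacity
  refine ⟨s, h1, fun r => ?_⟩
  obtain ⟨C, hC0, hC⟩ := S.exists_packing_bound (r + 1)
  refine ⟨K * C, fun n p => ?_⟩
  have hs := S.scale_pos
  have hpos : 0 < S.scale ^ n := by positivity
  obtain ⟨B, hBc, hB⟩ := h (S.scale ^ n)⁻¹ (by positivity)
    (inv_le_one_of_one_le₀ (one_le_pow₀ S.one_lt_scale.le)) p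
  have hsub : S.nearPunctures n p r ⊆ B.biUnion fun c =>
      {z ∈ S.punctures n p | ‖z - S.scale ^ n • c‖ ≤ r + 1} := by
    intro z hz
    obtain ⟨hz, hzr⟩ := S.mem_nearPunctures.1 hz
    obtain ⟨w, hw, hzw⟩ := (Metric.infDist_lt_iff (S.compl_supp_supertile_nonempty n p)).1 hzr
    obtain ⟨q, hq⟩ := S.mem_punctures.1 hz
    have hzs : z ∈ S.supp (S.supertile n p) := S.mem_supp.2 ⟨_, hq, S.snd_mem_carrier _⟩
    -- The segment from `z` to an outside point `w` crosses the boundary of the supertile, at a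
    -- point no farther from `z` than `w` is.
    obtain ⟨u, hu, huf⟩ := (convex_segment (𝕜 := ℝ) z w).isPreconnected.exists_mem_frontier
      (left_mem_segment ℝ z w) hzs (right_mem_segment ℝ z w) hw
    have huz : dist u z ≤ dist z w := by
      have := (convex_closedBall z (dist z w)).segment_subset
        (Metric.mem_closedBall_self dist_nonneg) (by simp [dist_comm]) hu
      simpa using this
    have h2 := (Homeomorph.smulOfNeZero (S.scale ^ n) (S.scale_pow_ne_zero n)).image_frontier
      (S.shape p)
    rw [supp_supertile] at huf
    rw [show (fun y : Euc d => S.scale ^ n • y) '' S.shape p =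
      (Homeomorph.smulOfNeZero (S.scale ^ n) (S.scale_pow_ne_zero n)) '' S.shape p from rfl,
      ← h2] at huf
    obtain ⟨u', hu', rfl⟩ := huf
    obtain ⟨c, hc, hcu⟩ := mem_iUnion₂.1 (hB hu')
    refine Finset.mem_biUnion.2 ⟨c, hc, Finset.mem_filter.2 ⟨hz, ?_⟩⟩
    have h3 : dist (S.scale ^ n • u') (S.scale ^ n • c) < 1 := by
      rw [dist_smul₀, Real.norm_of_nonneg hpos.le]
      rw [Metric.mem_ball] at hcu
      calc _ < S.scale ^ n * (S.scale ^ n)⁻¹ := mul_lt_mul_of_pos_left hcu hpos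
        _ = 1 := mul_inv_cancel₀ hpos.ne'
    have huz' : dist (S.scale ^ n • u') z ≤ dist z w := huz
    rw [← dist_eq_norm]
    have := dist_triangle z (S.scale ^ n • u') (S.scale ^ n • c)
    rw [dist_comm] at huz'
    linarith
  have hcard : ((S.nearPunctures n p r).card : ℝ) ≤ B.card * C := by
    calc ((S.nearPunctures n p r).card : ℝ)
        ≤ ((∑ c ∈ B, (Finset.filter (fun z => ‖z - S.scale ^ n • c‖ ≤ r + 1)
            (S.punctures n p)).card : ℕ) : ℝ) := by
          exact_mod_cast (Finset.card_le_card hsub).trans Finset.card_biUnion_le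
      _ ≤ ∑ c ∈ B, C := by
          push_cast
          refine Finset.sum_le_sum fun c _ => hC _ (S.isPartialTiling_supertile n p)
            (S.scale ^ n • c) _ fun z hz => ?_
          rw [Finset.mem_filter, mem_punctures] at hz
          exact ⟨hz.2, hz.1⟩
      _ = _ := by simp
  have hpow : ((S.scale ^ n)⁻¹) ^ (-s) = (S.scale ^ n) ^ s := by
    rw [Real.inv_rpow hpos.le, Real.rpow_neg hpos.le, inv_inv]
  rw [hpow] at hBc
  calc _ ≤ _ := hcard
    _ ≤ K * (S.scale ^ n) ^ s * C := by gcongr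
    _ = _ := by ring

/-- Most punctures of large supertiles are far from the boundary. -/
theorem eventually_card_nearPunctures_le [Finite ι] (r : ℝ) {ε : ℝ} (hε : 0 < ε) :
    ∀ᶠ n in atTop, ∀ p, ((S.nearPunctures n p r).card : ℝ) ≤ ε * (S.punctures n p).card := by
  obtain ⟨s, hs, h⟩ := S.exists_card_nearPunctures_upper
  obtain ⟨C, hC⟩ := h r
  obtain ⟨c, hc, hlow⟩ := S.exists_card_punctures_lower
  -- Up to constants, `λ^(n(s-d))` is the ratio of the upper bound for near punctures to the lower
  -- bound for all punctures.
  have h1 : Tendsto (fun n : ℕ => C * (S.scale ^ n) ^ (s - d)) atTop (𝓝 (C * 0)) := by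
    refine Tendsto.const_mul C ?_
    have h2 : Tendsto (fun n : ℕ => S.scale ^ n) atTop atTop :=
      tendsto_pow_atTop_atTop_of_one_lt S.one_lt_scale
    have h3 := (tendsto_rpow_neg_atTop (show 0 < (d : ℝ) - s by linarith)).comp h2
    simpa [Function.comp_def] using h3
  rw [mul_zero] at h1
  filter_upwards [h1.eventually (gt_mem_nhds (show 0 < ε * c by positivity))] with n hn p
  have hpos : 0 < S.scale ^ n := pow_pos S.scale_pos n
  refine (hC n p).trans ?_
  calc C * (S.scale ^ n) ^ s = C * (S.scale ^ n) ^ (s - d) * (S.scale ^ n) ^ d := by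
        rw [mul_assoc, ← Real.rpow_natCast (S.scale ^ n) d, ← Real.rpow_add hpos]; ring_nf
    _ ≤ ε * c * (S.scale ^ n) ^ d := by gcongr
    _ = ε * (c * (S.scale ^ n) ^ d) := by ring
    _ ≤ _ := by gcongr; exact hlow n p

end SubstitutionSystem
end SubstTiling

namespace SubstTiling
namespace SubstitutionSystem

variable {d : ℕ} {ι : Type*} {S : SubstitutionSystem d ι}

/-! ### The hull -/

theorem hull_translate {T : Set (Tile d ι)} (hT : T ∈ S.hull) (x : Euc d) :
    translate x T ∈ S.hull := by
  refine ⟨hT.1.translate x, fun P hP hfin => ?_⟩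
  obtain ⟨y, p, n, h⟩ := hT.2 (translate (-x) P) (by
    rw [translate_subset_iff, neg_neg]; exact hP) (hfin.image _)
  refine ⟨y + x, p, n, ?_⟩
  rw [translate_subset_iff, neg_neg, translate_translate] at h
  exact h

theorem hull_iterate {T : Set (Tile d ι)} (hT : T ∈ S.hull) (n : ℕ) :
    S.substMap^[n] T ∈ S.hull := by
  refine ⟨hT.1.iterate n, fun P hP hfin => ?_⟩
  obtain ⟨Q, hQ, hQfin, hPQ⟩ := S.finite_of_subset_iterate n hfin hP
  obtain ⟨y, p, k, h⟩ := hT.2 Q hQ hQfin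
  refine ⟨S.scale ^ n • y, p, n + k, hPQ.trans ?_⟩
  rw [supertile_add, ← iterate_translate]
  exact S.iterate_mono n h

theorem supertile_subset {n k : ℕ} {p q : ι} {w : Euc d}
    (h : ((p, w) : Tile d ι) ∈ S.supertile k q) :
    translate (S.scale ^ n • w) (S.supertile n p) ⊆ S.supertile (n + k) q := by
  rw [supertile_add]
  have := S.iterate_mono n (singleton_subset_iff.2 h)
  rwa [iterate_singleton] at this

theorem mem_supertile_add {n k : ℕ} {q : ι} {t : Tile d ι} : t ∈ S.supertile (n + k) q ↔
    ∃ s ∈ S.supertile k q, t ∈ translate (S.scale ^ n • s.2) (S.supertile n s.1) := by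
  rw [supertile_add, mem_iterate]
  simp only [mem_translate]

theorem IsPrimitive.exists_parent (h : S.IsPrimitive) (q : ι) :
    ∃ (q' : ι) (w : Euc d), ((q, w) : Tile d ι) ∈ S.supertile 1 q' := by
  obtain ⟨N, hN⟩ := h
  rcases N with _ | N
  -- With `N = 0`, primitivity forces all labels to coincide, so any tile of `ω(q)` has type `q`.
  · obtain ⟨⟨q', w⟩, ht⟩ := S.supertile_nonempty 1 q
    obtain ⟨x, hx⟩ := hN q' q
    have : q = q' := congrArg Prod.fst hx
    exact ⟨q, w, this ▸ ht⟩
  · obtain ⟨x, hx⟩ := hN q q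
    rw [add_comm, mem_supertile_add] at hx
    obtain ⟨s, -, hs⟩ := hx
    exact ⟨s.1, _, mem_translate.1 hs⟩

theorem IsPrimitive.exists_ancestor (h : S.IsPrimitive) (k : ℕ) (q : ι) :
    ∃ (q' : ι) (w : Euc d), ((q, w) : Tile d ι) ∈ S.supertile k q' := by
  induction k generalizing q with
  | zero => exact ⟨q, 0, rfl⟩
  | succ k ih =>
    obtain ⟨r, w, hw⟩ := ih q
    obtain ⟨q', v, hv⟩ := h.exists_parent r
    exact ⟨q', w + S.scale ^ k • v,
      mem_supertile_add.2 ⟨_, hv, mem_translate.2 (by simpa using hw)⟩⟩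

/-- A patch in a supertile also lies in a supertile of large order. -/
theorem IsPrimitive.exists_large_supertile (h : S.IsPrimitive) {T P : Set (Tile d ι)}
    (hT : T ∈ S.hull) (hP : P ⊆ T) (hfin : P.Finite) (k : ℕ) :
    ∃ (x : Euc d) (p : ι) (n : ℕ), P ⊆ translate x (S.supertile (k + n) p) := by
  obtain ⟨x, p, n, hx⟩ := hT.2 P hP hfin
  obtain ⟨q, w, hw⟩ := h.exists_ancestor k p
  refine ⟨x - S.scale ^ n • w, q, n, ?_⟩
  rw [add_comm k n]
  have := translate_mono (x := x - S.scale ^ n • w) (supertile_subset (n := n) hw)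
  rw [translate_translate, add_sub_cancel] at this
  exact hx.trans this

/-- Some tile lies, with a neighbourhood of radius one, inside its own supertile. -/
theorem IsPrimitive.exists_interior_fixed_tile [Finite ι] [Nonempty ι] (h : S.IsPrimitive) :
    ∃ (t : Tile d ι) (m : ℕ), 0 < m ∧ t ∈ S.substMap^[m] {t} ∧
      ∀ w ∈ S.carrier t, Metric.ball w 1 ⊆ (fun y => S.scale ^ m • y) '' S.carrier t := by
  classical
  obtain ⟨p⟩ := ‹Nonempty ι›
  obtain ⟨D, hD0, hD⟩ := S.exists_outer_radius
  -- At most half of the punctures of a large supertile are within `D + 1` of its complement, so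
  -- some puncture `z` is deeper than that. The margin `D` accounts for the size of the tile at `z`
  -- and `1` for the required neighbourhood.
  obtain ⟨n, hn, hn1⟩ := ((S.eventually_card_nearPunctures_le (D + 1)
    (show (0 : ℝ) < 1 / 2 by norm_num)).and (eventually_ge_atTop 1)).exists
  have hex : ∃ z ∈ S.punctures n p, z ∉ S.nearPunctures n p (D + 1) := by
    by_contra! hcon
    have h1 := hn p
    have h2 : ((S.punctures n p).card : ℝ) ≤ (S.nearPunctures n p (D + 1)).card := by
      exact_mod_cast Finset.card_le_card hcon
    have h3 : (0 : ℝ) < (S.punctures n p).card := by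
      exact_mod_cast (S.punctures_nonempty n p).card_pos
    linarith
  obtain ⟨z, hz, hzn⟩ := hex
  have hfar : D + 1 ≤ Metric.infDist z (S.supp (S.supertile n p))ᶜ := by
    by_contra! hcon
    exact hzn (S.mem_nearPunctures.2 ⟨hz, hcon⟩)
  obtain ⟨q, hq⟩ := S.mem_punctures.1 hz
  obtain ⟨N, hN⟩ := h
  obtain ⟨w₀, hw₀⟩ := hN q p
  set m := n + N with hm
  set x := z + S.scale ^ n • w₀ with hx
  have hlt : 1 < S.scale ^ m := one_lt_pow₀ S.one_lt_scale (by omega)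
  have hne : (1 - S.scale ^ m) ≠ 0 := by linarith
  -- The fixed point of `y ↦ λ^m y + x`: the copy of `q` at `x` in `ω^m(q)` sits in `ω^m` of the
  -- tile `(q, y)` exactly at `y`.
  set y : Euc d := (1 - S.scale ^ m)⁻¹ • x with hy
  have hxy : y - S.scale ^ m • y = x := by
    have : y - S.scale ^ m • y = (1 - S.scale ^ m) • y := by rw [sub_smul, one_smul]
    rw [this, hy, smul_inv_smul₀ hne]
  have hxm : translate (S.scale ^ n • w₀) (S.supertile n p) ⊆ S.supertile m q :=
    supertile_subset hw₀
  have hcar : S.substMap^[m] {((q, y) : Tile d ι)} = translate (S.scale ^ m • y)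
    (S.supertile m q) := S.iterate_singleton m _
  refine ⟨(q, y), m, by omega, ?_, fun w hw v hv => ?_⟩
  · rw [hcar, mem_translate]
    refine hxm (mem_translate.2 ?_)
    simpa [hxy, hx] using hq
  · rw [← supp_singleton, ← supp_iterate, hcar, mem_supp_translate]
    refine S.supp_mono hxm ?_
    rw [mem_supp_translate]
    by_contra hcon
    have h1 := Metric.infDist_le_dist_of_mem (x := z) (mem_compl hcon)
    have h2 : dist z (v - S.scale ^ m • y - S.scale ^ n • w₀) = dist v y := by
      rw [dist_eq_norm, dist_eq_norm, ← norm_neg]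
      congr 1
      have : z = y - S.scale ^ m • y - S.scale ^ n • w₀ := by rw [hxy, hx]; abel
      rw [this]; abel
    have h3 := S.dist_le_of_mem_carrier hD hw
    rw [Metric.mem_ball] at hv
    simp only at h3
    rw [← dist_eq_norm] at h3
    linarith [dist_triangle v w y]

/-- The tile `t` of `exists_interior_fixed_tile` belongs to its own supertile, so iterating `ω^m` on
it gives an increasing sequence of patches. Their supports are the dilates of `t`, which exhaust
space because of the unit margin, and the union of the patches is a tiling of the hull. -/
theorem IsPrimitive.hull_nonempty [Finite ι] [Nonempty ι] (h : S.IsPrimitive) :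
    S.hull.Nonempty := by
  obtain ⟨t, m, hm, ht, hball⟩ := h.exists_interior_fixed_tile
  set C := S.carrier t with hC
  set Λ := S.scale ^ m with hΛ
  have hΛ1 : 1 < Λ := one_lt_pow₀ S.one_lt_scale hm.ne'
  have hΛ0 : Λ ≠ 0 := by positivity
  let P : ℕ → Set (Tile d ι) := fun k => (S.substMap^[m])^[k] {t}
  have hPiter : ∀ k, P k = S.substMap^[m * k] {t} := fun k => by
    simp only [P]; rw [Function.iterate_mul]
  have hPmono : Monotone P := by
    refine monotone_nat_of_le_succ fun k => ?_
    simp only [P]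
    rw [Function.iterate_succ_apply, ← Function.iterate_mul]
    exact S.iterate_mono _ (singleton_subset_iff.2 ht)
  have hsupp : ∀ k, S.supp (P k) = (fun y => Λ ^ k • y) '' C := fun k => by
    rw [hPiter, supp_iterate, supp_singleton, hΛ, ← pow_mul]
  have hstep : ∀ y ∈ C, Λ⁻¹ • y ∈ C := fun y hy => by
    obtain ⟨z, hz, he⟩ := hball y hy (Metric.mem_ball_self one_pos)
    simp only at he
    rw [← he, smul_smul, inv_mul_cancel₀ hΛ0, one_smul]
    exact hz
  have hlim : ∀ y : Euc d, Tendsto (fun k : ℕ => (Λ⁻¹) ^ k • y) atTop (𝓝 0) := fun y => by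
    have := (tendsto_pow_atTop_nhds_zero_of_lt_one (inv_nonneg.2 (zero_le_one.trans hΛ1.le))
      (inv_lt_one_of_one_lt₀ hΛ1)).smul_const y
    rwa [zero_smul] at this
  -- The contraction by `Λ⁻¹` maps the closed set `C` into itself, so `C` contains the limit of the
  -- orbit of its puncture.
  have h0 : (0 : Euc d) ∈ C := by
    refine (S.isCompact_carrier t).isClosed.mem_of_tendsto (hlim t.2)
      (Eventually.of_forall fun k => ?_)
    induction k with
    | zero => simpa using S.snd_mem_carrier t
    | succ k ih => rw [pow_succ', mul_smul]; exact hstep _ ih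
  have hcover : ∀ y : Euc d, ∃ k, y ∈ S.supp (P k) := fun y => by
    obtain ⟨k, hk⟩ := ((hlim y).eventually (Metric.ball_mem_nhds 0 one_pos)).exists
    refine ⟨k + 1, ?_⟩
    obtain ⟨z, hz, he⟩ := hball 0 h0 hk
    simp only at he
    rw [hsupp]
    refine ⟨z, hz, ?_⟩
    simp only
    rw [pow_succ, mul_smul, he, smul_smul, ← mul_pow, mul_inv_cancel₀ hΛ0, one_pow, one_smul]
  refine ⟨⋃ k, P k, ⟨?_, eq_univ_of_forall fun y => ?_⟩, fun Q hQ hfin => ?_⟩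
  · rw [isPartialTiling_iff]
    rintro s hs s' hs' ⟨y, hy, hy'⟩
    obtain ⟨k, hk⟩ := mem_iUnion.1 hs
    obtain ⟨k', hk'⟩ := mem_iUnion.1 hs'
    have hpt : IsPartialTiling S.shape (P (max k k')) := by
      rw [hPiter, iterate_singleton]
      exact (S.isPartialTiling_supertile _ _).translate _
    exact hpt.eq_of_inter (hPmono (le_max_left _ _) hk) (hPmono (le_max_right _ _) hk') hy hy'
  · obtain ⟨k, hk⟩ := hcover y
    exact S.supp_mono (subset_iUnion P k) hk
  · have hdir : Directed (· ⊆ ·) P := hPmono.directed_le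
    obtain ⟨k, hk⟩ := hdir.exists_mem_subset_of_finset_subset_biUnion
      (s := hfin.toFinset) (by simpa using hQ)
    refine ⟨S.scale ^ (m * k) • t.2, t.1, m * k, ?_⟩
    rw [← iterate_singleton, ← hPiter]
    simpa using hk

/-- Every tiling of the hull contains translates of every supertile near every point. -/
theorem IsPrimitive.exists_translate_subset [Finite ι] (h : S.IsPrimitive) (n : ℕ) :
    ∃ R : ℝ, ∀ T ∈ S.hull, ∀ (p : ι) (y : Euc d), ∃ x : Euc d, ‖x - y‖ ≤ R ∧
      translate x (S.supertile n p) ⊆ T := by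
  obtain ⟨D, hD0, hD⟩ := S.exists_outer_radius
  have hprim := h
  obtain ⟨N, hN⟩ := h
  -- All points of a supertile of order `n + N` are within `λ^(n+N) D` of its centre; if it contains
  -- the origin, it lies in the ball of radius twice that.
  set R := 2 * (S.scale ^ (n + N) * D) with hR
  have hRpos : 0 ≤ R := by have := S.scale_pos; positivity
  have main : ∀ T ∈ S.hull, ∀ p : ι, ∃ x : Euc d, ‖x‖ ≤ R ∧
      translate x (S.supertile n p) ⊆ T := by
    intro T hT p
    set Q := {t ∈ T | ‖t.2‖ ≤ R + D} with hQ
    have hQT : Q ⊆ T := fun t ht => ht.1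
    have hQsupp : ∀ y : Euc d, ‖y‖ ≤ R → y ∈ S.supp Q := fun y hy => by
      have : y ∈ S.supp T := by rw [hT.1.2]; trivial
      obtain ⟨t, ht, hyt⟩ := S.mem_supp.1 this
      refine S.mem_supp.2 ⟨t, ⟨ht, ?_⟩, hyt⟩
      have h1 := S.dist_le_of_mem_carrier hD hyt
      have h2 := norm_sub_norm_le t.2 y
      rw [norm_sub_rev] at h2
      linarith
    -- The central patch `Q` lies in a supertile of order at least `n + N`. Its constituent of order
    -- `n + N` over the origin will turn out to be part of `T`, and primitivity finds `ω^n(p)`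
    -- inside that constituent.
    obtain ⟨x, q, k, hx⟩ := hprim.exists_large_supertile hT hQT (hT.1.1.finite_of_norm_le _) (n + N)
    obtain ⟨t₀, ht₀, h0⟩ := S.mem_supp.1 (hQsupp 0 (by simpa using hRpos))
    obtain ⟨s, hs, hst⟩ := mem_supertile_add.1 (mem_translate.1 (hx ht₀))
    set x' := S.scale ^ (n + N) • s.2 + x with hx'
    have hsub : translate x' (S.supertile (n + N) s.1) ⊆ translate x (S.supertile (n + N + k) q) := by
      rw [hx', ← translate_translate]
      exact translate_mono (supertile_subset hs)
    have ht₀' : t₀ ∈ translate x' (S.supertile (n + N) s.1) := by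
      rw [hx', ← translate_translate, mem_translate]; exact hst
    have hnorm : ∀ y ∈ S.supp (translate x' (S.supertile (n + N) s.1)), ‖y‖ ≤ R := fun y hy => by
      have h1 := S.norm_le_of_mem_supertile hD ((S.mem_supp_translate).1 hy)
      have h2 := S.norm_le_of_mem_supertile hD
        ((S.mem_supp_translate).1 (S.mem_supp.2 ⟨t₀, ht₀', h0⟩))
      have h3 := norm_sub_le (y - x') (0 - x')
      rw [sub_sub_sub_cancel_right, sub_zero] at h3
      linarith
    -- A priori these are tiles of the large supertile rather than of `T`. They lie over the ball of
    -- radius `R`, which `Q` covers, so absorption puts them in `Q`.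
    have hin : translate x' (S.supertile (n + N) s.1) ⊆ Q := fun t ht => by
      refine ((S.isPartialTiling_supertile _ _).translate x).absorb hx (hsub ht) fun y hy => ?_
      exact hQsupp y (hnorm y (S.mem_supp.2 ⟨t, ht, S.inner_subset t hy⟩))
    obtain ⟨w, hw⟩ := hN s.1 p
    have hsub' : translate (S.scale ^ n • w + x') (S.supertile n p) ⊆
        translate x' (S.supertile (n + N) s.1) := by
      rw [← translate_translate]
      exact translate_mono (supertile_subset hw)
    refine ⟨S.scale ^ n • w + x', hnorm _ (S.supp_mono hsub' ?_), (hsub'.trans hin).trans hQT⟩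
    rw [mem_supp_translate, sub_self, supp_supertile]
    exact ⟨0, interior_subset (S.zero_mem p), by simp⟩
  refine ⟨R, fun T hT p y => ?_⟩
  obtain ⟨x, hx, hsub⟩ := main _ (hull_translate hT (-y)) p
  refine ⟨x + y, by simpa using hx, ?_⟩
  rw [translate_subset_iff, translate_translate] at hsub
  rwa [translate_subset_iff, neg_add_rev]

/-- Every patch of a tiling of the hull occurs in every tiling of the hull, with bounded gaps. -/
theorem IsPrimitive.exists_patch_translate [Finite ι] (h : S.IsPrimitive) {T P : Set (Tile d ι)}
    (hT : T ∈ S.hull) (hP : P ⊆ T) (hfin : P.Finite) :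
    ∃ R : ℝ, ∀ T' ∈ S.hull, ∃ x : Euc d, ‖x‖ ≤ R ∧ translate x P ⊆ T' := by
  obtain ⟨x, p, n, hx⟩ := hT.2 P hP hfin
  obtain ⟨R, hR⟩ := h.exists_translate_subset n
  refine ⟨R, fun T' hT' => ?_⟩
  obtain ⟨y, hy, hsub⟩ := hR T' hT' p x
  refine ⟨y - x, hy, ?_⟩
  have := translate_mono (x := y - x) hx
  rw [translate_translate, add_sub_cancel] at this
  exact this.trans hsub

/-- The tiles near the origin of the tilings of the punctured hull are finite in number. -/
theorem finite_tiles [Finite ι] [Nonempty ι] (h : S.IsPrimitive) (hflc : S.HasFLC) (R : ℝ) :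
    {t : Tile d ι | ∃ T ∈ S.punctHull, t ∈ T ∧ ‖t.2‖ ≤ R}.Finite := by
  obtain ⟨D, hD0, hD⟩ := S.exists_outer_radius
  -- Finite local complexity concerns one tiling at a time. A pair consisting of a tile with
  -- puncture `0` and a tile `t` recurs, up to translation, in the fixed tiling `T₀`, and `t` is
  -- recovered from the translation class of the pair.
  obtain ⟨T₀, hT₀⟩ := h.hull_nonempty
  obtain ⟨F, hF, hFsub⟩ := hflc T₀ hT₀ (2 * (max R 0 + D) + 1) (by positivity)
  have hfin : (⋃ Q ∈ {Q ∈ F | Q.Finite}, ⋃ a ∈ Q, ⋃ b ∈ Q,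
      ({((b.1, b.2 - a.2) : Tile d ι)} : Set (Tile d ι))).Finite :=
    (hF.subset (sep_subset _ _)).biUnion fun Q hQ => hQ.2.biUnion fun a _ =>
      hQ.2.biUnion fun b _ => finite_singleton _
  refine hfin.subset ?_
  rintro t ⟨T, ⟨hT, p, hp⟩, ht, htR⟩
  have hPT : ({(p, 0), t} : Set (Tile d ι)) ⊆ T := by
    rintro s (rfl | rfl) <;> assumption
  obtain ⟨_, hR'⟩ := h.exists_patch_translate hT hPT (toFinite _)
  obtain ⟨x, -, hx⟩ := hR' T₀ hT₀
  have hdiam : Metric.diam (S.supp (translate x {(p, 0), t})) < 2 * (max R 0 + D) + 1 := by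
    refine (Metric.diam_mono (t := Metric.closedBall x (max R 0 + D)) ?_
      Metric.isBounded_closedBall).trans_lt ((Metric.diam_closedBall (by positivity)).trans_lt ?_)
    · intro y hy
      rw [mem_supp_translate] at hy
      obtain ⟨s, hs, hy⟩ := S.mem_supp.1 hy
      have h1 := S.dist_le_of_mem_carrier hD hy
      have h2 : ‖s.2‖ ≤ max R 0 := by
        rcases hs with rfl | rfl
        · simp
        · exact htR.trans (le_max_left _ _)
      rw [Metric.mem_closedBall, dist_eq_norm]
      have := norm_add_le (y - x - s.2) s.2
      rw [sub_add_cancel] at this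
      linarith
    · linarith
  obtain ⟨Q, hQF, y, hQ⟩ := hFsub _ hx ((toFinite _).image _) hdiam
  have hQ' : Q = translate (x - y) {(p, 0), t} := by
    rw [sub_eq_add_neg, ← translate_translate, hQ, translate_neg_translate]
  refine mem_iUnion₂.2 ⟨Q, ⟨hQF, ?_⟩, mem_iUnion₂.2 ⟨(p, x - y), ?_, mem_iUnion₂.2
    ⟨(t.1, t.2 + (x - y)), ?_, ?_⟩⟩⟩
  · rw [hQ']; exact (toFinite _).image _
  · rw [hQ', mem_translate]; simp
  · rw [hQ', mem_translate]; simp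
  · simp

end SubstitutionSystem
end SubstTiling

/-! ### The punctured hull as a compact Hausdorff space, and its cells. -/

namespace SubstTiling
namespace SubstitutionSystem

variable {d : ℕ} {ι : Type*}

/-- The standing assumptions: a primitive substitution with finite local complexity which is
injective on its hull. -/
class IsRegular (S : SubstitutionSystem d ι) : Prop where
  primitive : S.IsPrimitive
  flc : S.HasFLC
  injective : S.IsInjective

/-- The punctured hull as a space. -/
@[ext]
structure Transversal (S : SubstitutionSystem d ι) where
  /-- the tiling -/
  val : Set (Tile d ι)
  mem : val ∈ S.punctHull

variable {S : SubstitutionSystem d ι}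

/-- The cylinder topology: nearby tilings share a prescribed finite patch. -/
instance : TopologicalSpace S.Transversal :=
  TopologicalSpace.generateFrom {U | ∃ t : Tile d ι, U = {T | t ∈ T.1}}

namespace Transversal

theorem mem_hull (T : S.Transversal) : T.1 ∈ S.hull := T.2.1

theorem isOpen_mem (t : Tile d ι) : IsOpen {T : S.Transversal | t ∈ T.1} :=
  TopologicalSpace.isOpen_generateFrom_of_mem ⟨t, rfl⟩

theorem continuous_iff {Y : Type*} [TopologicalSpace Y] {f : Y → S.Transversal} :
    Continuous f ↔ ∀ t : Tile d ι, IsOpen {y | t ∈ (f y).1} := by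
  rw [continuous_generateFrom_iff]
  constructor
  · exact fun h t => h _ ⟨t, rfl⟩
  · rintro h _ ⟨t, rfl⟩
    exact h t

/-- If `t ∉ T`, then some tile `t'` of `T` overlaps `t` without being equal to it, and no tiling
containing `t'` can contain `t`. -/
theorem isClopen_mem (t : Tile d ι) : IsClopen {T : S.Transversal | t ∈ T.1} := by
  refine ⟨⟨isOpen_iff_mem_nhds.2 fun T hT => ?_⟩, isOpen_mem t⟩
  obtain ⟨t', ht', y, hy, hy'⟩ := T.mem_hull.1.1.exists_inner_inter (S.isOpen_inner t)
    ⟨_, S.snd_mem_inner t⟩ (by rw [T.mem_hull.1.2]; exact subset_univ _)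
  filter_upwards [(isOpen_mem t').mem_nhds ht'] with T' hT' ht
  have := T'.mem_hull.1.1.eq_of_inter ht hT' hy hy'
  exact hT (this ▸ ht')

instance : T2Space S.Transversal := by
  refine ⟨fun T T' hne => ?_⟩
  by_cases h : T.1 ⊆ T'.1
  · exact absurd (Transversal.ext (T.mem_hull.1.eq_of_subset T'.mem_hull.1.1 h)) hne
  · obtain ⟨t, ht, ht'⟩ := not_subset.1 h
    exact ⟨_, _, isOpen_mem t, (isClopen_mem t).compl.isOpen, ht, ht', disjoint_compl_right⟩

theorem nhds_hasBasis (T : S.Transversal) : (𝓝 T).HasBasis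
    (fun P : Set (Tile d ι) => P.Finite ∧ P ⊆ T.1) (fun P => {T' | P ⊆ T'.1}) := by
  refine ⟨fun U => ⟨fun hU => ?_, ?_⟩⟩
  · obtain ⟨_, ⟨F, ⟨hF, hFs⟩, rfl⟩, hT, hsub⟩ :=
      (TopologicalSpace.isTopologicalBasis_of_subbasis (α := S.Transversal) rfl).mem_nhds_iff.1 hU
    choose t ht using fun U : F => hFs U.2
    have := hF.to_subtype
    refine ⟨range t, ⟨finite_range t, ?_⟩, fun T' hT' => hsub fun V hV => ?_⟩
    · rintro _ ⟨V, rfl⟩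
      have h := hT V.1 V.2
      rw [ht V] at h
      exact h
    · have h : T' ∈ {T : S.Transversal | t ⟨V, hV⟩ ∈ T.1} := hT' ⟨⟨V, hV⟩, rfl⟩
      rwa [← ht ⟨V, hV⟩] at h
  · rintro ⟨P, ⟨hP, hPT⟩, hsub⟩
    refine mem_of_superset ?_ hsub
    exact (eventually_all_finite hP).2 fun t ht => (isOpen_mem t).mem_nhds (hPT ht)

theorem isClopen_subset {P : Set (Tile d ι)} (hP : P.Finite) :
    IsClopen {T : S.Transversal | P ⊆ T.1} := by
  have : {T : S.Transversal | P ⊆ T.1} = ⋂ t ∈ P, {T : S.Transversal | t ∈ T.1} := by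
    ext T; simp [subset_def]
  rw [this]
  exact hP.isClopen_biInter fun t _ => isClopen_mem t

theorem translate_mem_iff (T : S.Transversal) (x : Euc d) :
    translate x T.1 ∈ S.punctHull ↔ ∃ p : ι, ((p, -x) : Tile d ι) ∈ T.1 := by
  simp [punctHull, hull_translate T.mem_hull, mem_translate]

theorem isClopen_translate_mem [Finite ι] (x : Euc d) :
    IsClopen {T : S.Transversal | translate x T.1 ∈ S.punctHull} := by
  have : {T : S.Transversal | translate x T.1 ∈ S.punctHull} =
      ⋃ p : ι, {T : S.Transversal | ((p, -x) : Tile d ι) ∈ T.1} := by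
    ext T; simp [translate_mem_iff]
  rw [this]
  exact isClopen_iUnion_of_finite fun p => isClopen_mem _

variable [Finite ι] [Nonempty ι] [S.IsRegular]

instance : Nonempty S.Transversal := by
  obtain ⟨T, hT⟩ := (IsRegular.primitive (S := S)).hull_nonempty
  have : (0 : Euc d) ∈ S.supp T := by rw [hT.1.2]; trivial
  obtain ⟨t, ht, -⟩ := S.mem_supp.1 this
  exact ⟨⟨translate (-t.2) T, hull_translate hT _, t.1, by simpa [mem_translate] using ht⟩⟩

/-- An ultrafilter converges to the set `L` of tiles that belong to almost every tiling. By
`finite_tiles` only finitely many tiles are possible within a given radius, so almost every tiling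
agrees with `L` there. Covering and the existence of a puncture at the origin are seen in a bounded
region, and disjointness and the patch condition on finite subsets; all of them pass to `L`. -/
instance : CompactSpace S.Transversal := by
  refine ⟨isCompact_iff_ultrafilter_le_nhds.2 fun F _ => ?_⟩
  set L : Set (Tile d ι) := {t | ∀ᶠ T : S.Transversal in F, t ∈ T.1} with hL
  have hev : ∀ R : ℝ, ∀ᶠ T : S.Transversal in F, ∀ t : Tile d ι, ‖t.2‖ ≤ R → (t ∈ T.1 ↔ t ∈ L) := by
    intro R
    have hfin := finite_tiles (IsRegular.primitive (S := S)) IsRegular.flc R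
    have h1 : ∀ t ∈ {t : Tile d ι | ∃ T ∈ S.punctHull, t ∈ T ∧ ‖t.2‖ ≤ R},
        ∀ᶠ T : S.Transversal in F, (t ∈ T.1 ↔ t ∈ L) := by
      intro t _
      by_cases ht : t ∈ L
      · filter_upwards [ht] with T hT
        exact iff_of_true hT ht
      · filter_upwards [Ultrafilter.eventually_not.2 ht] with T hT
        exact iff_of_false hT ht
    filter_upwards [(eventually_all_finite hfin).2 h1] with T hT t htR
    by_cases ht : ∃ T ∈ S.punctHull, t ∈ T ∧ ‖t.2‖ ≤ R
    · exact hT t ht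
    · refine iff_of_false (fun h => ht ⟨_, T.2, h, htR⟩) fun h => ?_
      obtain ⟨T', hT'⟩ := h.exists
      exact ht ⟨_, T'.2, hT', htR⟩
  have hfinite : ∀ P ⊆ L, P.Finite → ∀ᶠ T : S.Transversal in F, P ⊆ T.1 := fun P hP hfin =>
    (eventually_all_finite hfin).2 fun t ht => hP ht
  obtain ⟨D, -, hD⟩ := S.exists_outer_radius
  have hLmem : L ∈ S.punctHull := by
    refine ⟨⟨⟨?_, eq_univ_of_forall fun y => ?_⟩, fun P hP hfin => ?_⟩, ?_⟩
    · intro t ht t' ht'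
      obtain ⟨T, hT, hT'⟩ := (ht.and ht').exists
      exact T.mem_hull.1.1 t hT t' hT'
    · obtain ⟨T, hT⟩ := (hev (‖y‖ + D)).exists
      have : y ∈ S.supp T.1 := by rw [T.mem_hull.1.2]; trivial
      obtain ⟨t, ht, hy⟩ := S.mem_supp.1 this
      refine S.mem_supp.2 ⟨t, (hT t ?_).1 ht, hy⟩
      have h1 := S.dist_le_of_mem_carrier hD hy
      have h2 := norm_sub_norm_le t.2 y
      rw [norm_sub_rev] at h2
      linarith
    · obtain ⟨T, hT⟩ := (hfinite P hP hfin).exists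
      exact T.mem_hull.2 P hT hfin
    · obtain ⟨T, hT⟩ := (hev 0).exists
      obtain ⟨p, hp⟩ := T.2.2
      exact ⟨p, (hT _ (by simp)).1 hp⟩
  refine ⟨⟨L, hLmem⟩, trivial, ?_⟩
  refine (nhds_hasBasis _).ge_iff.2 fun P hP => hfinite P hP.2 hP.1

end Transversal

/-! ### Supertiles of tilings in the hull -/

variable (S) in
/-- The tilings in the punctured hull that arise from `ω^n(T')` with `p ∈ T'` by moving the
puncture `z` of `ω^n(p)` to the origin. -/
def cell (n : ℕ) (p : ι) (z : Euc d) : Set S.Transversal :=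
  {T | ∃ T' ∈ S.hull, ((p, 0) : Tile d ι) ∈ T' ∧ T.1 = translate (-z) (S.substMap^[n] T')}

theorem injOn_iterate [S.IsRegular] (n : ℕ) : InjOn (S.substMap^[n]) S.hull := by
  induction n with
  | zero => exact injOn_id _
  | succ n ih =>
    rw [Function.iterate_succ]
    exact ih.comp IsRegular.injective fun T hT => hull_iterate hT 1

/-- Passing to the preimage of `T` itself under `ω^n` allows cells of tilings that differ by a
translation to be compared inside one tiling. -/
theorem mem_cell_iff {n : ℕ} {p : ι} {z : Euc d} {T : S.Transversal} : T ∈ S.cell n p z ↔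
    ∃ T' ∈ S.hull, ((p, -(S.scale ^ n)⁻¹ • z) : Tile d ι) ∈ T' ∧ S.substMap^[n] T' = T.1 := by
  have hs := S.scale_pow_ne_zero n
  constructor
  · rintro ⟨T', hT', hp, he⟩
    refine ⟨translate (-(S.scale ^ n)⁻¹ • z) T', hull_translate hT' _, ?_, ?_⟩
    · rw [mem_translate]; simpa using hp
    · rw [iterate_translate, he, neg_smul, smul_neg, smul_inv_smul₀ hs]
  · rintro ⟨T', hT', hp, he⟩
    refine ⟨translate ((S.scale ^ n)⁻¹ • z) T', hull_translate hT' _, ?_, ?_⟩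
    · rw [mem_translate]; simpa using hp
    · rw [iterate_translate, smul_inv_smul₀ hs, translate_neg_translate, he]

theorem supertile_subset_of_mem_iterate {n : ℕ} {T : Set (Tile d ι)} {p : ι} {y : Euc d}
    (h : ((p, y) : Tile d ι) ∈ T) :
    translate (S.scale ^ n • y) (S.supertile n p) ⊆ S.substMap^[n] T := by
  have := S.iterate_mono n (singleton_subset_iff.2 h)
  rwa [iterate_singleton] at this

theorem supertile_subset_of_mem_cell {n : ℕ} {p : ι} {z : Euc d} {T : S.Transversal}
    (h : T ∈ S.cell n p z) : translate (-z) (S.supertile n p) ⊆ T.1 := by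
  obtain ⟨T', -, hp, he⟩ := h
  rw [he]
  refine translate_mono ?_
  simpa [translate_zero] using supertile_subset_of_mem_iterate (S := S) (n := n) hp

/-- Distinct supertiles of a tiling of the hull in which tiles are given. -/
theorem cell_common [S.IsRegular] {n : ℕ} {p p' : ι} {z z' x : Euc d} {T T' : S.Transversal}
    (hx : T'.1 = translate x T.1) (h : T ∈ S.cell n p z) (h' : T' ∈ S.cell n p' z') :
    ∃ U ∈ S.hull, S.substMap^[n] U = T.1 ∧ ((p, -(S.scale ^ n)⁻¹ • z) : Tile d ι) ∈ U ∧
      ((p', -(S.scale ^ n)⁻¹ • (z' + x)) : Tile d ι) ∈ U := by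
  obtain ⟨U, hU, hp, he⟩ := mem_cell_iff.1 h
  obtain ⟨U', hU', hp', he'⟩ := mem_cell_iff.1 h'
  refine ⟨U, hU, he, hp, ?_⟩
  -- Both sides have the image `T` under `ω^n`, which is injective on the hull.
  have : translate (-(S.scale ^ n)⁻¹ • x) U' = U := by
    refine injOn_iterate n (hull_translate hU' _) hU ?_
    rw [iterate_translate, he', he, hx, neg_smul, smul_neg, smul_inv_smul₀ (S.scale_pow_ne_zero n),
      translate_neg_translate]
  rw [← this, mem_translate]
  simpa [smul_add] using hp'

theorem mem_cell_translate {n : ℕ} {p : ι} {z z' : Euc d} {T T' : S.Transversal}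
    (h : T'.1 = translate (z - z') T.1) (hT : T ∈ S.cell n p z) : T' ∈ S.cell n p z' := by
  obtain ⟨U, hU, hp, he⟩ := hT
  refine ⟨U, hU, hp, ?_⟩
  rw [h, he, translate_translate]
  congr 1
  abel

section Finite

variable [Finite ι]

/-- Injectivity provides a single preimage under `ω^n`, in which the tile of `T` at the origin has
only one parent; `p` and `z` are read off from the label and position of that parent. -/
theorem mem_cell_unique [S.IsRegular] {n : ℕ} {p p' : ι} {z z' : Euc d} {T : S.Transversal}
    (hz : z ∈ S.punctures n p) (hz' : z' ∈ S.punctures n p')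
    (h : T ∈ S.cell n p z) (h' : T ∈ S.cell n p' z') : p = p' ∧ z = z' := by
  have hs := S.scale_pow_ne_zero n
  obtain ⟨U, hU, he, hp, hp'⟩ := cell_common (x := 0) (translate_zero _).symm h h'
  rw [add_zero] at hp'
  obtain ⟨q, hq⟩ := S.mem_punctures.1 hz
  obtain ⟨q', hq'⟩ := S.mem_punctures.1 hz'
  have h1 : ∀ {p : ι} {z : Euc d} {q : ι}, ((q, z) : Tile d ι) ∈ S.supertile n p →
      ((q, 0) : Tile d ι) ∈ S.substMap^[n] {((p, -(S.scale ^ n)⁻¹ • z) : Tile d ι)} := by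
    intro p z q h
    rw [iterate_singleton, mem_translate]
    simpa [smul_inv_smul₀ hs] using h
  have hqT : ((q, 0) : Tile d ι) ∈ T.1 := by
    rw [← he]; exact (S.mem_iterate' n).2 ⟨_, hp, h1 hq⟩
  have hqT' : ((q', 0) : Tile d ι) ∈ T.1 := by
    rw [← he]; exact (S.mem_iterate' n).2 ⟨_, hp', h1 hq'⟩
  have hqq : ((q, 0) : Tile d ι) = (q', 0) := T.mem_hull.1.1.eq_of_snd hqT hqT' rfl
  have hpp := hU.1.1.parent_unique hp hp' (h1 hq) (by rw [hqq]; exact h1 hq')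
  rw [Prod.mk.injEq] at hpp
  refine ⟨hpp.1, ?_⟩
  have := smul_right_injective (Euc d) (neg_ne_zero.2 (inv_ne_zero hs)) hpp.2
  exact this

/-- The cell is the continuous image of the compact set of tilings that have `p` at the origin. -/
theorem isClosed_cell [Nonempty ι] [S.IsRegular] {n : ℕ} {p : ι} {z : Euc d}
    (hz : z ∈ S.punctures n p) : IsClosed (S.cell n p z) := by
  obtain ⟨q, hq⟩ := S.mem_punctures.1 hz
  have hmem : ∀ T' ∈ S.hull, ((p, 0) : Tile d ι) ∈ T' →
      translate (-z) (S.substMap^[n] T') ∈ S.punctHull := fun T' hT' hp => by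
    refine ⟨hull_translate (hull_iterate hT' n) _, q, mem_translate.2 ?_⟩
    have := supertile_subset_of_mem_iterate (S := S) (n := n) hp
    simpa [translate_zero] using this (by simpa [translate_zero] using hq)
  let f : {T' : S.Transversal // ((p, 0) : Tile d ι) ∈ T'.1} → S.Transversal :=
    fun T' => ⟨_, hmem _ T'.1.mem_hull T'.2⟩
  have hf : Continuous f := by
    refine Transversal.continuous_iff.2 fun t => ?_
    have : {T' | t ∈ (f T').1} = ⋃ s ∈ {s : Tile d ι | (t.1, t.2 + z) ∈ S.substMap^[n] {s}},
        {T' | s ∈ T'.1.1} := by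
      ext T'
      simp only [f, mem_ofPred_eq, mem_translate, sub_neg_eq_add, mem_iUnion]
      rw [S.mem_iterate' n]
      simp only [exists_prop, and_comm]
    rw [this]
    exact isOpen_biUnion fun s _ => (Transversal.isOpen_mem s).preimage continuous_subtype_val
  have : CompactSpace {T' : S.Transversal // ((p, 0) : Tile d ι) ∈ T'.1} :=
    isCompact_iff_compactSpace.1 (Transversal.isClopen_mem _).isClosed.isCompact
  have hr : S.cell n p z = range f := by
    ext T
    constructor
    · rintro ⟨T', hT', hp, he⟩
      exact ⟨⟨⟨T', hT', p, hp⟩, hp⟩, Transversal.ext he.symm⟩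
    · rintro ⟨T', rfl⟩
      exact ⟨_, T'.1.mem_hull, T'.2, rfl⟩
  rw [hr]
  exact (isCompact_range hf).isClosed

/-- Every tiling of the punctured hull lies in one of the cells of order `n`. -/
theorem exists_mem_cell [Nonempty ι] [S.IsRegular] (n : ℕ) (T : S.Transversal) :
    ∃ p, ∃ z ∈ S.punctures n p, T ∈ S.cell n p z := by
  have hs := S.scale_pow_ne_zero n
  have hcl : IsClosed (⋃ p, ⋃ z ∈ S.punctures n p, S.cell n p z) :=
    isClosed_iUnion_of_finite fun p =>
      (Finset.finite_toSet _).isClosed_biUnion fun z hz => isClosed_cell hz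
  -- The union of the cells is closed, so it suffices to approximate `T`. A finite patch of `T` lies
  -- in a supertile of order `n + m`, hence in `ω^n(U)` for a tiling `U` of the hull containing a
  -- suitably placed supertile of order `m`.
  suffices h : T ∈ closure (⋃ p, ⋃ z ∈ S.punctures n p, S.cell n p z) by
    rw [hcl.closure_eq] at h
    simpa using h
  refine (mem_closure_iff_nhds_basis T.nhds_hasBasis).2 fun P ⟨hfin, hP⟩ => ?_
  obtain ⟨q, hq⟩ := T.2.2
  obtain ⟨x, r, m, hx⟩ := (IsRegular.primitive (S := S)).exists_large_supertile T.mem_hull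
    (insert_subset hq hP) (hfin.insert _) n
  obtain ⟨T₀, hT₀⟩ := (IsRegular.primitive (S := S)).hull_nonempty
  obtain ⟨R, hR⟩ := (IsRegular.primitive (S := S)).exists_translate_subset m
  obtain ⟨y, -, hy⟩ := hR T₀ hT₀ r 0
  set U := translate ((S.scale ^ n)⁻¹ • x - y) T₀ with hU
  have hUh : U ∈ S.hull := hull_translate hT₀ _
  have hPU : insert ((q, 0) : Tile d ι) P ⊆ S.substMap^[n] U := by
    refine hx.trans ?_
    have h1 := S.iterate_mono n (translate_mono (x := (S.scale ^ n)⁻¹ • x - y) hy)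
    rw [translate_translate, add_sub_cancel, iterate_translate, smul_inv_smul₀ hs,
      ← supertile_add] at h1
    exact h1
  obtain ⟨s, hs', hqs⟩ := (S.mem_iterate' n).1 (hPU (mem_insert _ _))
  rw [iterate_singleton, mem_translate, zero_sub] at hqs
  refine ⟨⟨S.substMap^[n] U, hull_iterate hUh n, q, hPU (mem_insert _ _)⟩, ?_,
    (subset_insert _ _).trans hPU⟩
  refine mem_iUnion.2 ⟨s.1, mem_iUnion₂.2 ⟨-(S.scale ^ n • s.2), S.mem_punctures.2 ⟨q, hqs⟩, ?_⟩⟩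
  rw [mem_cell_iff]
  refine ⟨U, hUh, ?_, rfl⟩
  simpa [inv_smul_smul₀ hs] using hs'

/-- By existence and uniqueness the cells of order `n` partition the punctured hull, so the
complement of one is a finite union of closed cells. -/
theorem isClopen_cell [Nonempty ι] [S.IsRegular] {n : ℕ} {p : ι} {z : Euc d}
    (hz : z ∈ S.punctures n p) : IsClopen (S.cell n p z) := by
  refine ⟨isClosed_cell hz, ?_⟩
  have : (S.cell n p z)ᶜ = ⋃ q, ⋃ w ∈ {w ∈ (S.punctures n q : Set (Euc d)) | (q, w) ≠ (p, z)},
      S.cell n q w := by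
    ext T
    simp only [mem_compl_iff, mem_iUnion]
    constructor
    · intro hT
      obtain ⟨q, w, hw, hTw⟩ := exists_mem_cell n T
      refine ⟨q, w, ⟨hw, fun h => hT ?_⟩, hTw⟩
      rw [Prod.mk.injEq] at h
      rwa [← h.1, ← h.2]
    · rintro ⟨q, w, ⟨hw, hne⟩, hTw⟩ hT
      obtain ⟨h1, h2⟩ := mem_cell_unique hw hz hTw hT
      exact hne (by rw [h1, h2])
  rw [← isClosed_compl_iff, this]
  exact isClosed_iUnion_of_finite fun q =>
    ((Finset.finite_toSet _).subset (sep_subset _ _)).isClosed_biUnion fun w hw =>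
      isClosed_cell hw.1

/-- The cells of order one cover the punctured hull, and every tiling of the hull can be translated
into it. -/
theorem exists_substMap_eq [Nonempty ι] [S.IsRegular] {T : Set (Tile d ι)} (hT : T ∈ S.hull) :
    ∃ T' ∈ S.hull, S.substMap T' = T := by
  have : (0 : Euc d) ∈ S.supp T := by rw [hT.1.2]; trivial
  obtain ⟨t, ht, -⟩ := S.mem_supp.1 this
  obtain ⟨p, z, -, hz⟩ := exists_mem_cell (S := S) 1
    ⟨translate (-t.2) T, hull_translate hT _, t.1, by simpa [mem_translate] using ht⟩
  obtain ⟨T', hT', -, he⟩ := mem_cell_iff.1 hz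
  simp only [Function.iterate_one] at he
  refine ⟨translate (S.scale⁻¹ • t.2) T', hull_translate hT' _, ?_⟩
  rw [substMap_translate, he, smul_inv_smul₀ S.scale_pos.ne', translate_translate_neg]

/-- Tilings in the hull have no periods. -/
theorem eq_zero_of_translate_eq [Nonempty ι] [S.IsRegular] {T : Set (Tile d ι)} (hT : T ∈ S.hull)
    {x : Euc d} (hx : translate x T = T) : x = 0 := by
  -- Injectivity turns a period `x` of `ω(U')` into the period `λ⁻¹ x` of `U'`. Iteration yields
  -- periods shorter than `ρ`, for which a tile and its translate overlap; they must then be equal.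
  have hstep : ∀ n : ℕ, ∃ U ∈ S.hull, translate ((S.scale⁻¹) ^ n • x) U = U := by
    intro n
    induction n with
    | zero => exact ⟨T, hT, by simpa using hx⟩
    | succ n ih =>
      obtain ⟨U, hU, he⟩ := ih
      obtain ⟨U', hU', rfl⟩ := exists_substMap_eq hU
      refine ⟨U', hU', IsRegular.injective (hull_translate hU' _) hU' ?_⟩
      rw [substMap_translate, smul_smul, pow_succ', ← mul_assoc, mul_inv_cancel₀ S.scale_pos.ne',
        one_mul, he]
  obtain ⟨ρ, hρ, hball⟩ := S.exists_inner_radius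
  have hlim : Tendsto (fun n : ℕ => (S.scale⁻¹) ^ n • x) atTop (𝓝 0) := by
    have := (tendsto_pow_atTop_nhds_zero_of_lt_one (inv_nonneg.2 S.scale_pos.le)
      (inv_lt_one_of_one_lt₀ S.one_lt_scale)).smul_const x
    rwa [zero_smul] at this
  obtain ⟨n, hn⟩ := (hlim.eventually (Metric.ball_mem_nhds 0 hρ)).exists
  obtain ⟨U, hU, he⟩ := hstep n
  have : (0 : Euc d) ∈ S.supp U := by rw [hU.1.2]; trivial
  obtain ⟨t, ht, -⟩ := S.mem_supp.1 this
  have ht' : ((t.1, t.2 - (S.scale⁻¹) ^ n • x) : Tile d ι) ∈ U := by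
    rw [← mem_translate, he]; exact ht
  have heq := hU.1.1.eq_of_inter ht ht' (S.snd_mem_inner t) (by
    rw [mem_inner]
    simpa using hball t.1 hn)
  exact (smul_eq_zero.1 (sub_eq_self.1 (congrArg Prod.snd heq).symm)).resolve_left
    (pow_ne_zero _ (inv_ne_zero S.scale_pos.ne'))

theorem translate_injective [Nonempty ι] [S.IsRegular] {T : Set (Tile d ι)} (hT : T ∈ S.hull)
    {x y : Euc d} (h : translate x T = translate y T) : x = y := by
  have : translate (x - y) T = T := by
    rw [sub_eq_add_neg, ← translate_translate, h, translate_neg_translate]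
  exact sub_eq_zero.1 (eq_zero_of_translate_eq hT this)

theorem exists_translate_of_mem_cell {n : ℕ} {p : ι} {z z' : Euc d} {T : S.Transversal}
    (hT : T ∈ S.cell n p z) (hz' : z' ∈ S.punctures n p) :
    translate (z - z') T.1 ∈ S.punctHull := by
  rw [Transversal.translate_mem_iff]
  obtain ⟨q, hq⟩ := S.mem_punctures.1 hz'
  exact ⟨q, supertile_subset_of_mem_cell hT (mem_translate.2 (by simpa using hq))⟩

theorem add_mem_punctures {n k : ℕ} {p q : ι} {z w : Euc d} (hz : z ∈ S.punctures n p)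
    (hw : ((p, w) : Tile d ι) ∈ S.supertile k q) : z + S.scale ^ n • w ∈ S.punctures (n + k) q := by
  obtain ⟨r, hr⟩ := S.mem_punctures.1 hz
  exact S.mem_punctures.2 ⟨r, supertile_subset hw (mem_translate.2 (by simpa using hr))⟩

/-- A cell of order `n` is a union of cells of order `n + k`. -/
theorem mem_cell_iff_exists [Nonempty ι] [S.IsRegular] {n k : ℕ} {p : ι} {z : Euc d}
    {T : S.Transversal} : T ∈ S.cell n p z ↔
      ∃ q, ∃ w, ((p, w) : Tile d ι) ∈ S.supertile k q ∧
        T ∈ S.cell (n + k) q (z + S.scale ^ n • w) := by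
  constructor
  · rintro ⟨U, hU, hp, he⟩
    obtain ⟨q, w, hw, V, hV, hq, heV⟩ := exists_mem_cell (S := S) k ⟨U, hU, p, hp⟩
    have hUV : U = translate (-w) (S.substMap^[k] V) := heV
    obtain ⟨p', hp'⟩ := S.mem_punctures.1 hw
    have hp'U : ((p', 0) : Tile d ι) ∈ U := by
      rw [hUV, mem_translate]
      have := supertile_subset_of_mem_iterate (S := S) (n := k) hq
      rw [smul_zero, translate_zero] at this
      simpa using this hp'
    have hpp : ((p, 0) : Tile d ι) = (p', 0) := hU.1.1.eq_of_snd hp hp'U rfl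
    rw [Prod.mk.injEq] at hpp
    refine ⟨q, w, hpp.1 ▸ hp', V, hV, hq, ?_⟩
    rw [he, hUV, iterate_translate, ← Function.iterate_add_apply, translate_translate]
    congr 1
    simp [add_comm]
  · rintro ⟨q, w, hw, V, hV, hq, he⟩
    refine ⟨translate (-w) (S.substMap^[k] V), hull_translate (hull_iterate hV k) _, ?_, ?_⟩
    · rw [mem_translate]
      have := supertile_subset_of_mem_iterate (S := S) (n := k) hq
      rw [smul_zero, translate_zero] at this
      simpa using this hw
    · rw [he, iterate_translate, ← Function.iterate_add_apply, translate_translate]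
      congr 1
      simp [add_comm]

end Finite

/-! ### Equivariance of cells and punctures. -/

namespace IsSymmetryGroup

variable {G : Subgroup (OrthGroup d)} [MulAction G ι]

theorem iterate_rotate (hG : S.IsSymmetryGroup G) (g : G) (n : ℕ) (P : Set (Tile d ι)) :
    S.substMap^[n] (rotate g P) = rotate g (S.substMap^[n] P) := by
  induction n with
  | zero => rfl
  | succ n ih =>
    rw [Function.iterate_succ_apply', Function.iterate_succ_apply', ih, hG.substMap_rotate]

theorem mem_cell_rotate (hG : S.IsSymmetryGroup G) (g : G) {n : ℕ} {p : ι} {z : Euc d}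
    {T T' : S.Transversal} (h : T'.1 = rotate g T.1) (hT : T ∈ S.cell n p z) :
    T' ∈ S.cell n (g • p) ((g : OrthGroup d) z) := by
  obtain ⟨U, hU, hp, he⟩ := hT
  refine ⟨rotate g U, hG.hull_rotate g hU, ⟨_, hp, by simp [Tile.rotate]⟩, ?_⟩
  rw [h, he, rotate_translate, hG.iterate_rotate, map_neg]

theorem mem_punctures_rotate [Finite ι] (hG : S.IsSymmetryGroup G) (g : G) {n : ℕ} {p : ι}
    {z : Euc d} (hz : z ∈ S.punctures n p) : (g : OrthGroup d) z ∈ S.punctures n (g • p) := by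
  obtain ⟨q, hq⟩ := S.mem_punctures.1 hz
  refine S.mem_punctures.2 ⟨g • q, ?_⟩
  rw [hG.supertile_smul]
  exact ⟨_, hq, rfl⟩

end IsSymmetryGroup

end SubstitutionSystem
end SubstTiling

namespace SubstTiling

/-! ### Weighted compositions with partial injections on `ℓ²` -/

section WeightedComp

variable {X : Type*}

/-- As `σ` is injective where it is defined, the nonzero terms are distinct coordinates of `ξ`. -/
theorem sum_option_rpow_le (σ : X → Option X)
    (hσ : ∀ a b c, σ a = some c → σ b = some c → a = b) (ξ : lp (fun _ : X => ℂ) 2)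
    (s : Finset X) :
    ∑ a ∈ s, ‖(σ a).elim 0 (ξ : X → ℂ)‖ ^ (2 : ENNReal).toReal ≤ ‖ξ‖ ^ (2 : ENNReal).toReal := by
  classical
  have h0 : (0 : ℝ) < (2 : ENNReal).toReal := by norm_num
  set h : Option X → ℝ := fun o => ‖o.elim 0 (ξ : X → ℂ)‖ ^ (2 : ENNReal).toReal with hh
  have hnone : h none = 0 := by simp [hh]
  have hnn : ∀ o, 0 ≤ h o := fun o => by positivity
  set s' := s.filter fun a => σ a ≠ none
  calc ∑ a ∈ s, h (σ a) = ∑ a ∈ s', h (σ a) := by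
        symm
        apply Finset.sum_filter_of_ne
        intro a _ hne hn
        exact hne (by rw [hn, hnone])
    _ = ∑ o ∈ s'.image σ, h o := by
        refine (Finset.sum_image fun a ha b hb hab => ?_).symm
        obtain ⟨c, hc⟩ := Option.ne_none_iff_exists'.1 (Finset.mem_filter.1 ha).2
        exact hσ a b c hc (hab ▸ hc)
    _ ≤ ∑ o ∈ Finset.insertNone (Finset.eraseNone (s'.image σ)), h o := by
        refine Finset.sum_le_sum_of_subset_of_nonneg (fun o ho => ?_) fun o _ _ => hnn o
        rcases o with _ | b
        · simp
        · simpa [Finset.mem_insertNone] using ho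
    _ = ∑ b ∈ Finset.eraseNone (s'.image σ), ‖(ξ : X → ℂ) b‖ ^ (2 : ENNReal).toReal := by
        rw [Finset.sum_insertNone, hnone, zero_add]
        rfl
    _ ≤ _ := lp.sum_rpow_le_norm_rpow h0 ξ _

theorem sum_weighted_rpow_le {w : X → ℂ} {C : ℝ} (hC : 0 ≤ C) (hw : ∀ a, ‖w a‖ ≤ C)
    (σ : X → Option X)
    (hσ : ∀ a b c, σ a = some c → σ b = some c → a = b) (ξ : lp (fun _ : X => ℂ) 2)
    (s : Finset X) :
    ∑ a ∈ s, ‖w a * (σ a).elim 0 (ξ : X → ℂ)‖ ^ (2 : ENNReal).toReal ≤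
      (C * ‖ξ‖) ^ (2 : ENNReal).toReal := by
  rw [Real.mul_rpow hC (norm_nonneg _)]
  refine le_trans ?_ (mul_le_mul_of_nonneg_left (sum_option_rpow_le σ hσ ξ s) (by positivity))
  rw [Finset.mul_sum]
  refine Finset.sum_le_sum fun a _ => ?_
  rw [norm_mul, Real.mul_rpow (norm_nonneg _) (norm_nonneg _)]
  gcongr
  exact hw a

/-- The operator `ξ ↦ (a ↦ w a * ξ (σ a))`, where `σ` is a partial injection. -/
def weightedComp (w : X → ℂ) (C : ℝ) (hC : 0 ≤ C) (hw : ∀ a, ‖w a‖ ≤ C) (σ : X → Option X)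
    (hσ : ∀ a b c, σ a = some c → σ b = some c → a = b) :
    lp (fun _ : X => ℂ) 2 →L[ℂ] lp (fun _ : X => ℂ) 2 :=
  LinearMap.mkContinuous
    { toFun := fun ξ => ⟨fun a => w a * (σ a).elim 0 (ξ : X → ℂ),
        memℓp_gen' (sum_weighted_rpow_le hC hw σ hσ ξ)⟩
      map_add' := fun ξ η => by
        ext a
        change w a * (σ a).elim 0 (⇑(ξ + η)) =
          w a * (σ a).elim 0 (ξ : X → ℂ) + w a * (σ a).elim 0 (η : X → ℂ)
        rcases σ a with _ | b
        · exact (show w a * 0 = w a * 0 + w a * 0 by simp)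
        · exact mul_add _ _ _
      map_smul' := fun c ξ => by
        ext a
        change w a * (σ a).elim 0 (⇑(c • ξ)) = c * (w a * (σ a).elim 0 (ξ : X → ℂ))
        rcases σ a with _ | b <;> simp [mul_left_comm] } C
    fun ξ => lp.norm_le_of_forall_sum_le (by norm_num) (by positivity)
      (sum_weighted_rpow_le hC hw σ hσ ξ)

theorem weightedComp_apply (w : X → ℂ) (C : ℝ) (hC : 0 ≤ C) (hw : ∀ a, ‖w a‖ ≤ C)
    (σ : X → Option X) (hσ : ∀ a b c, σ a = some c → σ b = some c → a = b)
    (ξ : lp (fun _ : X => ℂ) 2) (a : X) :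
    (weightedComp w C hC hw σ hσ ξ : X → ℂ) a = w a * (σ a).elim 0 (ξ : X → ℂ) := rfl

theorem norm_weightedComp_le (w : X → ℂ) (C : ℝ) (hC : 0 ≤ C) (hw : ∀ a, ‖w a‖ ≤ C)
    (σ : X → Option X) (hσ : ∀ a b c, σ a = some c → σ b = some c → a = b) :
    ‖weightedComp w C hC hw σ hσ‖ ≤ C :=
  LinearMap.mkContinuous_norm_le _ hC _

open Classical in
/-- The basis vector of `ℓ²(X)` at `a`. -/
def basisVec (a : X) : lp (fun _ : X => ℂ) 2 := lp.single 2 a (1 : ℂ)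

open Classical in
theorem basisVec_apply (a b : X) : (basisVec a : X → ℂ) b = if b = a then 1 else 0 := by
  simp [basisVec, lp.single_apply, Pi.single_apply]

theorem inner_basisVec (a : X) (ξ : lp (fun _ : X => ℂ) 2) :
    inner ℂ (basisVec a) ξ = (ξ : X → ℂ) a := by
  classical
  rw [basisVec, lp.inner_single_left]
  simp

theorem norm_basisVec (a : X) : ‖(basisVec a : lp (fun _ : X => ℂ) 2)‖ = 1 := by
  classical
  rw [basisVec, lp.norm_single (by norm_num)]
  simp

theorem clm_ext_basisVec {A B : lp (fun _ : X => ℂ) 2 →L[ℂ] lp (fun _ : X => ℂ) 2}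
    (h : ∀ b, A (basisVec b) = B (basisVec b)) : A = B := by
  classical
  ext1 ξ
  have hs := lp.hasSum_single (p := 2) (by norm_num) ξ
  have h1 := hs.mapL A
  have h2 := hs.mapL B
  refine h1.unique ?_
  convert h2 using 2 with b
  have : lp.single 2 b ((ξ : X → ℂ) b) = (ξ : X → ℂ) b • (basisVec b : lp (fun _ : X => ℂ) 2) := by
    rw [basisVec, ← lp.single_smul]; simp
  rw [this, map_smul, map_smul, h]

theorem star_eq_of_coeff {A B : lp (fun _ : X => ℂ) 2 →L[ℂ] lp (fun _ : X => ℂ) 2}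
    (h : ∀ a b, (B (basisVec b) : X → ℂ) a =
      (starRingEnd ℂ) ((A (basisVec a) : X → ℂ) b)) : star A = B := by
  refine clm_ext_basisVec fun b => ?_
  ext a
  rw [h, ← inner_basisVec, ← inner_basisVec, ContinuousLinearMap.star_eq_adjoint,
    ContinuousLinearMap.adjoint_inner_right, inner_conj_symm]

end WeightedComp

namespace SubstitutionSystem

variable {d : ℕ} {ι : Type*} {S : SubstitutionSystem d ι}

/-! ### The topology of the groupoid -/

namespace RPunc

/-- The range of a groupoid element as a point of the punctured hull. -/
def range (γ : S.RPunc) : S.Transversal := ⟨γ.rng, γ.rng_mem⟩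

/-- The source of a groupoid element as a point of the punctured hull. -/
def source (γ : S.RPunc) : S.Transversal := ⟨γ.src, γ.src_mem⟩

end RPunc

variable (S) in
/-- The elements `(T, T + x)` of the groupoid. -/
def slice (x : Euc d) : Set S.RPunc := {γ | γ.src = translate x γ.rng}

/-- The patch consisting of `t` and the tiles with punctures `0` and `-x` gives a generator of the
topology that fixes the translation vector and prescribes `t`. -/
theorem exists_basicGraph {x : Euc d} {γ : S.RPunc} (hγ : γ ∈ S.slice x) {t : Tile d ι}
    (ht : t ∈ γ.rng) : ∃ V : Set S.RPunc, IsOpen V ∧ γ ∈ V ∧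
      ∀ η ∈ V, η ∈ S.slice x ∧ t ∈ η.rng := by
  obtain ⟨p, hp⟩ := γ.rng_mem.2
  obtain ⟨q, hq⟩ := γ.src_mem.2
  have hq' : ((q, -x) : Tile d ι) ∈ γ.rng := by
    rw [hγ, mem_translate] at hq; simpa using hq
  set P : Set (Tile d ι) := {(p, 0), (q, -x), t}
  have hP : P ⊆ γ.rng := by
    rintro s (rfl | rfl | rfl) <;> assumption
  refine ⟨S.basicGraph P (p, 0) (q, -x), TopologicalSpace.isOpen_generateFrom_of_mem
    ⟨γ.rng, γ.rng_mem.1, P, hP, toFinite _, _, by simp [P], _, by simp [P], rfl⟩, ⟨?_, ?_⟩, ?_⟩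
  · simpa [translate_zero] using hP
  · rw [hγ]; simp
  · rintro η ⟨h1, h2⟩
    refine ⟨?_, ?_⟩
    · rw [slice, mem_ofPred_eq, h2]; simp
    · simp only [neg_zero, translate_zero] at h1
      exact h1 (by simp [P])

theorem isOpen_slice (x : Euc d) : IsOpen (S.slice x) := by
  refine isOpen_iff_forall_mem_open.2 fun γ hγ => ?_
  obtain ⟨p, hp⟩ := γ.rng_mem.2
  obtain ⟨V, hV, hγV, h⟩ := exists_basicGraph hγ hp
  exact ⟨V, fun η hη => (h η hη).1, hV, hγV⟩

theorem continuous_range : Continuous (RPunc.range : S.RPunc → S.Transversal) := by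
  refine Transversal.continuous_iff.2 fun t => isOpen_iff_forall_mem_open.2 fun γ hγ => ?_
  obtain ⟨x, hx⟩ := γ.rel
  obtain ⟨V, hV, hγV, h⟩ := exists_basicGraph hx hγ
  exact ⟨V, fun η hη => (h η hη).2, hV, hγV⟩

variable (S) in
/-- The tilings that can be translated by `x` within the punctured hull. -/
def translatable (x : Euc d) : Set S.Transversal := {T | translate x T.1 ∈ S.punctHull}

/-- The groupoid element `(T, T + x)`. -/
def arrow (x : Euc d) (T : S.Transversal) (h : T ∈ S.translatable x) : S.RPunc :=
  ⟨T.1, translate x T.1, T.2, h, x, rfl⟩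

/-- The translate of a point of the punctured hull. -/
def Transversal.shift (x : Euc d) (T : S.Transversal) (h : T ∈ S.translatable x) :
    S.Transversal := ⟨translate x T.1, h⟩

theorem isClopen_translatable [Finite ι] (x : Euc d) : IsClopen (S.translatable x) :=
  Transversal.isClopen_translate_mem x

theorem _root_.continuous_ite_of_isClopen {X Y : Type*} [TopologicalSpace X] [TopologicalSpace Y]
    {U : Set X} (hU : IsClopen U) {f : X → Y} {c : Y} (hf : Continuous fun x : U => f x)
    (hc : ∀ x ∉ U, f x = c) : Continuous f := by
  have h1 : ContinuousOn f U := continuousOn_iff_continuous_domRestrict.2 hf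
  have h2 : ContinuousOn f Uᶜ := continuousOn_const.congr hc
  have := h1.union_of_isOpen h2 hU.isOpen hU.compl.isOpen
  rwa [union_compl_self, continuousOn_univ] at this

section Regular

variable [Finite ι] [Nonempty ι] [S.IsRegular]

/-- Tilings of the hull have no periods. The open slices are therefore disjoint, hence also closed,
and the groupoid is a topological disjoint union of compact pieces. -/
theorem slice_unique {x y : Euc d} {γ : S.RPunc} (hx : γ ∈ S.slice x) (hy : γ ∈ S.slice y) :
    x = y := by
  rw [slice, mem_ofPred_eq] at hx hy
  exact translate_injective γ.rng_mem.1 (hx.symm.trans hy)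

theorem isClosed_slice (x : Euc d) : IsClosed (S.slice x) := by
  refine isOpen_compl_iff.1 (isOpen_iff_forall_mem_open.2 fun γ hγ => ?_)
  obtain ⟨y, hy⟩ := γ.rel
  refine ⟨S.slice y, fun η hη hη' => hγ ?_, isOpen_slice y, hy⟩
  rw [slice_unique hη' hη]
  exact hy

theorem continuous_arrow (x : Euc d) :
    Continuous fun T : S.translatable x => arrow x T.1 T.2 := by
  refine continuous_generateFrom_iff.2 ?_
  rintro _ ⟨T, hT, P, hP, hfin, t₁, ht₁, t₂, ht₂, rfl⟩
  by_cases hx : x = t₁.2 - t₂.2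
  · have : (fun T : S.translatable x => arrow x T.1 T.2) ⁻¹' S.basicGraph P t₁ t₂ =
        Subtype.val ⁻¹' {T : S.Transversal | translate (-t₁.2) P ⊆ T.1} := by
      ext T
      simp [basicGraph, arrow, hx]
    rw [this]
    exact (Transversal.isClopen_subset (hfin.image _)).isOpen.preimage continuous_subtype_val
  · have : (fun T : S.translatable x => arrow x T.1 T.2) ⁻¹' S.basicGraph P t₁ t₂ = ∅ := by
      ext T
      simp only [mem_preimage, mem_empty_iff_false, iff_false]
      rintro ⟨-, h⟩
      exact hx (translate_injective T.1.mem_hull h)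
    rw [this]
    exact isOpen_empty

theorem isCompact_slice (x : Euc d) : IsCompact (S.slice x) := by
  have : CompactSpace (S.translatable x) :=
    isCompact_iff_compactSpace.1 (isClopen_translatable x).isClosed.isCompact
  have h : S.slice x = Set.range fun T : S.translatable x => arrow x T.1 T.2 := by
    ext γ
    constructor
    · intro hγ
      refine ⟨⟨γ.range, ?_⟩, RPunc.ext rfl hγ.symm⟩
      have := γ.src_mem
      rwa [hγ] at this
    · rintro ⟨T, rfl⟩
      rfl
  rw [h]
  exact isCompact_range (continuous_arrow x)

open Classical in
/-- The function on the groupoid supported on the elements `(T, T + x)`, with value `φ T`. -/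
def sliceFun (φ : C(S.Transversal, ℂ)) (x : Euc d) (γ : S.RPunc) : ℂ :=
  if γ ∈ S.slice x then φ γ.range else 0

theorem continuous_sliceFun (φ : C(S.Transversal, ℂ)) (x : Euc d) :
    Continuous (sliceFun φ x) := by
  refine continuous_ite_of_isClopen (U := S.slice x) ⟨isClosed_slice x, isOpen_slice x⟩ (c := 0)
    ?_ fun γ hγ => if_neg hγ
  have : (fun γ : S.slice x => sliceFun φ x γ) = fun γ => φ γ.1.range :=
    funext fun γ => if_pos γ.2
  rw [this]
  exact φ.continuous.comp (continuous_range.comp continuous_subtype_val)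

theorem hasCompactSupport_sliceFun (φ : C(S.Transversal, ℂ)) (x : Euc d) :
    HasCompactSupport (sliceFun φ x) :=
  HasCompactSupport.intro' (isCompact_slice x) (isClosed_slice x) fun _ hγ => if_neg hγ

open Classical in
/-- The restriction of a continuous function on the groupoid to the elements `(T, T + x)`. -/
def sliceCoeff (f : S.RPunc → ℂ) (hf : Continuous f) (x : Euc d) : C(S.Transversal, ℂ) where
  toFun T := if h : T ∈ S.translatable x then f (arrow x T h) else 0
  continuous_toFun := by
    refine continuous_ite_of_isClopen (isClopen_translatable x) (c := 0) ?_ fun T hT => dif_neg hT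
    have : (fun T : S.translatable x => if h : T.1 ∈ S.translatable x then f (arrow x T h) else 0) =
        fun T => f (arrow x T.1 T.2) := funext fun T => dif_pos T.2
    rw [this]
    exact hf.comp (continuous_arrow x)

/-- A compactly supported continuous function is a finite sum of functions on slices. -/
theorem exists_eq_sum_sliceFun {f : S.RPunc → ℂ} (hf : Continuous f) (hc : HasCompactSupport f) :
    ∃ F : Finset (Euc d), ∀ γ, f γ = ∑ x ∈ F, sliceFun (sliceCoeff f hf x) x γ := by
  classical
  obtain ⟨F, hF⟩ := hc.isCompact.elim_finite_subcover S.slice isOpen_slice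
    fun γ _ => mem_iUnion.2 γ.rel
  refine ⟨F, fun γ => ?_⟩
  obtain ⟨y, hy⟩ := γ.rel
  have hy : γ ∈ S.slice y := hy
  have hval : sliceFun (sliceCoeff f hf y) y γ = f γ := by
    have htr : γ.range ∈ S.translatable y := by
      have := γ.src_mem
      rwa [hy] at this
    rw [sliceFun, if_pos hy]
    change (if h : γ.range ∈ S.translatable y then f (arrow y γ.range h) else 0) = f γ
    rw [dif_pos htr]
    congr 1
    exact RPunc.ext rfl hy.symm
  have hne : ∀ x, x ≠ y → sliceFun (sliceCoeff f hf x) x γ = 0 := fun x hx =>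
    if_neg fun h => hx (slice_unique h hy)
  by_cases hyF : y ∈ F
  · rw [Finset.sum_eq_single_of_mem y hyF fun x _ hx => hne x hx, hval]
  · rw [Finset.sum_eq_zero fun x hx => hne x (ne_of_mem_of_not_mem hx hyF)]
    by_contra hfγ
    obtain ⟨x, hx, hγx⟩ := mem_iUnion₂.1 (hF (subset_tsupport f hfγ))
    rw [slice_unique hγx hy] at hx
    exact hyF hx

end Regular

end SubstitutionSystem
end SubstTiling

namespace SubstTiling
namespace SubstitutionSystem

variable {d : ℕ} {ι : Type*} {S : SubstitutionSystem d ι}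

/-! ### The diagonal and the shift operators -/

namespace RPunc

/-- The groupoid element `(T + x, T')` for `γ = (T, T')`. -/
def shiftRange (γ : S.RPunc) (x : Euc d) (h : γ.range ∈ S.translatable x) : S.RPunc where
  rng := translate x γ.rng
  src := γ.src
  rng_mem := h
  src_mem := γ.src_mem
  rel := by
    obtain ⟨y, hy⟩ := γ.rel
    exact ⟨y - x, by rw [translate_translate, add_sub_cancel, hy]⟩

/-- The groupoid element `(T, T' + x)` for `γ = (T, T')`. -/
def shiftSource (γ : S.RPunc) (x : Euc d) (h : γ.source ∈ S.translatable x) : S.RPunc where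
  rng := γ.rng
  src := translate x γ.src
  rng_mem := γ.rng_mem
  src_mem := h
  rel := by
    obtain ⟨y, hy⟩ := γ.rel
    exact ⟨y + x, by rw [hy, translate_translate]⟩

/-- The unit of the groupoid at `T`. -/
def unit (T : S.Transversal) : S.RPunc := ⟨T.1, T.1, T.2, T.2, 0, (translate_zero _).symm⟩

end RPunc

theorem translate_inj {x : Euc d} {P Q : Set (Tile d ι)} : translate x P = translate x Q ↔ P = Q :=
  ⟨fun h => by simpa [translate_neg_translate] using congrArg (translate (-x)) h, fun h => by rw [h]⟩

theorem zero_mem_translatable (T : S.Transversal) : T ∈ S.translatable 0 := by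
  rw [translatable, mem_ofPred_eq, translate_zero]; exact T.2

theorem mem_translatable_translate {x y : Euc d} {T : S.Transversal} (h : T ∈ S.translatable x) :
    T.shift x h ∈ S.translatable y ↔ T ∈ S.translatable (x + y) := by
  simp only [translatable, mem_ofPred_eq, Transversal.shift, translate_translate]

open Classical in
/-- The shift operator `(V_x ξ)(T, T') = ξ(T + x, T')`. -/
def shiftOp (x : Euc d) : S.RegSpace →L[ℂ] S.RegSpace :=
  weightedComp (fun _ => 1) 1 zero_le_one (fun _ => by simp)
    (fun γ => if h : γ.range ∈ S.translatable x then some (γ.shiftRange x h) else none) (by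
      intro a b c ha hb
      split_ifs at ha hb
      rw [Option.some.injEq] at ha hb
      have h := ha.trans hb.symm
      have h1 : translate x a.rng = translate x b.rng := (RPunc.ext_iff.1 h).1
      have h2 : a.src = b.src := (RPunc.ext_iff.1 h).2
      exact RPunc.ext (translate_inj.1 h1) h2)

open Classical in
/-- The right shift operator `(R_x ξ)(T, T') = ξ(T, T' + x)`. -/
def rightShiftOp (x : Euc d) : S.RegSpace →L[ℂ] S.RegSpace :=
  weightedComp (fun _ => 1) 1 zero_le_one (fun _ => by simp)
    (fun γ => if h : γ.source ∈ S.translatable x then some (γ.shiftSource x h) else none) (by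
      intro a b c ha hb
      split_ifs at ha hb
      rw [Option.some.injEq] at ha hb
      have h := ha.trans hb.symm
      have h1 : a.rng = b.rng := (RPunc.ext_iff.1 h).1
      have h2 : translate x a.src = translate x b.src := (RPunc.ext_iff.1 h).2
      exact RPunc.ext h1 (translate_inj.1 h2))

open Classical in
theorem shiftOp_apply (x : Euc d) (ξ : S.RegSpace) (γ : S.RPunc) :
    (shiftOp x ξ : S.RPunc → ℂ) γ =
      if h : γ.range ∈ S.translatable x then (ξ : S.RPunc → ℂ) (γ.shiftRange x h) else 0 := by
  rw [shiftOp, weightedComp_apply, one_mul]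
  split_ifs <;> rfl

open Classical in
theorem rightShiftOp_apply (x : Euc d) (ξ : S.RegSpace) (γ : S.RPunc) :
    (rightShiftOp x ξ : S.RPunc → ℂ) γ =
      if h : γ.source ∈ S.translatable x then (ξ : S.RPunc → ℂ) (γ.shiftSource x h) else 0 := by
  rw [rightShiftOp, weightedComp_apply, one_mul]
  split_ifs <;> rfl

theorem norm_shiftOp_le (x : Euc d) : ‖(shiftOp x : S.RegSpace →L[ℂ] S.RegSpace)‖ ≤ 1 :=
  norm_weightedComp_le _ _ _ _ _ _

open Classical in
theorem shiftOp_basisVec (x : Euc d) (a b : S.RPunc) :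
    (shiftOp x (basisVec b) : S.RPunc → ℂ) a =
      if b.rng = translate x a.rng ∧ b.src = a.src then 1 else 0 := by
  rw [shiftOp_apply]
  by_cases h : a.range ∈ S.translatable x
  · rw [dif_pos h, basisVec_apply]
    refine if_congr ?_ rfl rfl
    rw [RPunc.ext_iff]
    exact and_congr eq_comm eq_comm
  · rw [dif_neg h, if_neg]
    rintro ⟨h1, -⟩
    refine h ?_
    change translate x a.rng ∈ S.punctHull
    rw [← h1]
    exact b.rng_mem

theorem star_shiftOp (x : Euc d) :
    star (shiftOp x : S.RegSpace →L[ℂ] S.RegSpace) = shiftOp (-x) := by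
  refine star_eq_of_coeff fun a b => ?_
  rw [shiftOp_basisVec, shiftOp_basisVec, apply_ite (starRingEnd ℂ), map_one, map_zero]
  refine if_congr ?_ rfl rfl
  rw [eq_comm (a := b.src), and_congr_left_iff]
  intro _
  constructor
  · intro h; rw [h, translate_translate_neg]
  · intro h; rw [h, translate_neg_translate]

theorem shiftOp_zero : (shiftOp 0 : S.RegSpace →L[ℂ] S.RegSpace) = 1 := by
  ext ξ γ
  rw [shiftOp_apply, dif_pos (zero_mem_translatable _)]
  have h : γ.shiftRange 0 (zero_mem_translatable _) = γ := RPunc.ext (translate_zero _) rfl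
  rw [h]
  rfl

open Classical in
/-- The function `T ↦ φ(T + x)`, extended by zero. -/
def shiftFun [Finite ι] (x : Euc d) (φ : C(S.Transversal, ℂ)) : C(S.Transversal, ℂ) where
  toFun T := if h : T ∈ S.translatable x then φ (T.shift x h) else 0
  continuous_toFun := by
    refine continuous_ite_of_isClopen (isClopen_translatable x) (c := 0) ?_ fun T hT => dif_neg hT
    have : (fun T : S.translatable x => if h : T.1 ∈ S.translatable x then φ (T.1.shift x h) else 0)
        = fun T => φ (T.1.shift x T.2) := funext fun T => dif_pos T.2
    rw [this]
    refine φ.continuous.comp (Transversal.continuous_iff.2 fun t => ?_)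
    have : {T : S.translatable x | t ∈ (T.1.shift x T.2).1} =
        Subtype.val ⁻¹' {T : S.Transversal | ((t.1, t.2 - x) : Tile d ι) ∈ T.1} := by
      ext T; exact mem_translate
    rw [this]
    exact (Transversal.isOpen_mem _).preimage continuous_subtype_val

open Classical in
theorem shiftFun_apply [Finite ι] (x : Euc d) (φ : C(S.Transversal, ℂ)) (T : S.Transversal) :
    shiftFun x φ T = if h : T ∈ S.translatable x then φ (T.shift x h) else 0 := rfl

section Regular

variable [Finite ι] [Nonempty ι] [S.IsRegular]

/-- The operator of multiplication by `φ(T)` at `(T, T')`. -/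
def diagOp (φ : C(S.Transversal, ℂ)) : S.RegSpace →L[ℂ] S.RegSpace :=
  weightedComp (fun γ => φ γ.range) ‖φ‖ (norm_nonneg _) (fun γ => φ.norm_coe_le_norm _) some (by
    rintro a b c ⟨⟩ ⟨⟩
    rfl)

theorem diagOp_apply (φ : C(S.Transversal, ℂ)) (ξ : S.RegSpace) (γ : S.RPunc) :
    (diagOp φ ξ : S.RPunc → ℂ) γ = φ γ.range * (ξ : S.RPunc → ℂ) γ := rfl

theorem norm_diagOp_le (φ : C(S.Transversal, ℂ)) : ‖diagOp φ‖ ≤ ‖φ‖ :=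
  norm_weightedComp_le _ _ _ _ _ _

theorem diagOp_mul (φ ψ : C(S.Transversal, ℂ)) : diagOp (φ * ψ) = diagOp φ * diagOp ψ := by
  ext ξ γ
  change (diagOp (φ * ψ) ξ : S.RPunc → ℂ) γ = (diagOp φ (diagOp ψ ξ) : S.RPunc → ℂ) γ
  simp only [diagOp_apply, ContinuousMap.mul_apply, mul_assoc]

theorem diagOp_add (φ ψ : C(S.Transversal, ℂ)) : diagOp (φ + ψ) = diagOp φ + diagOp ψ := by
  ext ξ γ
  change _ = (diagOp φ ξ : S.RPunc → ℂ) γ + (diagOp ψ ξ : S.RPunc → ℂ) γ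
  simp only [diagOp_apply, ContinuousMap.add_apply, add_mul]

theorem diagOp_smul (c : ℂ) (φ : C(S.Transversal, ℂ)) : diagOp (c • φ) = c • diagOp φ := by
  ext ξ γ
  change _ = c * (diagOp φ ξ : S.RPunc → ℂ) γ
  simp only [diagOp_apply, ContinuousMap.smul_apply, smul_eq_mul, mul_assoc]

theorem diagOp_one : diagOp (1 : C(S.Transversal, ℂ)) = 1 := by
  ext ξ γ
  change _ = (ξ : S.RPunc → ℂ) γ
  simp only [diagOp_apply, ContinuousMap.one_apply, one_mul]

theorem star_diagOp (φ : C(S.Transversal, ℂ)) : star (diagOp φ) = diagOp (star φ) := by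
  refine star_eq_of_coeff fun a b => ?_
  rw [diagOp_apply, diagOp_apply, basisVec_apply, basisVec_apply]
  by_cases h : a = b
  · subst h; simp
  · simp [h, Ne.symm h]

theorem shiftOp_mul_diagOp (x : Euc d) (φ : C(S.Transversal, ℂ)) :
    shiftOp x * diagOp φ = diagOp (shiftFun x φ) * shiftOp x := by
  ext ξ γ
  change (shiftOp x (diagOp φ ξ) : S.RPunc → ℂ) γ =
    (diagOp (shiftFun x φ) (shiftOp x ξ) : S.RPunc → ℂ) γ
  rw [shiftOp_apply, diagOp_apply, shiftFun_apply, shiftOp_apply]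
  by_cases h : γ.range ∈ S.translatable x
  · simp only [dif_pos h, diagOp_apply]; rfl
  · simp only [dif_neg h, zero_mul]

/-- The product vanishes where `T + x` leaves the punctured hull, whereas `V_(x+y)` need not; the
indicator function corrects this. -/
theorem shiftOp_mul_shiftOp (x y : Euc d) :
    (shiftOp x * shiftOp y : S.RegSpace →L[ℂ] S.RegSpace) =
      diagOp (shiftFun x 1) * shiftOp (x + y) := by
  ext ξ γ
  change (shiftOp x (shiftOp y ξ) : S.RPunc → ℂ) γ =
    (diagOp (shiftFun x 1) (shiftOp (x + y) ξ) : S.RPunc → ℂ) γ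
  rw [shiftOp_apply, diagOp_apply, shiftFun_apply]
  by_cases h : γ.range ∈ S.translatable x
  · rw [dif_pos h, dif_pos h, ContinuousMap.one_apply, one_mul, shiftOp_apply, shiftOp_apply]
    have hiff : (γ.shiftRange x h).range ∈ S.translatable y ↔ γ.range ∈ S.translatable (x + y) :=
      mem_translatable_translate h
    by_cases h' : γ.range ∈ S.translatable (x + y)
    · rw [dif_pos h', dif_pos (hiff.2 h')]
      have he : (γ.shiftRange x h).shiftRange y (hiff.2 h') = γ.shiftRange (x + y) h' :=
        RPunc.ext (translate_translate _ _ _) rfl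
      rw [he]
    · rw [dif_neg h', dif_neg fun h2 => h' (hiff.1 h2)]
  · rw [dif_neg h, dif_neg h, zero_mul]

/-! ### The tiling algebra in terms of these operators -/

open Classical in
-- For `γ = (T, T')` only `η = (T + x, T')` can contribute to the convolution, so the regular
-- representation of a function on a slice is `φ V_x`.
theorem hasSum_sliceFun (φ : C(S.Transversal, ℂ)) (x : Euc d) (ξ : S.RegSpace) (γ : S.RPunc) :
    HasSum (fun η : {η : S.RPunc // η.src = γ.src} =>
      sliceFun φ x (γ.mulInv η.1 η.2) * (ξ : S.RPunc → ℂ) η.1)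
      (((diagOp φ * shiftOp x : S.RegSpace →L[ℂ] S.RegSpace) ξ : S.RPunc → ℂ) γ) := by
  have hval : ((diagOp φ * shiftOp x : S.RegSpace →L[ℂ] S.RegSpace) ξ : S.RPunc → ℂ) γ =
      φ γ.range * (shiftOp x ξ : S.RPunc → ℂ) γ := rfl
  rw [hval, shiftOp_apply]
  have hmem : ∀ η : {η : S.RPunc // η.src = γ.src},
      γ.mulInv η.1 η.2 ∈ S.slice x ↔ η.1.rng = translate x γ.rng := fun η => Iff.rfl
  by_cases h : γ.range ∈ S.translatable x
  · rw [dif_pos h]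
    have := hasSum_single (f := fun η : {η : S.RPunc // η.src = γ.src} =>
      sliceFun φ x (γ.mulInv η.1 η.2) * (ξ : S.RPunc → ℂ) η.1) ⟨γ.shiftRange x h, rfl⟩ (by
        intro η hη
        rw [sliceFun, if_neg, zero_mul]
        rw [hmem]
        exact fun he => hη (Subtype.ext (RPunc.ext he η.2)))
    convert this using 1
    have hin : sliceFun φ x (γ.mulInv (γ.shiftRange x h) rfl) = φ γ.range :=
      if_pos (show γ.mulInv (γ.shiftRange x h) rfl ∈ S.slice x from rfl)
    rw [← hin]
  · rw [dif_neg h, mul_zero]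
    convert hasSum_zero using 2 with η
    rw [sliceFun, if_neg, zero_mul]
    rw [hmem]
    exact fun he => h (by change translate x γ.rng ∈ S.punctHull; rw [← he]; exact η.1.rng_mem)

theorem diagOp_mul_shiftOp_mem_regOperators (φ : C(S.Transversal, ℂ)) (x : Euc d) :
    diagOp φ * shiftOp x ∈ S.regOperators :=
  ⟨sliceFun φ x, continuous_sliceFun φ x, hasCompactSupport_sliceFun φ x,
    fun ξ γ => (hasSum_sliceFun φ x ξ γ).tsum_eq.symm⟩

variable (S) in
/-- The span of the operators `φ V_x`. -/
def coreSpan : Submodule ℂ (S.RegSpace →L[ℂ] S.RegSpace) :=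
  Submodule.span ℂ {a | ∃ φ x, a = diagOp φ * shiftOp x}

theorem diagOp_mul_shiftOp_mem_coreSpan (φ : C(S.Transversal, ℂ)) (x : Euc d) :
    diagOp φ * shiftOp x ∈ S.coreSpan := Submodule.subset_span ⟨φ, x, rfl⟩

theorem regOperators_subset_coreSpan : S.regOperators ⊆ S.coreSpan := by
  rintro a ⟨f, hf, hc, ha⟩
  obtain ⟨F, hF⟩ := exists_eq_sum_sliceFun hf hc
  have : a = ∑ x ∈ F, diagOp (sliceCoeff f hf x) * shiftOp x := by
    ext ξ γ
    have h1 := hasSum_sum fun x (_ : x ∈ F) => hasSum_sliceFun (sliceCoeff f hf x) x ξ γ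
    rw [ha ξ γ]
    simp only [hF, Finset.sum_mul]
    rw [h1.tsum_eq, _root_.sum_apply, lp.coeFn_sum, Finset.sum_apply]
  rw [this]
  exact Submodule.sum_mem _ fun x _ => diagOp_mul_shiftOp_mem_coreSpan _ _

theorem gen_mul_gen (φ ψ : C(S.Transversal, ℂ)) (x y : Euc d) :
    diagOp φ * shiftOp x * (diagOp ψ * shiftOp y) =
      diagOp (φ * shiftFun x ψ * shiftFun x 1) * shiftOp (x + y) := by
  rw [mul_assoc, ← mul_assoc (shiftOp x), shiftOp_mul_diagOp, mul_assoc (diagOp _) (shiftOp x),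
    shiftOp_mul_shiftOp, diagOp_mul, diagOp_mul]
  simp only [mul_assoc]

theorem star_gen (φ : C(S.Transversal, ℂ)) (x : Euc d) :
    star (diagOp φ * shiftOp x) = diagOp (shiftFun (-x) (star φ)) * shiftOp (-x) := by
  rw [star_mul, star_shiftOp, star_diagOp, shiftOp_mul_diagOp]

/-- The set of operators `φ V_x` is stable under products and adjoints, by `gen_mul_gen` and
`star_gen`, so its span is already a star algebra. -/
theorem adjoin_subset_coreSpan {a : S.RegSpace →L[ℂ] S.RegSpace}
    (ha : a ∈ StarAlgebra.adjoin ℂ S.regOperators) : a ∈ S.coreSpan := by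
  have hone : (1 : S.RegSpace →L[ℂ] S.RegSpace) ∈ S.coreSpan := by
    have := diagOp_mul_shiftOp_mem_coreSpan (S := S) 1 0
    rwa [diagOp_one, shiftOp_zero, mul_one] at this
  induction ha using StarAlgebra.adjoin_induction with
  | mem a ha => exact regOperators_subset_coreSpan ha
  | algebraMap c => rw [Algebra.algebraMap_eq_smul_one]; exact Submodule.smul_mem _ _ hone
  | add a b _ _ ha hb => exact add_mem ha hb
  | mul a b _ _ ha hb =>
    have h := Submodule.mul_mem_mul ha hb
    rw [coreSpan, Submodule.span_mul_span] at h
    refine Submodule.span_mono ?_ h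
    rintro _ ⟨_, ⟨φ, x, rfl⟩, _, ⟨ψ, y, rfl⟩, rfl⟩
    exact ⟨_, _, gen_mul_gen φ ψ x y⟩
  | star a h ha =>
    clear h
    induction ha using Submodule.span_induction with
    | mem a ha =>
      obtain ⟨φ, x, rfl⟩ := ha
      rw [star_gen]
      exact diagOp_mul_shiftOp_mem_coreSpan _ _
    | zero => rw [star_zero]; exact S.coreSpan.zero_mem
    | add a b _ _ ha hb => rw [star_add]; exact add_mem ha hb
    | smul c a _ ha => rw [star_smul]; exact Submodule.smul_mem _ _ ha

theorem gen_mem (φ : C(S.Transversal, ℂ)) (x : Euc d) :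
    diagOp φ * shiftOp x ∈ S.tilingSubalgebra :=
  StarSubalgebra.le_topologicalClosure _
    (StarAlgebra.subset_adjoin ℂ _ (diagOp_mul_shiftOp_mem_regOperators φ x))

theorem diagOp_mem (φ : C(S.Transversal, ℂ)) : diagOp φ ∈ S.tilingSubalgebra := by
  have := gen_mem φ 0
  rwa [shiftOp_zero, mul_one] at this

theorem shiftOp_mem (x : Euc d) : shiftOp x ∈ S.tilingSubalgebra := by
  have := gen_mem (S := S) 1 x
  rwa [diagOp_one, one_mul] at this

/-- The multiplication operators as elements of the tiling algebra. -/
def diagElt (φ : C(S.Transversal, ℂ)) : S.TilingAlgebra := ⟨diagOp φ, diagOp_mem φ⟩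

/-- The shift operators as elements of the tiling algebra. -/
def shiftElt (x : Euc d) : S.TilingAlgebra := ⟨shiftOp x, shiftOp_mem x⟩

/-- A property of elements of the tiling algebra which holds for the operators `φ V_x` and is
preserved by sums, scalar multiples and norm limits holds for all elements. -/
theorem tiling_induction {p : S.TilingAlgebra → Prop}
    (gen : ∀ φ x, p (diagElt φ * shiftElt x))
    (add : ∀ a b, p a → p b → p (a + b)) (smul : ∀ (c : ℂ) a, p a → p (c • a))
    (lim : ∀ a, (∀ ε > 0, ∃ b, p b ∧ ‖a - b‖ < ε) → p a) (a : S.TilingAlgebra) : p a := by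
  have hcore : ∀ b ∈ S.coreSpan, ∃ hb : b ∈ S.tilingSubalgebra, p ⟨b, hb⟩ := by
    intro b hb
    induction hb using Submodule.span_induction with
    | mem b hb =>
      obtain ⟨φ, x, rfl⟩ := hb
      exact ⟨gen_mem φ x, gen φ x⟩
    | zero =>
      refine ⟨ZeroMemClass.zero_mem _, ?_⟩
      have := smul 0 _ (gen 0 0)
      rw [zero_smul] at this
      exact this
    | add a b _ _ ha hb =>
      obtain ⟨ha, hpa⟩ := ha
      obtain ⟨hb, hpb⟩ := hb
      exact ⟨add_mem ha hb, add _ _ hpa hpb⟩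
    | smul c a _ ha =>
      obtain ⟨ha, hpa⟩ := ha
      exact ⟨SMulMemClass.smul_mem c ha, smul c _ hpa⟩
  refine lim a fun ε hε => ?_
  have ha : a.1 ∈ closure (StarAlgebra.adjoin ℂ S.regOperators :
    Set (S.RegSpace →L[ℂ] S.RegSpace)) := a.2
  obtain ⟨b, hb, hab⟩ := Metric.mem_closure_iff.1 ha ε hε
  obtain ⟨hb', hp⟩ := hcore b (adjoin_subset_coreSpan hb)
  refine ⟨⟨b, hb'⟩, hp, ?_⟩
  rw [dist_eq_norm] at hab
  exact hab

end Regular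

end SubstitutionSystem
end SubstTiling

namespace SubstTiling
namespace SubstitutionSystem

variable {d : ℕ} {ι : Type*} {S : SubstitutionSystem d ι}

open Classical in
/-- The indicator function of a clopen set. -/
def clopenInd {U : Set S.Transversal} (hU : IsClopen U) : C(S.Transversal, ℂ) where
  toFun T := if T ∈ U then 1 else 0
  continuous_toFun := by
    refine continuous_ite_of_isClopen hU (c := 0) ?_ fun T hT => if_neg hT
    have : (fun T : U => if T.1 ∈ U then (1 : ℂ) else 0) = fun _ => 1 :=
      funext fun T => if_pos T.2
    rw [this]
    exact continuous_const

open Classical in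
theorem clopenInd_apply {U : Set S.Transversal} (hU : IsClopen U) (T : S.Transversal) :
    clopenInd hU T = if T ∈ U then 1 else 0 := rfl

/-! ### The conditional expectation -/

/-- The basis vector at the unit `T`. -/
def unitVec (T : S.Transversal) : S.RegSpace := basisVec (RPunc.unit T)

/-- The value at `T` of the conditional expectation of `a` onto the diagonal. -/
def expect (T : S.Transversal) (a : S.TilingAlgebra) : ℂ :=
  (a.1 (unitVec T) : S.RPunc → ℂ) (RPunc.unit T)

theorem expect_add (T : S.Transversal) (a b : S.TilingAlgebra) :
    expect T (a + b) = expect T a + expect T b := rfl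

theorem expect_sub (T : S.Transversal) (a b : S.TilingAlgebra) :
    expect T (a - b) = expect T a - expect T b := rfl

theorem expect_smul (T : S.Transversal) (c : ℂ) (a : S.TilingAlgebra) :
    expect T (c • a) = c * expect T a := rfl

theorem norm_expect_le (T : S.Transversal) (a : S.TilingAlgebra) : ‖expect T a‖ ≤ ‖a‖ := by
  refine (lp.norm_apply_le_norm (by norm_num) (a.1 (unitVec T)) _).trans ?_
  refine (a.1.le_opNorm _).trans ?_
  rw [unitVec, norm_basisVec, mul_one]
  rfl

theorem expect_star_mul_self (T : S.Transversal) (a : S.TilingAlgebra) :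
    expect T (star a * a) = ((‖a.1 (unitVec T)‖ ^ 2 : ℝ) : ℂ) := by
  have h : expect T (star a * a) = Inner.inner ℂ (unitVec T) ((star a.1) (a.1 (unitVec T))) :=
    (inner_basisVec _ _).symm
  rw [h, ContinuousLinearMap.star_eq_adjoint, ContinuousLinearMap.adjoint_inner_right,
    inner_self_eq_norm_sq_to_K]
  simp

theorem shiftFun_mul_shiftFun_one [Finite ι] (x : Euc d) (φ : C(S.Transversal, ℂ)) :
    shiftFun x φ * shiftFun x 1 = shiftFun x φ := by
  ext T
  rw [ContinuousMap.mul_apply, shiftFun_apply, shiftFun_apply]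
  split_ifs <;> simp

section Regular

variable [Finite ι] [Nonempty ι] [S.IsRegular]

theorem diagElt_mul (φ ψ : C(S.Transversal, ℂ)) : diagElt (φ * ψ) = diagElt φ * diagElt ψ :=
  Subtype.ext (diagOp_mul φ ψ)

theorem diagElt_add (φ ψ : C(S.Transversal, ℂ)) : diagElt (φ + ψ) = diagElt φ + diagElt ψ :=
  Subtype.ext (diagOp_add φ ψ)

theorem diagElt_smul (c : ℂ) (φ : C(S.Transversal, ℂ)) : diagElt (c • φ) = c • diagElt φ :=
  Subtype.ext (diagOp_smul c φ)

theorem diagElt_one : diagElt (1 : C(S.Transversal, ℂ)) = 1 := Subtype.ext diagOp_one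

theorem star_diagElt (φ : C(S.Transversal, ℂ)) : star (diagElt φ) = diagElt (star φ) :=
  Subtype.ext (star_diagOp φ)

theorem shiftElt_zero : (shiftElt 0 : S.TilingAlgebra) = 1 := Subtype.ext shiftOp_zero

theorem shiftElt_mul_diagElt (x : Euc d) (φ : C(S.Transversal, ℂ)) :
    shiftElt x * diagElt φ = diagElt (shiftFun x φ) * shiftElt x :=
  Subtype.ext (shiftOp_mul_diagOp x φ)

theorem shiftElt_mul_shiftElt (x y : Euc d) : (shiftElt x * shiftElt y : S.TilingAlgebra) =
    diagElt (shiftFun x 1) * shiftElt (x + y) := Subtype.ext (shiftOp_mul_shiftOp x y)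

theorem genElt_mul_genElt (φ ψ : C(S.Transversal, ℂ)) (x y : Euc d) :
    diagElt φ * shiftElt x * (diagElt ψ * shiftElt y) =
      diagElt (φ * shiftFun x ψ * shiftFun x 1) * shiftElt (x + y) :=
  Subtype.ext (gen_mul_gen φ ψ x y)

theorem norm_diagElt_le (φ : C(S.Transversal, ℂ)) : ‖diagElt φ‖ ≤ ‖φ‖ := norm_diagOp_le φ

theorem norm_shiftElt_le (x : Euc d) : ‖(shiftElt x : S.TilingAlgebra)‖ ≤ 1 := norm_shiftOp_le x

theorem norm_genElt_le (φ : C(S.Transversal, ℂ)) (x : Euc d) :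
    ‖diagElt φ * shiftElt x‖ ≤ ‖φ‖ := by
  refine (norm_mul_le _ _).trans ?_
  have h1 := norm_diagElt_le φ
  have h2 := norm_shiftElt_le (S := S) x
  nlinarith [norm_nonneg (diagElt φ), norm_nonneg φ]

variable (S) in
/-- `diagElt` as a linear map. -/
def diagEltLin : C(S.Transversal, ℂ) →ₗ[ℂ] S.TilingAlgebra where
  toFun := diagElt
  map_add' := diagElt_add
  map_smul' := diagElt_smul

theorem diagElt_sub (φ ψ : C(S.Transversal, ℂ)) : diagElt (φ - ψ) = diagElt φ - diagElt ψ :=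
  map_sub (diagEltLin S) φ ψ

theorem diagElt_zero : diagElt (0 : C(S.Transversal, ℂ)) = 0 := map_zero (diagEltLin S)

theorem diagElt_sum {κ : Type*} (s : Finset κ) (φ : κ → C(S.Transversal, ℂ)) :
    diagElt (∑ i ∈ s, φ i) = ∑ i ∈ s, diagElt (φ i) := map_sum (diagEltLin S) φ s

theorem shiftElt_conj (x : Euc d) (φ : C(S.Transversal, ℂ)) :
    shiftElt x * diagElt φ * shiftElt (-x) = diagElt (shiftFun x φ) := by
  rw [shiftElt_mul_diagElt, mul_assoc, shiftElt_mul_shiftElt, add_neg_cancel, shiftElt_zero,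
    mul_one, ← diagElt_mul, shiftFun_mul_shiftFun_one]

open Classical in
-- For `x ≠ 0` aperiodicity gives `T + x ≠ T`, so the diagonal matrix entry at the unit vanishes.
theorem expect_gen (T : S.Transversal) (φ : C(S.Transversal, ℂ)) (x : Euc d) :
    expect T (diagElt φ * shiftElt x) = if x = 0 then φ T else 0 := by
  have h : expect T (diagElt φ * shiftElt x) =
      φ T * (shiftOp x (basisVec (RPunc.unit T)) : S.RPunc → ℂ) (RPunc.unit T) := rfl
  rw [h, shiftOp_basisVec]
  by_cases hx : x = 0
  · rw [if_pos hx, if_pos, mul_one]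
    exact ⟨by rw [hx, translate_zero], rfl⟩
  · rw [if_neg hx, if_neg, mul_zero]
    rintro ⟨h1, -⟩
    exact hx (eq_zero_of_translate_eq T.mem_hull h1.symm)

/-- The algebra acts on the range of a groupoid element and the right shifts act on its source. -/
theorem rightShiftOp_comm (x : Euc d) (a : S.TilingAlgebra) :
    a.1 * rightShiftOp x = rightShiftOp x * a.1 := by
  induction a using tiling_induction with
  | gen φ y =>
    ext ξ γ
    change φ γ.range * (shiftOp y (rightShiftOp x ξ) : S.RPunc → ℂ) γ =
      (rightShiftOp x ((diagOp φ * shiftOp y : S.RegSpace →L[ℂ] S.RegSpace) ξ) : S.RPunc → ℂ) γ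
    rw [shiftOp_apply, rightShiftOp_apply]
    have hval : ∀ η : S.RPunc, ((diagOp φ * shiftOp y : S.RegSpace →L[ℂ] S.RegSpace) ξ :
      S.RPunc → ℂ) η = φ η.range * (shiftOp y ξ : S.RPunc → ℂ) η := fun η => rfl
    by_cases h1 : γ.range ∈ S.translatable y <;> by_cases h2 : γ.source ∈ S.translatable x
    · have h1' : (γ.shiftSource x h2).range ∈ S.translatable y := h1
      have h2' : (γ.shiftRange y h1).source ∈ S.translatable x := h2
      rw [dif_pos h1, dif_pos h2, rightShiftOp_apply, dif_pos h2', hval, shiftOp_apply,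
        dif_pos h1']
      rfl
    · have h2' : (γ.shiftRange y h1).source ∉ S.translatable x := h2
      rw [dif_pos h1, dif_neg h2, rightShiftOp_apply, dif_neg h2', mul_zero]
    · have h1' : (γ.shiftSource x h2).range ∉ S.translatable y := h1
      rw [dif_neg h1, dif_pos h2, hval, shiftOp_apply, dif_neg h1', mul_zero, mul_zero]
    · rw [dif_neg h1, dif_neg h2, mul_zero]
  | add a b ha hb =>
    change (a.1 + b.1) * _ = _ * (a.1 + b.1)
    rw [add_mul, mul_add, ha, hb]
  | smul c a ha =>
    change (c • a.1) * _ = _ * (c • a.1)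
    rw [smul_mul_assoc, mul_smul_comm, ha]
  | lim a h =>
    have hcl : IsClosed {b : S.TilingAlgebra | b.1 * rightShiftOp x = rightShiftOp x * b.1} :=
      isClosed_eq (by fun_prop) (by fun_prop)
    rw [← mem_ofPred_eq (p := fun b : S.TilingAlgebra =>
      b.1 * rightShiftOp x = rightShiftOp x * b.1), ← hcl.closure_eq]
    refine Metric.mem_closure_iff.2 fun ε hε => ?_
    obtain ⟨b, hb, hab⟩ := h ε hε
    exact ⟨b, hb, by rwa [dist_eq_norm]⟩

open Classical in
-- Every basis vector is a right shift of the one at a unit, so an element that kills all unit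
-- vectors is zero. In other words, the conditional expectation is faithful.
theorem exists_unitVec_ne_zero {a : S.TilingAlgebra} (ha : a ≠ 0) :
    ∃ T, a.1 (unitVec T) ≠ 0 := by
  by_contra! hcon
  refine ha (Subtype.ext (clm_ext_basisVec fun η => ?_))
  obtain ⟨z, hz⟩ := η.rel
  have hη : basisVec η = rightShiftOp (-z) (unitVec η.range) := by
    ext γ
    rw [rightShiftOp_apply, basisVec_apply]
    by_cases h : γ.source ∈ S.translatable (-z)
    · rw [dif_pos h, unitVec, basisVec_apply]
      refine if_congr ?_ rfl rfl
      rw [RPunc.ext_iff, RPunc.ext_iff]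
      refine and_congr Iff.rfl ?_
      change γ.src = η.src ↔ translate (-z) γ.src = η.rng
      rw [hz]
      constructor
      · intro h; rw [h, translate_neg_translate]
      · intro h; rw [← h, translate_translate_neg]
    · rw [dif_neg h, if_neg]
      rintro rfl
      refine h ?_
      change translate (-z) γ.src ∈ S.punctHull
      rw [hz, translate_neg_translate]
      exact γ.rng_mem
  have hcomm : a.1 (rightShiftOp (-z) (unitVec η.range)) =
      rightShiftOp (-z) (a.1 (unitVec η.range)) :=
    congrArg (fun b : S.RegSpace →L[ℂ] S.RegSpace => b (unitVec η.range))
      (rightShiftOp_comm (-z) a)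
  rw [hη, hcomm, hcon, map_zero]
  rfl

/-- Compression by small neighbourhoods of `T` turns `a` into the scalar `expect T a`. -/
theorem exists_compression (T : S.Transversal) (a : S.TilingAlgebra) : ∀ ε : ℝ, 0 < ε →
    ∃ U₀ : Set S.Transversal, IsClopen U₀ ∧ T ∈ U₀ ∧ ∀ (U : Set S.Transversal) (hU : IsClopen U),
      U ⊆ U₀ → ‖diagElt (clopenInd hU) * a * diagElt (clopenInd hU) -
        expect T a • diagElt (clopenInd hU)‖ ≤ ε := by
  have hind : ∀ (U : Set S.Transversal) (hU : IsClopen U), ‖diagElt (clopenInd hU)‖ ≤ 1 :=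
    fun U hU => (norm_diagElt_le _).trans ((ContinuousMap.norm_le _ zero_le_one).2 fun T' => by
      rw [clopenInd_apply]; split_ifs <;> simp)
  induction a using tiling_induction with
  | gen φ x =>
    intro ε hε
    rw [expect_gen]
    by_cases hx : x = 0
    · subst hx
      obtain ⟨P, ⟨hfin, hPT⟩, hP⟩ := T.nhds_hasBasis.mem_iff.1
        (φ.continuous.continuousAt.preimage_mem_nhds (Metric.closedBall_mem_nhds (φ T) hε))
      refine ⟨_, Transversal.isClopen_subset hfin, hPT, fun U hU hsub => ?_⟩
      rw [if_pos rfl, shiftElt_zero, mul_one, ← diagElt_mul, ← diagElt_mul, ← diagElt_smul,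
        ← diagElt_sub]
      refine (norm_diagElt_le _).trans ((ContinuousMap.norm_le _ hε.le).2 fun T' => ?_)
      simp only [ContinuousMap.sub_apply, ContinuousMap.mul_apply, ContinuousMap.smul_apply,
        clopenInd_apply]
      by_cases h : T' ∈ U
      · simpa [h, dist_eq_norm] using hP (hsub h)
      · simpa [h] using hε.le
    -- Aperiodicity provides a tile `t` of `T` with `t - x` not in `T`. On the cylinder where `t` is
    -- present and `t - x` absent, no tiling has its translate by `x` in the same cylinder, so
    -- compression annihilates `φ V_x`.
    · have hne : ¬ T.1 ⊆ translate x T.1 := fun h =>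
        hx (eq_zero_of_translate_eq T.mem_hull
          (T.mem_hull.1.eq_of_subset (T.mem_hull.1.1.translate x) h).symm)
      obtain ⟨t, ht, ht'⟩ := not_subset.1 hne
      rw [mem_translate] at ht'
      refine ⟨_, (Transversal.isClopen_mem t).inter
        (Transversal.isClopen_mem (t.1, t.2 - x)).compl, ⟨ht, ht'⟩, fun U hU hsub => ?_⟩
      have h0 : clopenInd hU * φ * shiftFun x (clopenInd hU) = 0 := by
        ext T'
        simp only [ContinuousMap.mul_apply, clopenInd_apply, shiftFun_apply,
          ContinuousMap.zero_apply]
        by_cases h : T' ∈ U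
        · split_ifs with h1 h2
          · exact absurd (mem_translate.1 (hsub h2).1) (hsub h).2
          · simp
          · simp
        · simp [h]
      rw [if_neg hx, zero_smul, sub_zero, ← mul_assoc, ← diagElt_mul, mul_assoc,
        shiftElt_mul_diagElt, ← mul_assoc, ← diagElt_mul, h0, diagElt_zero, zero_mul, norm_zero]
      exact hε.le
  | add a b ha hb =>
    intro ε hε
    obtain ⟨U₁, h₁, hT₁, H₁⟩ := ha (ε / 2) (half_pos hε)
    obtain ⟨U₂, h₂, hT₂, H₂⟩ := hb (ε / 2) (half_pos hε)
    refine ⟨U₁ ∩ U₂, h₁.inter h₂, ⟨hT₁, hT₂⟩, fun U hU hsub => ?_⟩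
    have := norm_add_le_of_le (H₁ U hU (hsub.trans inter_subset_left))
      (H₂ U hU (hsub.trans inter_subset_right))
    rw [add_halves] at this
    refine le_of_eq_of_le (congrArg _ ?_) this
    rw [expect_add, mul_add, add_mul, add_smul]
    abel
  | smul c a ha =>
    intro ε hε
    obtain ⟨U₀, h₀, hT₀, H⟩ := ha (ε / (‖c‖ + 1)) (by positivity)
    refine ⟨U₀, h₀, hT₀, fun U hU hsub => ?_⟩
    rw [expect_smul, mul_smul_comm, smul_mul_assoc, mul_smul, ← smul_sub, norm_smul]
    calc _ ≤ (‖c‖ + 1) * (ε / (‖c‖ + 1)) := by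
          gcongr
          · linarith
          · exact H U hU hsub
      _ = ε := by field_simp
  | lim a h =>
    intro ε hε
    obtain ⟨b, hb, hab⟩ := h (ε / 3) (by positivity)
    obtain ⟨U₀, h₀, hT₀, H⟩ := hb (ε / 3) (by positivity)
    refine ⟨U₀, h₀, hT₀, fun U hU hsub => ?_⟩
    set e := diagElt (clopenInd hU)
    have he : ‖e‖ ≤ 1 := hind U hU
    have h1 : e * a * e - expect T a • e = e * (a - b) * e + (e * b * e - expect T b • e) -
        expect T (a - b) • e := by
      rw [expect_sub, mul_sub, sub_mul, sub_smul]; abel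
    have h2 : ‖e * (a - b) * e‖ ≤ ε / 3 := by
      calc _ ≤ ‖e‖ * ‖a - b‖ * ‖e‖ := (norm_mul_le _ _).trans
            (mul_le_mul_of_nonneg_right (norm_mul_le _ _) (norm_nonneg _))
        _ ≤ 1 * ‖a - b‖ * 1 := by gcongr
        _ ≤ ε / 3 := by linarith
    have h3 : ‖expect T (a - b) • e‖ ≤ ε / 3 := by
      rw [norm_smul]
      calc _ ≤ ‖a - b‖ * 1 := by gcongr; exact norm_expect_le _ _
        _ ≤ ε / 3 := by linarith
    rw [h1]
    have := norm_sub_le_of_le (norm_add_le_of_le h2 (H U hU hsub)) h3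
    linarith

/-! ### Simplicity -/

/-- Finitely many translates of a nonempty open set cover the punctured hull. -/
theorem exists_finset_shift {U : Set S.Transversal} (hU : IsOpen U) (hne : U.Nonempty) :
    ∃ F : Finset (Euc d), ∀ T : S.Transversal, ∃ x ∈ F, ∃ h : T ∈ S.translatable x,
      T.shift x h ∈ U := by
  obtain ⟨T₀, hT₀⟩ := hne
  obtain ⟨P, ⟨hfin, hPT⟩, hP⟩ := T₀.nhds_hasBasis.mem_iff.1 (hU.mem_nhds hT₀)
  obtain ⟨p, hp⟩ := T₀.2.2
  obtain ⟨R, hR⟩ := (IsRegular.primitive (S := S)).exists_patch_translate T₀.mem_hull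
    (insert_subset hp hPT) (hfin.insert _)
  -- The patch was enlarged by the tile at the origin, so each return vector is itself a puncture,
  -- and only finitely many punctures of norm at most `R` occur.
  have hF := (finite_tiles (IsRegular.primitive (S := S)) IsRegular.flc R).image fun t => -t.2
  refine ⟨hF.toFinset, fun T => ?_⟩
  obtain ⟨x, hx, hsub⟩ := hR T.1 T.mem_hull
  have hpx : ((p, x) : Tile d ι) ∈ T.1 := hsub (mem_translate.2 (by simp))
  refine ⟨-x, hF.mem_toFinset.2 ⟨(p, x), ⟨T.1, T.2, hpx, hx⟩, rfl⟩,
    (T.translate_mem_iff (-x)).2 ⟨p, by simpa using hpx⟩, hP ?_⟩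
  exact (subset_insert _ _).trans (translate_subset_iff.1 hsub)

/-- Conjugates of the projection by finitely many shifts lie in the ideal. Their sum is a function
that is at least `1` everywhere by minimality, hence invertible. -/
theorem one_mem_of_diagElt_mem (I : TwoSidedIdeal S.TilingAlgebra) {U : Set S.Transversal}
    (hU : IsClopen U) (hne : U.Nonempty) (he : diagElt (clopenInd hU) ∈ I) : 1 ∈ I := by
  obtain ⟨F, hF⟩ := exists_finset_shift hU.isOpen hne
  set h : C(S.Transversal, ℂ) := ∑ x ∈ F, shiftFun x (clopenInd hU) with hh
  have hmem : diagElt h ∈ I := by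
    rw [hh, diagElt_sum]
    refine sum_mem fun x _ => ?_
    rw [← shiftElt_conj]
    exact I.mul_mem_right _ _ (I.mul_mem_left _ _ he)
  have hre : ∀ x T, 0 ≤ (shiftFun x (clopenInd hU) T).re := fun x T => by
    rw [shiftFun_apply]
    split_ifs
    · rw [clopenInd_apply]; split_ifs <;> simp
    · simp
  have hne0 : ∀ T, h T ≠ 0 := fun T h0 => by
    obtain ⟨x, hx, htr, hxU⟩ := hF T
    have h1 : h T = ∑ x ∈ F, shiftFun x (clopenInd hU) T := by simp [hh]
    have h2 : (h T).re = ∑ x ∈ F, (shiftFun x (clopenInd hU) T).re := by rw [h1, Complex.re_sum]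
    have h3 := Finset.single_le_sum (fun y _ => hre y T) hx
    rw [← h2, h0, shiftFun_apply, dif_pos htr, clopenInd_apply, if_pos hxU] at h3
    norm_num at h3
  set g : C(S.Transversal, ℂ) := ⟨fun T => (h T)⁻¹, h.continuous.inv₀ hne0⟩
  have hgh : g * h = 1 := by
    ext T
    exact inv_mul_cancel₀ (hne0 T)
  have := I.mul_mem_left (diagElt g) _ hmem
  rwa [← diagElt_mul, hgh, diagElt_one] at this

instance : Nontrivial S.TilingAlgebra := by
  refine ⟨1, 0, fun h => ?_⟩
  obtain ⟨T⟩ := (inferInstance : Nonempty S.Transversal)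
  have h1 := expect_gen T 1 0
  rw [diagElt_one, shiftElt_zero, one_mul, h, if_pos rfl] at h1
  exact zero_ne_one h1

/-- For `a ≠ 0` in the ideal, `b = a* a` has a positive expectation `c` at some `T`. Compression by
the projection `e` of a small clopen set brings `e b e` within `c / 2` of `c e`, so `e` is a
multiple of `e b e` and lies in the ideal. -/
theorem isSimpleRing_tilingAlgebra : IsSimpleRing S.TilingAlgebra := by
  refine .of_eq_bot_or_eq_top fun I => ?_
  rw [or_iff_not_imp_left, ← I.one_mem_iff]
  intro hI
  obtain ⟨a, haI, ha⟩ := SetLike.exists_of_lt (bot_lt_iff_ne_bot.mpr hI : ⊥ < I)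
  have ha0 : a ≠ 0 := ha
  obtain ⟨T, hT⟩ := exists_unitVec_ne_zero ha0
  set b := star a * a
  have hbI : b ∈ I := I.mul_mem_left _ _ haI
  set c : ℝ := ‖a.1 (unitVec T)‖ ^ 2
  have hc : 0 < c := pow_pos (norm_pos_iff.2 hT) 2
  obtain ⟨U, hU, hTU, H⟩ := exists_compression T b (c / 2) (half_pos hc)
  have hcomp := H U hU Subset.rfl
  refine one_mem_of_diagElt_mem I hU ⟨T, hTU⟩ ?_
  rw [expect_star_mul_self] at hcomp
  set e := diagElt (clopenInd hU)
  have hee : e * e = e := by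
    rw [← diagElt_mul]
    congr 1
    ext T'
    rw [ContinuousMap.mul_apply, clopenInd_apply]
    split_ifs <;> simp
  set C : ℂ := ((‖a.1 (unitVec T)‖ ^ 2 : ℝ) : ℂ)
  have hC0 : C ≠ 0 := Complex.ofReal_ne_zero.2 hc.ne'
  -- The unit is formed in the whole algebra rather than in the corner; right multiplication by `e`
  -- turns it into `C⁻¹ • (e * b * e)`.
  have hunit : IsUnit (1 - C⁻¹ • (C • e - e * b * e)) := by
    refine isUnit_one_sub_of_norm_lt_one ?_
    rw [norm_smul, norm_inv, norm_sub_rev]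
    have hnC : ‖C‖ = c := by rw [Complex.norm_real, Real.norm_of_nonneg hc.le]
    rw [hnC, inv_mul_lt_iff₀ hc]
    linarith
  obtain ⟨u, hu⟩ := hunit
  have hz : (u : S.TilingAlgebra) * e = C⁻¹ • (e * b * e) := by
    rw [hu, sub_mul, one_mul, smul_mul_assoc, sub_mul, smul_mul_assoc, hee, mul_assoc (e * b), hee,
      smul_sub, smul_smul, inv_mul_cancel₀ hC0, one_smul, sub_sub_cancel]
  have he : e = (↑u⁻¹ * (C⁻¹ • 1)) * (e * b * e) := by
    rw [mul_assoc, smul_mul_assoc, one_mul, ← hz, ← mul_assoc, u.inv_mul, one_mul]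
  rw [he]
  exact I.mul_mem_left _ _ (I.mul_mem_right _ _ (I.mul_mem_left _ _ hbI))

end Regular

end SubstitutionSystem
end SubstTiling

namespace SubstTiling

/-- The sum of a function over a finite set changes little when the argument is shifted, if the
function vanishes where the shift enters or leaves the set outside a small set. -/
theorem norm_sum_sub_sum_shift_le {E : Type*} [AddCommGroup E] [DecidableEq E] (Z N : Finset E)
    (x : E) (G : E → ℂ) (C : ℝ) (hC : ∀ z, ‖G z‖ ≤ C)
    (h1 : ∀ z ∈ Z, z - x ∉ Z → G z ≠ 0 → z ∈ N) (h2 : ∀ z ∈ Z, z + x ∉ Z → G (z + x) ≠ 0 → z ∈ N) :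
    ‖∑ z ∈ Z, G z - ∑ z ∈ Z, G (z + x)‖ ≤ 2 * (C * N.card) := by
  have hC0 : 0 ≤ C := (norm_nonneg _).trans (hC 0)
  have key : ∀ (s : Finset E) (f : E → ℂ), (∀ z, ‖f z‖ ≤ C) → (∀ z ∈ s, f z ≠ 0 → z ∈ N) →
      ‖∑ z ∈ s, f z‖ ≤ C * N.card := by
    intro s f hf hs
    rw [← Finset.sum_filter_of_ne (p := fun z => z ∈ N) hs]
    refine (norm_sum_le_of_le _ fun z _ => hf z).trans ?_
    rw [Finset.sum_const, nsmul_eq_mul, mul_comm]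
    refine mul_le_mul_of_nonneg_left ?_ hC0
    exact_mod_cast Finset.card_le_card fun z hz => (Finset.mem_filter.1 hz).2
  have hsum : ∑ z ∈ Z with z - x ∈ Z, G z = ∑ z ∈ Z with z + x ∈ Z, G (z + x) := by
    refine Finset.sum_nbij' (fun z => z - x) (fun z => z + x) ?_ ?_ ?_ ?_ ?_ <;>
      simp +contextual
  rw [← Finset.sum_filter_add_sum_filter_not Z (fun z => z - x ∈ Z) G,
    ← Finset.sum_filter_add_sum_filter_not Z (fun z => z + x ∈ Z) fun z => G (z + x), hsum,
    add_sub_add_left_eq_sub, two_mul]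
  refine norm_sub_le_of_le (key _ _ hC ?_) (key _ _ (fun z => hC _) ?_)
  · intro z hz
    rw [Finset.mem_filter] at hz
    exact h1 z hz.1 hz.2
  · intro z hz
    rw [Finset.mem_filter] at hz
    exact h2 z hz.1 hz.2

namespace SubstitutionSystem

variable {d : ℕ} {ι : Type*} {S : SubstitutionSystem d ι}

/-! ### Traces -/

/-- The tile at `z'` is not in the supertile, so by absorption it has a point outside the supertile,
and that point is within `D` of `z'`. -/
theorem mem_nearPunctures_of_adjacent [Finite ι] {D : ℝ} (hD : ∀ p, ∀ y ∈ S.shape p, ‖y‖ ≤ D)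
    {T : Set (Tile d ι)} (hT : IsPartialTiling S.shape T) {n : ℕ} {p : ι}
    (hsub : S.supertile n p ⊆ T) {z z' : Euc d} {q : ι} (hz : z ∈ S.punctures n p)
    (hz' : z' ∉ S.punctures n p) (hq : ((q, z') : Tile d ι) ∈ T) {r : ℝ}
    (hr : ‖z - z'‖ + D < r) : z ∈ S.nearPunctures n p r := by
  refine S.mem_nearPunctures.2 ⟨hz, ?_⟩
  have hnot : ¬ S.inner (q, z') ⊆ S.supp (S.supertile n p) := fun h =>
    hz' (S.mem_punctures.2 ⟨q, hT.absorb hsub hq h⟩)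
  obtain ⟨y, hy, hyn⟩ := not_subset.1 hnot
  have h1 := Metric.infDist_le_dist_of_mem (x := z) (mem_compl hyn)
  have h2 : ‖y - z'‖ ≤ D := S.dist_le_of_mem_carrier (t := (q, z')) hD (S.inner_subset _ hy)
  have h3 := dist_triangle z z' y
  rw [dist_eq_norm z z', dist_comm z' y, dist_eq_norm y z'] at h3
  linarith

/-- `expect T` as a linear map. -/
def expectLin (T : S.Transversal) : S.TilingAlgebra →ₗ[ℂ] ℂ where
  toFun := expect T
  map_add' := expect_add T
  map_smul' := expect_smul T

theorem expectLin_apply (T : S.Transversal) (a : S.TilingAlgebra) :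
    expectLin T a = expect T a := rfl

/-- The average of the functionals `expect (u z)` over a finite set. -/
def avgExpect (Z : Finset (Euc d)) (u : Euc d → S.Transversal) : S.TilingAlgebra →ₗ[ℂ] ℂ :=
  (Z.card : ℂ)⁻¹ • ∑ z ∈ Z, expectLin (u z)

theorem avgExpect_apply (Z : Finset (Euc d)) (u : Euc d → S.Transversal) (a : S.TilingAlgebra) :
    avgExpect Z u a = (Z.card : ℂ)⁻¹ * ∑ z ∈ Z, expect (u z) a := by
  simp [avgExpect, expectLin_apply]

theorem norm_avgExpect_le (Z : Finset (Euc d)) (u : Euc d → S.Transversal) (a : S.TilingAlgebra) :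
    ‖avgExpect Z u a‖ ≤ ‖a‖ := by
  rw [avgExpect_apply, norm_mul, norm_inv, Complex.norm_natCast]
  have h : ‖∑ z ∈ Z, expect (u z) a‖ ≤ Z.card * ‖a‖ := by
    refine (norm_sum_le_of_le _ fun z _ => norm_expect_le (u z) a).trans ?_
    rw [Finset.sum_const, nsmul_eq_mul]
  rcases Z.card.eq_zero_or_pos with h0 | h0
  · rw [h0]; simp
  · rw [inv_mul_le_iff₀ (by exact_mod_cast h0)]
    exact h

section Regular

variable [Finite ι] [Nonempty ι] [S.IsRegular]

theorem exists_supertile_subset (n : ℕ) (p : ι) : ∃ T ∈ S.hull, S.supertile n p ⊆ T ∧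
    ∃ u : Euc d → S.Transversal, ∀ z, translate (-z) T ∈ S.punctHull →
      (u z).1 = translate (-z) T := by
  classical
  obtain ⟨T, hT⟩ := (IsRegular.primitive (S := S)).hull_nonempty
  obtain ⟨R, hR⟩ := (IsRegular.primitive (S := S)).exists_translate_subset n
  obtain ⟨x, -, hx⟩ := hR T hT p 0
  refine ⟨translate (-x) T, hull_translate hT _, translate_subset_iff.1 hx, ?_⟩
  obtain ⟨T₀⟩ := (inferInstance : Nonempty S.Transversal)
  -- Where the translate has no puncture at the origin, the value `T₀` is arbitrary.
  exact ⟨fun z => if h : translate (-z) (translate (-x) T) ∈ S.punctHull then ⟨_, h⟩ else T₀,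
    fun z hz => by simp only [dif_pos hz]⟩

theorem expect_comm_of_add_ne_zero (T : S.Transversal) (φ ψ : C(S.Transversal, ℂ)) {x y : Euc d}
    (h : x + y ≠ 0) : expect T (diagElt φ * shiftElt x * (diagElt ψ * shiftElt y)) = 0 := by
  rw [genElt_mul_genElt, expect_gen, if_neg h]

/-- The two products have expectations `G z` and `G (z + x)` at the puncture `z`. Summed over a
supertile these cancel, except at punctures whose neighbour at distance `‖x‖` is outside it, and
such punctures are near the boundary. -/
theorem norm_avgExpect_comm_le {D : ℝ} (hD : ∀ p, ∀ y ∈ S.shape p, ‖y‖ ≤ D)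
    {n : ℕ} {p : ι} {T : Set (Tile d ι)} (hT : T ∈ S.hull) (hsub : S.supertile n p ⊆ T)
    {u : Euc d → S.Transversal}
    (hu : ∀ z, translate (-z) T ∈ S.punctHull → (u z).1 = translate (-z) T)
    (φ ψ : C(S.Transversal, ℂ)) (x : Euc d) :
    ‖avgExpect (S.punctures n p) u (diagElt φ * shiftElt x * (diagElt ψ * shiftElt (-x))) -
      avgExpect (S.punctures n p) u (diagElt ψ * shiftElt (-x) * (diagElt φ * shiftElt x))‖ ≤
      2 * (‖φ * shiftFun x ψ * shiftFun x 1‖ * (S.nearPunctures n p (‖x‖ + D + 1)).card) /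
        (S.punctures n p).card := by
  classical
  set g := φ * shiftFun x ψ * shiftFun x 1 with hg
  set Z := S.punctures n p
  -- Extension by zero off the punctures of `T` gives meaning to `G (z + x)` for every `z`.
  set G : Euc d → ℂ := fun z => if translate (-z) T ∈ S.punctHull then g (u z) else 0 with hG
  have hmem : ∀ z, translate (-z) T ∈ S.punctHull ↔ ∃ q : ι, ((q, z) : Tile d ι) ∈ T := fun z => by
    simp [punctHull, hull_translate hT, mem_translate]
  have hZ : ∀ z ∈ Z, translate (-z) T ∈ S.punctHull := fun z hz => by
    obtain ⟨q, hq⟩ := S.mem_punctures.1 hz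
    exact (hmem z).2 ⟨q, hsub hq⟩
  have hsupp : ∀ z, G z ≠ 0 → (∃ q : ι, ((q, z) : Tile d ι) ∈ T) ∧
      ∃ q : ι, ((q, z - x) : Tile d ι) ∈ T := fun z hz => by
    simp only [hG] at hz
    split_ifs at hz with h
    · refine ⟨(hmem z).1 h, ?_⟩
      have h1 : u z ∈ S.translatable x := by
        by_contra hn
        refine hz ?_
        rw [hg, ContinuousMap.mul_apply, shiftFun_apply x 1, dif_neg hn, mul_zero]
      rw [translatable, mem_ofPred_eq, hu z h, translate_translate] at h1
      refine (hmem (z - x)).1 ?_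
      rwa [neg_sub, ← neg_add_eq_sub]
    · exact absurd rfl hz
  have e1 : ∀ z ∈ Z, expect (u z) (diagElt φ * shiftElt x * (diagElt ψ * shiftElt (-x))) = G z :=
    fun z hz => by
      rw [genElt_mul_genElt, expect_gen, if_pos (add_neg_cancel x)]
      simp only [hG, if_pos (hZ z hz)]
      rfl
  have e2 : ∀ z ∈ Z, expect (u z) (diagElt ψ * shiftElt (-x) * (diagElt φ * shiftElt x)) =
      G (z + x) := fun z hz => by
    rw [genElt_mul_genElt, expect_gen, if_pos (neg_add_cancel x), ContinuousMap.mul_apply,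
      ContinuousMap.mul_apply, shiftFun_apply, shiftFun_apply]
    have htr : translate (-x) (u z).1 = translate (-(z + x)) T := by
      rw [hu z (hZ z hz), translate_translate, neg_add]
    by_cases h : u z ∈ S.translatable (-x)
    · have h' : translate (-(z + x)) T ∈ S.punctHull := htr ▸ h
      have hs : (u z).shift (-x) h = u (z + x) := Transversal.ext (by rw [hu _ h', ← htr]; rfl)
      have hsx : u (z + x) ∈ S.translatable x := by
        rw [← hs]
        refine (mem_translatable_translate h).2 ?_
        rw [neg_add_cancel]; exact zero_mem_translatable _
      have hback : (u (z + x)).shift x hsx = u z := Transversal.ext (by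
        change translate x (u (z + x)).1 = (u z).1
        rw [← hs]
        exact translate_translate_neg _ _)
      simp only [hG, dif_pos h, if_pos h', hs]
      rw [hg, ContinuousMap.mul_apply, ContinuousMap.mul_apply, shiftFun_apply, shiftFun_apply,
        dif_pos hsx, dif_pos hsx, hback]
      simp [mul_comm]
    · have h' : translate (-(z + x)) T ∉ S.punctHull := htr ▸ h
      simp only [hG, dif_neg h, if_neg h', mul_zero]
  rw [avgExpect_apply, avgExpect_apply, ← mul_sub, Finset.sum_congr rfl e1, Finset.sum_congr rfl e2,
    norm_mul, norm_inv, Complex.norm_natCast, mul_comm, ← div_eq_mul_inv]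
  refine div_le_div_of_nonneg_right ?_ (Nat.cast_nonneg _)
  refine norm_sum_sub_sum_shift_le Z _ x G _ (fun z => ?_) (fun z hz hzx hGz => ?_)
    fun z hz hzx hGz => ?_
  · simp only [hG]
    split_ifs
    · exact g.norm_coe_le_norm _
    · simp
  · obtain ⟨-, q, hq⟩ := hsupp z hGz
    exact mem_nearPunctures_of_adjacent hD hT.1.1 hsub hz hzx hq (by
      rw [sub_sub_cancel]; linarith)
  · obtain ⟨⟨q, hq⟩, -⟩ := hsupp _ hGz
    exact mem_nearPunctures_of_adjacent hD hT.1.1 hsub hz hzx hq (by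
      rw [sub_add_cancel_left, norm_neg]; linarith)

/-- Functionals that are asymptotically tracial on the generators are so on the whole algebra. -/
theorem tendsto_comm_of_gen {τ : ℕ → S.TilingAlgebra →ₗ[ℂ] ℂ} (hτ : ∀ n a, ‖τ n a‖ ≤ ‖a‖)
    (h : ∀ φ x ψ y, Tendsto (fun n => τ n (diagElt φ * shiftElt x * (diagElt ψ * shiftElt y)) -
      τ n (diagElt ψ * shiftElt y * (diagElt φ * shiftElt x))) atTop (𝓝 0))
    (a b : S.TilingAlgebra) : Tendsto (fun n => τ n (a * b) - τ n (b * a)) atTop (𝓝 0) := by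
  have hbound : ∀ (n : ℕ) (a b : S.TilingAlgebra),
      ‖τ n (a * b) - τ n (b * a)‖ ≤ 2 * (‖a‖ * ‖b‖) := fun n a b => by
    rw [two_mul]
    refine norm_sub_le_of_le ((hτ _ _).trans (norm_mul_le _ _)) ((hτ _ _).trans ?_)
    rw [mul_comm ‖a‖]; exact norm_mul_le _ _
  have hlim : ∀ (a b : S.TilingAlgebra), (∀ ε > 0, ∃ c, Tendsto (fun n => τ n (c * b) - τ n (b * c))
      atTop (𝓝 0) ∧ ‖a - c‖ < ε) → Tendsto (fun n => τ n (a * b) - τ n (b * a)) atTop (𝓝 0) := by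
    intro a b H
    refine Metric.tendsto_nhds.2 fun ε hε => ?_
    obtain ⟨c, hc, hac⟩ := H (ε / (4 * (‖b‖ + 1))) (by positivity)
    filter_upwards [Metric.tendsto_nhds.1 hc (ε / 2) (half_pos hε)] with n hn
    rw [dist_zero_right] at hn ⊢
    have h1 : τ n (a * b) - τ n (b * a) = (τ n (c * b) - τ n (b * c)) +
        (τ n ((a - c) * b) - τ n (b * (a - c))) := by
      rw [sub_mul, mul_sub, LinearMap.map_sub, LinearMap.map_sub]; abel
    rw [h1]
    refine (norm_add_le _ _).trans_lt ?_
    have h2 := hbound n (a - c) b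
    have h3 : ‖a - c‖ * ‖b‖ ≤ ε / (4 * (‖b‖ + 1)) * (‖b‖ + 1) := by
      gcongr; linarith
    have h4 : ε / (4 * (‖b‖ + 1)) * (‖b‖ + 1) = ε / 4 := by field_simp
    linarith
  have hadd : ∀ a a' b : S.TilingAlgebra, Tendsto (fun n => τ n (a * b) - τ n (b * a)) atTop (𝓝 0) →
      Tendsto (fun n => τ n (a' * b) - τ n (b * a')) atTop (𝓝 0) →
      Tendsto (fun n => τ n ((a + a') * b) - τ n (b * (a + a'))) atTop (𝓝 0) := by
    intro a a' b h1 h2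
    have := h1.add h2
    rw [add_zero] at this
    refine this.congr fun n => ?_
    rw [add_mul, mul_add, LinearMap.map_add, LinearMap.map_add]; abel
  have hsmul : ∀ (c : ℂ) (a b : S.TilingAlgebra),
      Tendsto (fun n => τ n (a * b) - τ n (b * a)) atTop (𝓝 0) →
      Tendsto (fun n => τ n ((c • a) * b) - τ n (b * (c • a))) atTop (𝓝 0) := by
    intro c a b h1
    have := h1.const_mul c
    rw [mul_zero] at this
    refine this.congr fun n => ?_
    rw [smul_mul_assoc, mul_smul_comm, LinearMap.map_smul, LinearMap.map_smul, smul_eq_mul, smul_eq_mul, mul_sub]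
  have hswap : ∀ a b : S.TilingAlgebra, Tendsto (fun n => τ n (a * b) - τ n (b * a)) atTop (𝓝 0) →
      Tendsto (fun n => τ n (b * a) - τ n (a * b)) atTop (𝓝 0) := by
    intro a b h1
    have := h1.neg
    rw [neg_zero] at this
    exact this.congr fun n => neg_sub _ _
  have hgen : ∀ φ x, ∀ b : S.TilingAlgebra, Tendsto (fun n => τ n (diagElt φ * shiftElt x * b) -
      τ n (b * (diagElt φ * shiftElt x))) atTop (𝓝 0) := by
    intro φ x b
    refine hswap _ _ ?_
    induction b using tiling_induction with
    | gen ψ y => exact h ψ y φ x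
    | add a b ha hb => exact hadd _ _ _ ha hb
    | smul c a ha => exact hsmul _ _ _ ha
    | lim a ha => exact hlim _ _ ha
  induction a using tiling_induction with
  | gen φ x => exact hgen φ x b
  | add a a' ha ha' => exact hadd _ _ _ ha ha'
  | smul c a ha => exact hsmul _ _ _ ha
  | lim a ha => exact hlim _ _ ha

/-- Large supertiles form a Følner sequence: the averages of `expect` over their punctures are
asymptotically tracial. Positivity and normalization hold for each average, so a limit along a
nonprincipal ultrafilter is a trace. -/
theorem exists_isNormalizedTrace : ∃ τ : S.TilingAlgebra →ₗ[ℂ] ℂ, IsNormalizedTrace τ := by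
  obtain ⟨p⟩ := ‹Nonempty ι›
  obtain ⟨D, hD0, hD⟩ := S.exists_outer_radius
  choose T hT hsub u hu using fun n => exists_supertile_subset (S := S) n p
  set t : ℕ → S.TilingAlgebra →ₗ[ℂ] ℂ := fun n => avgExpect (S.punctures n p) (u n) with ht
  have hcard : ∀ n, (0 : ℝ) < (S.punctures n p).card := fun n => by
    exact_mod_cast (S.punctures_nonempty n p).card_pos
  have hcomm : ∀ a b, Tendsto (fun n => t n (a * b) - t n (b * a)) atTop (𝓝 0) := by
    refine tendsto_comm_of_gen (fun n a => norm_avgExpect_le _ _ _) fun φ x ψ y => ?_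
    by_cases hxy : x + y = 0
    · obtain rfl : y = -x := (neg_eq_of_add_eq_zero_right hxy).symm
      refine Metric.tendsto_nhds.2 fun ε hε => ?_
      set c := ‖φ * shiftFun x ψ * shiftFun x 1‖
      filter_upwards [S.eventually_card_nearPunctures_le (‖x‖ + D + 1)
        (show 0 < ε / (2 * (c + 1)) by positivity)] with n hn
      rw [dist_zero_right]
      refine (norm_avgExpect_comm_le hD (hT n) (hsub n) (hu n) φ ψ x).trans_lt ?_
      rw [div_lt_iff₀ (hcard n)]
      calc 2 * (c * (S.nearPunctures n p (‖x‖ + D + 1)).card)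
          ≤ 2 * (c * (ε / (2 * (c + 1)) * (S.punctures n p).card)) := by gcongr; exact hn p
        _ = ε * (S.punctures n p).card * (c / (c + 1)) := by field_simp
        _ < ε * (S.punctures n p).card * 1 := by
            refine mul_lt_mul_of_pos_left ?_ (mul_pos hε (hcard n))
            rw [div_lt_one (by positivity)]; linarith
        _ = _ := mul_one _
    · refine tendsto_const_nhds.congr fun n => ?_
      simp only [ht]
      rw [avgExpect_apply, avgExpect_apply,
        Finset.sum_eq_zero fun z _ => expect_comm_of_add_ne_zero _ _ _ hxy,
        Finset.sum_eq_zero fun z _ => expect_comm_of_add_ne_zero _ _ _ (by rwa [add_comm])]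
      simp
  have hex : ∀ a, ∃ w : ℂ, Tendsto (fun n => t n a) (hyperfilter ℕ : Filter ℕ) (𝓝 w) := by
    intro a
    obtain ⟨w, -, hw⟩ := (isCompact_closedBall (0 : ℂ) ‖a‖).ultrafilter_le_nhds
      ((hyperfilter ℕ).map fun n => t n a) (by
        refine le_principal_iff.2 (Ultrafilter.mem_map.2 (Eventually.of_forall fun n => ?_))
        exact mem_closedBall_zero_iff.2 (norm_avgExpect_le _ _ _))
    exact ⟨w, hw⟩
  choose τ hτ using hex
  have hle : (hyperfilter ℕ : Filter ℕ) ≤ atTop := by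
    rw [← Nat.cofinite_eq_atTop]; exact hyperfilter_le_cofinite
  refine ⟨{ toFun := τ, map_add' := fun a b => ?_, map_smul' := fun c a => ?_ }, ?_, ?_, ?_⟩
  · refine tendsto_nhds_unique (hτ (a + b)) (((hτ a).add (hτ b)).congr fun n => ?_)
    rw [LinearMap.map_add]
  · refine tendsto_nhds_unique (hτ (c • a)) (((hτ a).const_mul c).congr fun n => ?_)
    rw [LinearMap.map_smul, smul_eq_mul]
  · intro a
    have hcl : IsClosed {w : ℂ | 0 ≤ w.re ∧ w.im = 0} :=
      (isClosed_le continuous_const Complex.continuous_re).inter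
        (isClosed_eq Complex.continuous_im continuous_const)
    refine hcl.mem_of_tendsto (hτ (star a * a)) (Eventually.of_forall fun n => ?_)
    have : t n (star a * a) = ((((S.punctures n p).card : ℝ)⁻¹ *
        ∑ z ∈ S.punctures n p, ‖a.1 (unitVec (u n z))‖ ^ 2 : ℝ) : ℂ) := by
      simp only [ht, avgExpect_apply, expect_star_mul_self]
      push_cast
      rfl
    rw [mem_ofPred_eq, this, Complex.ofReal_re, Complex.ofReal_im]
    exact ⟨by positivity, rfl⟩
  · refine tendsto_nhds_unique (hτ 1) (tendsto_const_nhds.congr fun n => ?_)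
    have h1 : ∀ T : S.Transversal, expect T 1 = 1 := fun T => by
      have := expect_gen T 1 0
      rwa [diagElt_one, shiftElt_zero, one_mul, if_pos rfl] at this
    simp only [ht]
    rw [avgExpect_apply, Finset.sum_congr rfl fun z _ => h1 _, Finset.sum_const, nsmul_eq_mul,
      mul_one, inv_mul_cancel₀]
    exact_mod_cast (hcard n).ne'
  · intro a b
    have := tendsto_nhds_unique ((hτ (a * b)).sub (hτ (b * a))) ((hcomm a b).mono_left hle)
    exact sub_eq_zero.1 this

end Regular

end SubstitutionSystem
end SubstTiling

namespace SubstTiling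

/-! ### Uniqueness of invariant frequencies -/

/-- A nonnegative normalized solution of the recursion `m n = M (m (n + N))`. -/
structure IsFrequency {ι : Type*} [Fintype ι] (L : ℕ → ι → ℝ) (M : ι → ι → ℝ) (N : ℕ)
    (m : ℕ → ι → ℝ) : Prop where
  nonneg : ∀ n p, 0 ≤ m n p
  step : ∀ n p, m n p = ∑ q, M p q * m (n + N) q
  sum_eq_one : ∀ n, ∑ p, L n p * m n p = 1

namespace IsFrequency

variable {ι : Type*} [Fintype ι] {L : ℕ → ι → ℝ} {M : ι → ι → ℝ} {N : ℕ} {m u : ℕ → ι → ℝ} {K : ℝ}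

/-- The entries of `M` lie in `[1, K]`, so every value at level `n` is between `s` and `K s`, where
`s` is the sum of the values at level `n + N`. Normalization with the same weights `L` then compares
the sums of the two solutions. -/
theorem le_mul (hM : ∀ p q, 1 ≤ M p q) (hK : ∀ p q, M p q ≤ K) (hL : ∀ n p, 0 < L n p)
    (hm : IsFrequency L M N m) (hu : IsFrequency L M N u) (n : ℕ) (p : ι) :
    u n p ≤ K ^ 2 * m n p := by
  have : Nonempty ι := ⟨p⟩
  have hK1 : 1 ≤ K := (hM p p).trans (hK p p)
  have lower : ∀ v, IsFrequency L M N v → ∀ r, ∑ q, v (n + N) q ≤ v n r := fun v hv r => by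
    rw [hv.step]
    exact Finset.sum_le_sum fun q _ => le_mul_of_one_le_left (hv.nonneg _ _) (hM r q)
  have upper : ∀ v, IsFrequency L M N v → ∀ r, v n r ≤ K * ∑ q, v (n + N) q := fun v hv r => by
    rw [hv.step, Finset.mul_sum]
    exact Finset.sum_le_sum fun q _ => mul_le_mul_of_nonneg_right (hK r q) (hv.nonneg _ _)
  have hΛ : 0 < ∑ r, L n r := Finset.sum_pos (fun r _ => hL n r) Finset.univ_nonempty
  set s := ∑ q, m (n + N) q
  set s' := ∑ q, u (n + N) q
  have h1 : 1 ≤ (∑ r, L n r) * (K * s) := by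
    rw [← hm.sum_eq_one n, Finset.sum_mul]
    exact Finset.sum_le_sum fun r _ => mul_le_mul_of_nonneg_left (upper m hm r) (hL n r).le
  have h2 : (∑ r, L n r) * s' ≤ 1 := by
    rw [← hu.sum_eq_one n, Finset.sum_mul]
    exact Finset.sum_le_sum fun r _ => mul_le_mul_of_nonneg_left (lower u hu r) (hL n r).le
  have h3 : s' ≤ K * s := le_of_mul_le_mul_left (h2.trans h1) hΛ
  calc u n p ≤ K * s' := upper u hu p
    _ ≤ K * (K * s) := by gcongr
    _ = K ^ 2 * s := by ring
    _ ≤ K ^ 2 * m n p := by gcongr; exact lower m hm p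

/-- If `m ≥ (1 - e) u`, the normalized remainder `(m - (1 - e) u) / e` is again a frequency, so
`le_mul` bounds it below by `δ u`. This replaces `e` by `(1 - δ) e`, and iteration gives `m ≥ u`. -/
theorem le (hM : ∀ p q, 1 ≤ M p q) (hK : ∀ p q, M p q ≤ K) (hL : ∀ n p, 0 < L n p)
    (hm : IsFrequency L M N m) (hu : IsFrequency L M N u) (n : ℕ) (p : ι) : u n p ≤ m n p := by
  have hK1 : 1 ≤ K := (hM p p).trans (hK p p)
  -- The extra `1` ensures `δ < 1` even for `K = 1`, so that the remainder can always be divided by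
  -- `e`.
  set δ : ℝ := (K ^ 2 + 1)⁻¹ with hδ
  have hδ0 : 0 < δ := by positivity
  have hδ1 : δ < 1 := inv_lt_one_of_one_lt₀ (by nlinarith)
  have key : ∀ j : ℕ, ∀ n p, (1 - (1 - δ) ^ j) * u n p ≤ m n p := by
    intro j
    induction j with
    | zero => intro n p; simpa using hm.nonneg n p
    | succ j ih =>
      set e := (1 - δ) ^ j with he
      have he0 : 0 < e := pow_pos (by linarith) j
      have hm' : IsFrequency L M N fun n p => e⁻¹ * (m n p - (1 - e) * u n p) := by
        refine ⟨fun n p => mul_nonneg (inv_nonneg.2 he0.le) (sub_nonneg.2 (ih n p)),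
          fun n p => ?_, fun n => ?_⟩
        · have h : ∀ q, M p q * (e⁻¹ * (m (n + N) q - (1 - e) * u (n + N) q)) =
              e⁻¹ * (M p q * m (n + N) q - (1 - e) * (M p q * u (n + N) q)) := fun q => by ring
          simp only [h]
          rw [← Finset.mul_sum, Finset.sum_sub_distrib, ← Finset.mul_sum, ← hm.step, ← hu.step]
        · have h : ∀ p, L n p * (e⁻¹ * (m n p - (1 - e) * u n p)) =
              e⁻¹ * (L n p * m n p - (1 - e) * (L n p * u n p)) := fun p => by ring
          simp only [h]
          rw [← Finset.mul_sum, Finset.sum_sub_distrib, ← Finset.mul_sum, hm.sum_eq_one,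
            hu.sum_eq_one]
          field_simp
          ring
      intro n p
      have h1 := le_mul hM hK hL hm' hu n p
      have h2 : δ * u n p ≤ e⁻¹ * (m n p - (1 - e) * u n p) := by
        have h0 := hm'.nonneg n p
        rw [hδ, inv_mul_le_iff₀ (by positivity)]
        linarith
      have h3 := mul_le_mul_of_nonneg_left h2 he0.le
      rw [mul_inv_cancel_left₀ he0.ne'] at h3
      rw [pow_succ, ← he]
      linarith
  have hlim : Tendsto (fun j : ℕ => (1 - (1 - δ) ^ j) * u n p) atTop (𝓝 ((1 - 0) * u n p)) :=
    ((tendsto_pow_atTop_nhds_zero_of_lt_one (by linarith) (by linarith)).const_sub 1).mul_const _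
  rw [sub_zero, one_mul] at hlim
  exact le_of_tendsto' hlim fun j => key j n p

theorem unique (hM : ∀ p q, 1 ≤ M p q) (hK : ∀ p q, M p q ≤ K) (hL : ∀ n p, 0 < L n p)
    (hm : IsFrequency L M N m) (hu : IsFrequency L M N u) (n : ℕ) (p : ι) : m n p = u n p :=
  (le hM hK hL hu hm n p).antisymm (le hM hK hL hm hu n p)

end IsFrequency

namespace SubstitutionSystem

variable {d : ℕ} {ι : Type*} {S : SubstitutionSystem d ι}

/-! ### Punctures by type -/

section Finite

variable [Finite ι]

open Classical in
variable (S) in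
/-- The punctures of the tiles of type `p` in `ω^k(q)`. -/
def typePunctures (k : ℕ) (p q : ι) : Finset (Euc d) :=
  {w ∈ S.punctures k q | ((p, w) : Tile d ι) ∈ S.supertile k q}

theorem mem_typePunctures {k : ℕ} {p q : ι} {w : Euc d} :
    w ∈ S.typePunctures k p q ↔ ((p, w) : Tile d ι) ∈ S.supertile k q := by
  classical
  rw [typePunctures, Finset.mem_filter, mem_punctures]
  exact ⟨fun h => h.2, fun h => ⟨⟨p, h⟩, h⟩⟩

variable (S) in
/-- A puncture of `ω^n(p)`. -/
def basePuncture (n : ℕ) (p : ι) : Euc d := (S.punctures_nonempty n p).choose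

theorem basePuncture_mem (n : ℕ) (p : ι) : S.basePuncture n p ∈ S.punctures n p :=
  (S.punctures_nonempty n p).choose_spec

variable {G : Subgroup (OrthGroup d)} [MulAction G ι]

theorem IsSymmetryGroup.card_punctures_smul (hG : S.IsSymmetryGroup G) (g : G) (n : ℕ) (p : ι) :
    (S.punctures n (g • p)).card = (S.punctures n p).card := by
  refine Finset.card_nbij' (fun z => ((g⁻¹ : G) : OrthGroup d) z) (fun z => (g : OrthGroup d) z)
    (fun z hz => ?_) (fun z hz => hG.mem_punctures_rotate g hz) (fun z _ => ?_) (fun z _ => ?_)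
  · have := hG.mem_punctures_rotate g⁻¹ hz
    rwa [inv_smul_smul] at this
  · exact (g : OrthGroup d).apply_symm_apply z
  · exact (g : OrthGroup d).symm_apply_apply z

theorem IsSymmetryGroup.mem_typePunctures_rotate (hG : S.IsSymmetryGroup G) (g : G) {k : ℕ}
    {p q : ι} {w : Euc d} (hw : w ∈ S.typePunctures k p q) :
    (g : OrthGroup d) w ∈ S.typePunctures k (g • p) (g • q) := by
  rw [mem_typePunctures] at hw ⊢
  rw [hG.supertile_smul]
  exact ⟨_, hw, rfl⟩

theorem IsSymmetryGroup.card_typePunctures_smul (hG : S.IsSymmetryGroup G) (g : G) (k : ℕ)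
    (p q : ι) : (S.typePunctures k (g • p) (g • q)).card = (S.typePunctures k p q).card := by
  refine Finset.card_nbij' (fun z => ((g⁻¹ : G) : OrthGroup d) z) (fun z => (g : OrthGroup d) z)
    (fun z hz => ?_) (fun z hz => hG.mem_typePunctures_rotate g hz) (fun z _ => ?_) (fun z _ => ?_)
  · have := hG.mem_typePunctures_rotate g⁻¹ hz
    rwa [inv_smul_smul, inv_smul_smul] at this
  · exact (g : OrthGroup d).apply_symm_apply z
  · exact (g : OrthGroup d).symm_apply_apply z

theorem exists_typePunctures_bounds [S.IsRegular] : ∃ (N : ℕ) (K : ℝ), ∀ p q : ι,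
    (1 : ℝ) ≤ (S.typePunctures N p q).card ∧ ((S.typePunctures N p q).card : ℝ) ≤ K := by
  have := Fintype.ofFinite ι
  obtain ⟨N, hN⟩ := IsRegular.primitive (S := S)
  refine ⟨N, ∑ p : ι, ∑ q : ι, ((S.typePunctures N p q).card : ℝ), fun p q => ⟨?_, ?_⟩⟩
  · obtain ⟨x, hx⟩ := hN q p
    exact_mod_cast Finset.card_pos.2 ⟨x, mem_typePunctures.2 hx⟩
  · refine le_trans ?_ (Finset.single_le_sum (f := fun p : ι => ∑ q : ι,
      ((S.typePunctures N p q).card : ℝ)) (fun p _ => by positivity) (Finset.mem_univ p))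
    exact Finset.single_le_sum (f := fun q : ι => ((S.typePunctures N p q).card : ℝ))
      (fun q _ => by positivity) (Finset.mem_univ q)

end Finite

/-! ### Traces of cells -/

section Regular

variable [Finite ι] [Nonempty ι] [S.IsRegular]

open Classical in
variable (S) in
/-- The indicator function of a cell. -/
def cellInd (n : ℕ) (p : ι) (z : Euc d) : C(S.Transversal, ℂ) :=
  if hz : z ∈ S.punctures n p then clopenInd (isClopen_cell hz) else 0

open Classical in
theorem cellInd_apply {n : ℕ} {p : ι} {z : Euc d} (hz : z ∈ S.punctures n p) (T : S.Transversal) :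
    S.cellInd n p z T = if T ∈ S.cell n p z then 1 else 0 := by
  rw [cellInd, dif_pos hz, clopenInd_apply]

theorem cellInd_of_mem {n : ℕ} {p : ι} {z : Euc d} (hz : z ∈ S.punctures n p) {T : S.Transversal}
    (hT : T ∈ S.cell n p z) : S.cellInd n p z T = 1 := by
  classical
  rw [cellInd_apply hz, if_pos hT]

theorem cellInd_of_notMem {n : ℕ} {p : ι} {z : Euc d} {T : S.Transversal}
    (hT : T ∉ S.cell n p z) : S.cellInd n p z T = 0 := by
  classical
  by_cases hz : z ∈ S.punctures n p
  · rw [cellInd_apply hz, if_neg hT]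
  · rw [cellInd, dif_neg hz]; rfl

/-- The value of a combination of indicators of cells of order `n`. -/
theorem sum_cellInd_apply [Fintype ι] {n : ℕ} {p : ι} {z : Euc d} (hz : z ∈ S.punctures n p)
    {T : S.Transversal} (hT : T ∈ S.cell n p z) (F : ι → Euc d → ℂ) :
    (∑ q, ∑ w ∈ S.punctures n q, F q w • S.cellInd n q w) T = F p z := by
  simp only [ContinuousMap.sum_apply, ContinuousMap.smul_apply, smul_eq_mul]
  rw [Finset.sum_eq_single p, Finset.sum_eq_single z, cellInd_of_mem hz hT, mul_one]
  · intro w hw hne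
    rw [cellInd_of_notMem, mul_zero]
    exact fun h => hne (mem_cell_unique hw hz h hT).2
  · exact fun h => absurd hz h
  · intro q _ hne
    refine Finset.sum_eq_zero fun w hw => ?_
    rw [cellInd_of_notMem, mul_zero]
    exact fun h => hne (mem_cell_unique hw hz h hT).1
  · exact fun h => absurd (Finset.mem_univ _) h

theorem sum_cellInd [Fintype ι] (n : ℕ) :
    ∑ p, ∑ z ∈ S.punctures n p, S.cellInd n p z = 1 := by
  ext T
  obtain ⟨p, z, hz, hT⟩ := exists_mem_cell n T
  have := sum_cellInd_apply hz hT fun _ _ => 1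
  simp only [one_smul] at this
  rw [this, ContinuousMap.one_apply]

theorem cellInd_eq_sum [Fintype ι] {n : ℕ} (k : ℕ) {p : ι} {z : Euc d}
    (hz : z ∈ S.punctures n p) : S.cellInd n p z =
      ∑ q, ∑ w ∈ S.typePunctures k p q, S.cellInd (n + k) q (z + S.scale ^ n • w) := by
  ext T
  simp only [ContinuousMap.sum_apply]
  by_cases hT : T ∈ S.cell n p z
  · obtain ⟨q, w, hw, hTq⟩ := mem_cell_iff_exists.1 hT
    have hq := add_mem_punctures hz hw
    rw [cellInd_of_mem hz hT, Finset.sum_eq_single q, Finset.sum_eq_single w,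
      cellInd_of_mem hq hTq]
    · intro w' hw' hne
      refine cellInd_of_notMem fun h => hne ?_
      have := (mem_cell_unique (add_mem_punctures hz (mem_typePunctures.1 hw')) hq h hTq).2
      exact smul_right_injective _ (S.scale_pow_ne_zero n) (add_left_cancel this)
    · exact fun h => absurd (mem_typePunctures.2 hw) h
    · intro q' _ hne
      refine Finset.sum_eq_zero fun w' hw' => cellInd_of_notMem fun h => hne ?_
      exact (mem_cell_unique (add_mem_punctures hz (mem_typePunctures.1 hw')) hq h hTq).1
    · exact fun h => absurd (Finset.mem_univ _) h
  · rw [cellInd_of_notMem hT]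
    refine (Finset.sum_eq_zero fun q _ => Finset.sum_eq_zero fun w hw => ?_).symm
    exact cellInd_of_notMem fun h => hT (mem_cell_iff_exists.2 ⟨q, w, mem_typePunctures.1 hw, h⟩)

theorem star_cellInd_mul_self (n : ℕ) (p : ι) (z : Euc d) :
    star (S.cellInd n p z) * S.cellInd n p z = S.cellInd n p z := by
  classical
  ext T
  by_cases hz : z ∈ S.punctures n p
  · rw [ContinuousMap.mul_apply, ContinuousMap.star_apply, cellInd_apply hz]
    split_ifs <;> simp
  · rw [cellInd, dif_neg hz]; simp

theorem shiftFun_cellInd {n : ℕ} {p : ι} {z z' : Euc d} (hz : z ∈ S.punctures n p)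
    (hz' : z' ∈ S.punctures n p) :
    shiftFun (z - z') (S.cellInd n p z') = S.cellInd n p z := by
  ext T
  rw [shiftFun_apply]
  by_cases hT : T ∈ S.cell n p z
  · have h : T ∈ S.translatable (z - z') := exists_translate_of_mem_cell hT hz'
    rw [dif_pos h, cellInd_of_mem hz hT, cellInd_of_mem hz' (mem_cell_translate rfl hT)]
  · rw [cellInd_of_notMem hT]
    split_ifs with h
    · refine cellInd_of_notMem fun h' => hT ?_
      refine mem_cell_translate ?_ h'
      rw [← neg_sub z z']
      exact (translate_neg_translate _ _).symm
    · rfl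

variable {τ : S.TilingAlgebra →ₗ[ℂ] ℂ}

/-- All cells of a supertile have the same trace. -/
theorem trace_cellInd_eq (hτ : IsNormalizedTrace τ) {n : ℕ} {p : ι} {z z' : Euc d}
    (hz : z ∈ S.punctures n p) (hz' : z' ∈ S.punctures n p) :
    τ (diagElt (S.cellInd n p z)) = τ (diagElt (S.cellInd n p z')) := by
  set c := S.cellInd n p z'
  have hcc : star c * c = c := star_cellInd_mul_self n p z'
  have hc2 : c * star c = c := by rw [mul_comm]; exact hcc
  -- The element `V_(z-z') c` is a partial isometry between the projections of the two cells; this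
  -- identity and the next are its range and source projections.
  have h1 : diagElt (S.cellInd n p z) =
      shiftElt (z - z') * diagElt c * (diagElt (star c) * shiftElt (-(z - z'))) := by
    rw [mul_assoc, ← mul_assoc (diagElt c), ← diagElt_mul, hc2, ← mul_assoc, shiftElt_conj,
      shiftFun_cellInd hz hz']
  have h2 : diagElt (star c) * shiftElt (-(z - z')) * (shiftElt (z - z') * diagElt c) =
      diagElt c := by
    have h3 : c * shiftFun (z' - z) 1 = c := by
      ext T
      rw [ContinuousMap.mul_apply, shiftFun_apply]
      by_cases hT : T ∈ S.cell n p z'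
      · have h : T ∈ S.translatable (z' - z) := exists_translate_of_mem_cell hT hz
        rw [dif_pos h, ContinuousMap.one_apply, mul_one]
      · rw [show c T = 0 from cellInd_of_notMem hT, zero_mul]
    have h4 : (shiftElt (-(z - z')) * shiftElt (z - z') : S.TilingAlgebra) =
        diagElt (shiftFun (z' - z) 1) := by
      rw [shiftElt_mul_shiftElt, neg_add_cancel, shiftElt_zero, mul_one, neg_sub]
    rw [mul_assoc, ← mul_assoc (shiftElt _), h4, ← diagElt_mul, ← diagElt_mul,
      mul_comm (shiftFun _ _), h3, hcc]
  rw [h1, hτ.tracial, h2]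

/-- The common trace of the cells of `ω^n(p)`. -/
def frequency (τ : S.TilingAlgebra →ₗ[ℂ] ℂ) (n : ℕ) (p : ι) : ℝ :=
  (τ (diagElt (S.cellInd n p (S.basePuncture n p)))).re

theorem frequency_nonneg (hτ : IsNormalizedTrace τ) (n : ℕ) (p : ι) : 0 ≤ frequency τ n p := by
  have h := (hτ.nonneg (diagElt (S.cellInd n p (S.basePuncture n p)))).1
  rwa [star_diagElt, ← diagElt_mul, star_cellInd_mul_self] at h

theorem trace_cellInd (hτ : IsNormalizedTrace τ) {n : ℕ} {p : ι} {z : Euc d}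
    (hz : z ∈ S.punctures n p) : τ (diagElt (S.cellInd n p z)) = frequency τ n p := by
  rw [trace_cellInd_eq hτ hz (basePuncture_mem n p)]
  have h := (hτ.nonneg (diagElt (S.cellInd n p (S.basePuncture n p)))).2
  rw [star_diagElt, ← diagElt_mul, star_cellInd_mul_self] at h
  exact Complex.ext rfl (by rw [h, Complex.ofReal_im])

theorem trace_sum_cellInd [Fintype ι] (hτ : IsNormalizedTrace τ) (n : ℕ) (F : ι → Euc d → ℂ) :
    τ (diagElt (∑ p, ∑ z ∈ S.punctures n p, F p z • S.cellInd n p z)) =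
      ∑ p, ∑ z ∈ S.punctures n p, F p z * frequency τ n p := by
  rw [diagElt_sum, _root_.map_sum τ]
  refine Finset.sum_congr rfl fun p _ => ?_
  rw [diagElt_sum, _root_.map_sum τ]
  refine Finset.sum_congr rfl fun z hz => ?_
  rw [diagElt_smul, LinearMap.map_smul, smul_eq_mul, trace_cellInd hτ hz]

/-- A cell of type `p` splits into cells of order `n + N`, one for each occurrence of `p` in some
`ω^N(q)`; this is the recursion. The normalization holds because the cells partition the unit. -/
theorem isFrequency_frequency [Fintype ι] (hτ : IsNormalizedTrace τ) (N : ℕ) :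
    IsFrequency (fun n p => ((S.punctures n p).card : ℝ))
      (fun p q => ((S.typePunctures N p q).card : ℝ)) N (frequency τ) := by
  refine ⟨frequency_nonneg hτ, fun n p => ?_, fun n => ?_⟩
  · have h := trace_cellInd hτ (basePuncture_mem n p)
    rw [cellInd_eq_sum N (basePuncture_mem n p), diagElt_sum, _root_.map_sum τ] at h
    have h1 : ∀ q, τ (diagElt (∑ w ∈ S.typePunctures N p q,
        S.cellInd (n + N) q (S.basePuncture n p + S.scale ^ n • w))) =
        (((S.typePunctures N p q).card * frequency τ (n + N) q : ℝ) : ℂ) := fun q => by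
      rw [diagElt_sum, _root_.map_sum τ, Finset.sum_congr rfl fun w hw => trace_cellInd hτ
        (add_mem_punctures (basePuncture_mem n p) (mem_typePunctures.1 hw)), Finset.sum_const]
      push_cast
      rw [nsmul_eq_mul]
    rw [Finset.sum_congr rfl fun q _ => h1 q, ← Complex.ofReal_sum] at h
    exact (Complex.ofReal_injective h).symm
  · have h := trace_sum_cellInd hτ n fun _ _ => 1
    simp only [one_smul, sum_cellInd, diagElt_one, hτ.map_one, one_mul, Finset.sum_const,
      nsmul_eq_mul] at h
    exact_mod_cast h.symm

variable {G : Subgroup (OrthGroup d)} [MulAction G ι]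

/-- The frequencies of supertiles are invariant under the symmetry group. -/
theorem IsSymmetryGroup.frequency_smul (hG : S.IsSymmetryGroup G) (hτ : IsNormalizedTrace τ)
    (g : G) (n : ℕ) (p : ι) : frequency τ n (g • p) = frequency τ n p := by
  have := Fintype.ofFinite ι
  obtain ⟨N, K, hK⟩ := exists_typePunctures_bounds (S := S)
  have hm := isFrequency_frequency hτ N
  -- The symmetry `g` preserves the numbers of punctures, so the permuted frequencies solve the same
  -- recursion with the same normalization.
  have hu : IsFrequency (fun n p => ((S.punctures n p).card : ℝ))
      (fun p q => ((S.typePunctures N p q).card : ℝ)) N fun n p => frequency τ n (g • p) := by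
    refine ⟨fun n p => hm.nonneg n _, fun n p => ?_, fun n => ?_⟩
    · rw [hm.step n (g • p), ← Equiv.sum_comp (MulAction.toPerm g)]
      simp only [MulAction.toPerm_apply, hG.card_typePunctures_smul]
    · rw [← hm.sum_eq_one n, ← Equiv.sum_comp (MulAction.toPerm g)
        fun p => ((S.punctures n p).card : ℝ) * frequency τ n p]
      simp only [MulAction.toPerm_apply, hG.card_punctures_smul]
  exact IsFrequency.unique (fun p q => (hK p q).1) (fun p q => (hK p q).2)
    (fun n p => by exact_mod_cast (S.punctures_nonempty n p).card_pos) hu hm n p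

end Regular

end SubstitutionSystem
end SubstTiling

/-! ### Orbit representatives and the Rokhlin functions. -/

namespace SubstTiling

/-- A function on a `G`-set sums to `#G` times its sum over a set of representatives. -/
theorem sum_eq_card_mul_sum_ite {G X : Type*} [Group G] [Finite G] [MulAction G X] [Fintype X]
    {D : Set X} [DecidablePred (· ∈ D)] (hD : ∀ p, ∃! g : G, g • p ∈ D) {u : X → ℝ}
    (hu : ∀ (g : G) (p : X), u (g • p) = u p) :
    ∑ p, u p = Nat.card G * ∑ p, if p ∈ D then u p else 0 := by
  have := Fintype.ofFinite G
  -- Exactly one `g` carries `p` into `D`, so the inner sum has one term.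
  have h1 : ∀ p, u p = ∑ g : G, if g • p ∈ D then u (g • p) else 0 := by
    intro p
    obtain ⟨g, hg, hg'⟩ := hD p
    rw [Finset.sum_eq_single g, if_pos hg, hu]
    · exact fun h _ hne => if_neg fun hh => hne (hg' h hh)
    · exact fun h => absurd (Finset.mem_univ g) h
  rw [Finset.sum_congr rfl fun p _ => h1 p, Finset.sum_comm]
  have h2 : ∀ g : G, (∑ p, if g • p ∈ D then u (g • p) else 0) = ∑ p, if p ∈ D then u p else 0 :=
    fun g => Equiv.sum_comp (MulAction.toPerm g) fun p => if p ∈ D then u p else 0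
  rw [Finset.sum_congr rfl fun g _ => h2 g, Finset.sum_const, nsmul_eq_mul, Finset.card_univ,
    Nat.card_eq_fintype_card]

/-- A free action has a set of representatives of its orbits. -/
theorem exists_existsUnique_smul_mem {G X : Type*} [Group G] [MulAction G X]
    (hfree : ∀ (g : G) (p : X), g • p = p → g = 1) : ∃ D : Set X, ∀ p, ∃! g : G, g • p ∈ D := by
  refine ⟨{p | (Quotient.mk (MulAction.orbitRel G X) p).out = p}, fun p => ?_⟩
  have hq : ∀ g : G, Quotient.mk (MulAction.orbitRel G X) (g • p) =
      Quotient.mk (MulAction.orbitRel G X) p := fun g => Quotient.sound ⟨g, rfl⟩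
  obtain ⟨g, hg⟩ : (Quotient.mk (MulAction.orbitRel G X) p).out ∈ MulAction.orbit G p :=
    Quotient.mk_out (s := MulAction.orbitRel G X) p
  have hg : g • p = (Quotient.mk (MulAction.orbitRel G X) p).out := hg
  refine ⟨g, ?_, fun h hh => ?_⟩
  · change (Quotient.mk (MulAction.orbitRel G X) (g • p)).out = g • p
    rw [hq, hg]
  · have hh : (Quotient.mk (MulAction.orbitRel G X) (h • p)).out = h • p := hh
    rw [hq, ← hg] at hh
    refine (inv_mul_eq_one.1 (hfree (g⁻¹ * h) p ?_)).symm
    rw [mul_smul, ← hh, inv_smul_smul]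

namespace SubstitutionSystem

variable {d : ℕ} {ι : Type*} {S : SubstitutionSystem d ι}

/-! ### The action on the diagonal -/

namespace IsSymmetryGroup

variable {G : Subgroup (OrthGroup d)} [MulAction G ι]

/-- The action of `g` on the punctured hull. -/
def rotT (hG : S.IsSymmetryGroup G) (g : G) : C(S.Transversal, S.Transversal) where
  toFun T := ⟨rotate g T.1, hG.punctHull_rotate g T.2⟩
  continuous_toFun := by
    refine Transversal.continuous_iff.2 fun t => ?_
    have : {T : S.Transversal | t ∈ rotate g T.1} =
        {T : S.Transversal | Tile.rotate g⁻¹ t ∈ T.1} := by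
      ext T
      constructor
      · intro h
        have := mem_image_of_mem (Tile.rotate g⁻¹) (show t ∈ rotate g T.1 from h)
        rwa [← rotate, rotate_inv_rotate] at this
      · intro h
        have := mem_image_of_mem (Tile.rotate g) (show Tile.rotate g⁻¹ t ∈ T.1 from h)
        simpa [rotate, Tile.rotate] using this
    change IsOpen {T : S.Transversal | t ∈ rotate g T.1}
    rw [this]
    exact Transversal.isOpen_mem _

theorem action_diagElt [Finite ι] [Nonempty ι] [S.IsRegular] (hG : S.IsSymmetryGroup G) (g : G)
    (φ : C(S.Transversal, ℂ)) :
    hG.action g (diagElt φ) = diagElt (φ.comp (hG.rotT g⁻¹)) := by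
  refine Subtype.ext ?_
  change hG.conj g (diagOp φ) = diagOp (φ.comp (hG.rotT g⁻¹))
  ext ξ γ
  rw [conj_apply_apply, diagOp_apply, diagOp_apply, permUnitary_symm_apply]
  congr 1
  exact congrArg (ξ : S.RPunc → ℂ) ((hG.homeoR g).apply_symm_apply γ)

end IsSymmetryGroup

/-! ### Asymptotically invariant functions -/

section Regular

variable [Finite ι] [Nonempty ι] [S.IsRegular]

theorem isPositiveElement_diagElt {φ : C(S.Transversal, ℂ)}
    (h : ∀ T, ∃ r : ℝ, 0 ≤ r ∧ φ T = r) : IsPositiveElement (diagElt φ) := by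
  let ψ : C(S.Transversal, ℂ) :=
    ⟨fun T => (Real.sqrt (φ T).re : ℂ), by fun_prop⟩
  refine ⟨diagElt ψ, ?_⟩
  rw [star_diagElt, ← diagElt_mul]
  congr 1
  ext T
  obtain ⟨r, hr, he⟩ := h T
  have hψ : ψ T = (Real.sqrt r : ℂ) := by
    change (Real.sqrt (φ T).re : ℂ) = _
    rw [he, Complex.ofReal_re]
  rw [ContinuousMap.mul_apply, ContinuousMap.star_apply, hψ, he, Complex.star_def,
    Complex.conj_ofReal, ← Complex.ofReal_mul, Real.mul_self_sqrt hr]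

/-- The commutator is `ψ (φ - φ(· + x)) V_x`, restricted to the tilings that can be translated by
`x`. -/
theorem norm_commutator_gen_le {φ : C(S.Transversal, ℂ)} {x : Euc d} {c : ℝ} (hc : 0 ≤ c)
    (h : ∀ T (hT : T ∈ S.translatable x), ‖φ T - φ (T.shift x hT)‖ ≤ c)
    (ψ : C(S.Transversal, ℂ)) :
    ‖diagElt φ * (diagElt ψ * shiftElt x) - diagElt ψ * shiftElt x * diagElt φ‖ ≤ ‖ψ‖ * c := by
  -- The shift absorbs the indicator of the tilings translatable by `x`; off that set `shiftFun x φ`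
  -- is zero and says nothing about `φ`.
  have hV : (shiftElt x : S.TilingAlgebra) = diagElt (shiftFun x 1) * shiftElt x := by
    rw [← shiftElt_mul_diagElt, diagElt_one, mul_one]
  have h1 : diagElt φ * (diagElt ψ * shiftElt x) =
      diagElt (ψ * (φ * shiftFun x 1)) * shiftElt x := by
    conv_lhs => rw [hV]
    rw [← mul_assoc, ← mul_assoc, ← diagElt_mul, ← diagElt_mul, mul_comm φ ψ, mul_assoc ψ]
  have h2 : diagElt ψ * shiftElt x * diagElt φ = diagElt (ψ * shiftFun x φ) * shiftElt x := by
    rw [mul_assoc, shiftElt_mul_diagElt, ← mul_assoc, ← diagElt_mul]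
  rw [h1, h2, ← sub_mul, ← diagElt_sub, ← mul_sub]
  refine (norm_genElt_le _ _).trans ((norm_mul_le _ _).trans ?_)
  refine mul_le_mul_of_nonneg_left ((ContinuousMap.norm_le _ hc).2 fun T => ?_) (norm_nonneg _)
  rw [ContinuousMap.sub_apply, ContinuousMap.mul_apply, shiftFun_apply, shiftFun_apply]
  by_cases hT : T ∈ S.translatable x
  · rw [dif_pos hT, dif_pos hT, ContinuousMap.one_apply, mul_one]
    exact h T hT
  · rw [dif_neg hT, dif_neg hT, mul_zero, sub_zero, norm_zero]
    exact hc

/-- Almost invariant functions asymptotically commute with the tiling algebra. -/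
theorem tendsto_norm_commutator {φ : ℕ → C(S.Transversal, ℂ)} (hφ : ∀ k, ‖φ k‖ ≤ 1)
    (h : ∀ k x T (hT : T ∈ S.translatable x), ‖φ k T - φ k (T.shift x hT)‖ ≤ ‖x‖ / (k + 1))
    (a : S.TilingAlgebra) :
    Tendsto (fun k => ‖diagElt (φ k) * a - a * diagElt (φ k)‖) atTop (𝓝 0) := by
  induction a using tiling_induction with
  | gen ψ x =>
    refine squeeze_zero (fun _ => norm_nonneg _)
      (fun k => norm_commutator_gen_le (c := ‖x‖ / (k + 1)) (by positivity) (h k x) ψ) ?_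
    have := (tendsto_one_div_add_atTop_nhds_zero_nat (𝕜 := ℝ)).const_mul (‖ψ‖ * ‖x‖)
    rw [mul_zero] at this
    refine this.congr fun k => ?_
    ring
  | add a b ha hb =>
    refine squeeze_zero (fun _ => norm_nonneg _) (fun k => ?_) (by simpa using ha.add hb)
    rw [mul_add, add_mul, add_sub_add_comm]
    exact norm_add_le _ _
  | smul c a ha =>
    have := ha.const_mul ‖c‖
    rw [mul_zero] at this
    refine this.congr fun k => ?_
    rw [mul_smul_comm, smul_mul_assoc, ← smul_sub, norm_smul]
  | lim a ha =>
    refine Metric.tendsto_atTop.2 fun ε hε => ?_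
    obtain ⟨b, hb, hab⟩ := ha (ε / 4) (by positivity)
    obtain ⟨N, hN⟩ := Metric.tendsto_atTop.1 hb (ε / 2) (by positivity)
    refine ⟨N, fun k hk => ?_⟩
    have hk := hN k hk
    rw [Real.dist_0_eq_abs, abs_norm] at hk ⊢
    have hf : ‖diagElt (φ k)‖ ≤ 1 := (norm_diagElt_le _).trans (hφ k)
    have h1 : ‖diagElt (φ k) * (a - b)‖ ≤ ‖a - b‖ :=
      (norm_mul_le _ _).trans (mul_le_of_le_one_left (norm_nonneg _) hf)
    have h2 : ‖(a - b) * diagElt (φ k)‖ ≤ ‖a - b‖ :=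
      (norm_mul_le _ _).trans (mul_le_of_le_one_right (norm_nonneg _) hf)
    have h3 : diagElt (φ k) * a - a * diagElt (φ k) =
        (diagElt (φ k) * b - b * diagElt (φ k)) +
          (diagElt (φ k) * (a - b) - (a - b) * diagElt (φ k)) := by
      rw [mul_sub, sub_mul]; abel
    rw [h3]
    have h4 := norm_add_le (diagElt (φ k) * b - b * diagElt (φ k))
      (diagElt (φ k) * (a - b) - (a - b) * diagElt (φ k))
    have h5 := norm_sub_le (diagElt (φ k) * (a - b)) ((a - b) * diagElt (φ k))
    linarith

end Regular

/-! ### Rokhlin functions -/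

variable (S) in
/-- The distance from the puncture `z` to the boundary of `ω^n(p)`, in units of `r` and cut off
at `1`. -/
def weight (r : ℝ) (n : ℕ) (p : ι) (z : Euc d) : ℝ :=
  min 1 (Metric.infDist z (S.supp (S.supertile n p))ᶜ / r)

theorem weight_nonneg {r : ℝ} (hr : 0 < r) (n : ℕ) (p : ι) (z : Euc d) : 0 ≤ S.weight r n p z :=
  le_min zero_le_one (div_nonneg Metric.infDist_nonneg hr.le)

theorem weight_le_one (r : ℝ) (n : ℕ) (p : ι) (z : Euc d) : S.weight r n p z ≤ 1 :=
  min_le_left _ _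

theorem abs_weight_sub_le {r : ℝ} (hr : 0 < r) (n : ℕ) (p : ι) (z w : Euc d) :
    |S.weight r n p z - S.weight r n p w| ≤ ‖z - w‖ / r := by
  refine (abs_min_sub_min_le_max _ _ _ _).trans ?_
  rw [sub_self, abs_zero, ← sub_div, abs_div, abs_of_pos hr]
  refine max_le (by positivity) ((div_le_div_iff_of_pos_right hr).2 ?_)
  have := (Metric.lipschitz_infDist_pt (S.supp (S.supertile n p))ᶜ).dist_le_mul z w
  rwa [NNReal.coe_one, one_mul, Real.dist_eq, dist_eq_norm] at this

theorem weight_eq_one [Finite ι] {r : ℝ} (hr : 0 < r) {n : ℕ} {p : ι} {z : Euc d}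
    (hz : z ∈ S.punctures n p) (hz' : z ∉ S.nearPunctures n p r) : S.weight r n p z = 1 := by
  refine min_eq_left ((one_le_div hr).2 (not_lt.1 fun h => hz' ?_))
  exact S.mem_nearPunctures.2 ⟨hz, h⟩

open scoped Pointwise in
/-- If `T` and `T + x` have their origins in different supertiles, then the origin of `T` is
within `‖x‖` of the boundary of its supertile. -/
theorem infDist_le_of_mem_cell [Finite ι] [S.IsRegular] {n : ℕ} {p p' : ι} {z z' x : Euc d}
    {T T' : S.Transversal} (hx : T'.1 = translate x T.1) (h : T ∈ S.cell n p z)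
    (h' : T' ∈ S.cell n p' z') (hz' : z' ∈ S.punctures n p') (hne : (p, z) ≠ (p', z' + x)) :
    Metric.infDist z (S.supp (S.supertile n p))ᶜ ≤ ‖x‖ := by
  have hs := S.scale_pow_ne_zero n
  obtain ⟨U, hU, -, hp, hp'⟩ := cell_common hx h h'
  obtain ⟨q, hq⟩ := S.mem_punctures.1 hz'
  have hmem : ((q, -x) : Tile d ι) ∈
      S.substMap^[n] {((p', -(S.scale ^ n)⁻¹ • (z' + x)) : Tile d ι)} := by
    rw [iterate_singleton, mem_translate]
    simpa [smul_inv_smul₀ hs] using hq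
  obtain ⟨y, hy, hyx⟩ := S.inner_subset_of_mem_iterate n hmem (S.snd_mem_inner _)
  have hyx : S.scale ^ n • y = -x := hyx
  -- The origin of `T'` has position `z - x` relative to the supertile of `T`. It is interior to the
  -- supertile of `T'`, and the two supertiles come from different tiles of `U`, so it is not
  -- interior to the first.
  have hnot : z - x ∉ interior (S.supp (S.supertile n p)) := by
    intro hin
    have himg : S.supp (S.supertile n p) = S.scale ^ n • S.shape p := S.supp_supertile n p
    rw [himg, interior_smul₀ hs] at hin
    obtain ⟨w, hw, hwz⟩ := hin
    have hwz : S.scale ^ n • w = z - x := hwz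
    have hyin : y ∈ S.inner (p, -(S.scale ^ n)⁻¹ • z) := by
      rw [mem_inner]
      have : y - -(S.scale ^ n)⁻¹ • z = w := by
        refine smul_right_injective _ hs ?_
        change S.scale ^ n • (y - -(S.scale ^ n)⁻¹ • z) = S.scale ^ n • w
        rw [smul_sub, hyx, hwz, neg_smul, smul_neg, smul_inv_smul₀ hs]
        abel
      rwa [this]
    have heq := hU.1.1.eq_of_inter hp hp' hyin hy
    rw [Prod.mk.injEq] at heq
    refine hne (Prod.ext heq.1 ?_)
    exact smul_right_injective (Euc d) (neg_ne_zero.2 (inv_ne_zero hs)) heq.2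
  rw [← Metric.infDist_closure, closure_compl]
  refine (Metric.infDist_le_dist_of_mem (mem_compl hnot)).trans ?_
  rw [dist_eq_norm, sub_sub_cancel]

section Regular

variable [Fintype ι] [Nonempty ι] [S.IsRegular]

open Classical in
variable (S) in
/-- The function which is the weight of the supertile containing the origin if the type of this
supertile is in `D`, and zero otherwise. -/
def rokhlinFun (D : Set ι) (r : ℝ) (n : ℕ) : C(S.Transversal, ℂ) :=
  ∑ p, ∑ z ∈ S.punctures n p,
    ((if p ∈ D then S.weight r n p z else 0 : ℝ) : ℂ) • S.cellInd n p z

open Classical in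
theorem rokhlinFun_apply (D : Set ι) (r : ℝ) {n : ℕ} {p : ι} {z : Euc d}
    (hz : z ∈ S.punctures n p) {T : S.Transversal} (hT : T ∈ S.cell n p z) :
    S.rokhlinFun D r n T = ((if p ∈ D then S.weight r n p z else 0 : ℝ) : ℂ) :=
  sum_cellInd_apply hz hT fun p z => ((if p ∈ D then S.weight r n p z else 0 : ℝ) : ℂ)

theorem exists_rokhlinFun_eq (D : Set ι) {r : ℝ} (hr : 0 < r) (n : ℕ) (T : S.Transversal) :
    ∃ c : ℝ, 0 ≤ c ∧ c ≤ 1 ∧ S.rokhlinFun D r n T = c := by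
  obtain ⟨p, z, hz, hT⟩ := exists_mem_cell n T
  refine ⟨_, ?_, ?_, rokhlinFun_apply D r hz hT⟩
  · split_ifs
    exacts [weight_nonneg hr _ _ _, le_rfl]
  · split_ifs
    exacts [weight_le_one _ _ _ _, zero_le_one]

theorem norm_rokhlinFun_le (D : Set ι) {r : ℝ} (hr : 0 < r) (n : ℕ) :
    ‖S.rokhlinFun D r n‖ ≤ 1 := by
  refine (ContinuousMap.norm_le _ zero_le_one).2 fun T => ?_
  obtain ⟨c, h0, h1, h⟩ := exists_rokhlinFun_eq D hr n T
  rw [h, Complex.norm_real, Real.norm_of_nonneg h0]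
  exact h1

/-- If the two origins share a supertile, the Lipschitz bound of the weight applies. Otherwise both
are within `‖x‖` of the complements of their supertiles, so both values lie in `[0, ‖x‖ / r]`,
whatever the types. -/
theorem norm_rokhlinFun_sub_le (D : Set ι) {r : ℝ} (hr : 0 < r) (n : ℕ) (x : Euc d)
    (T : S.Transversal) (hT : T ∈ S.translatable x) :
    ‖S.rokhlinFun D r n T - S.rokhlinFun D r n (T.shift x hT)‖ ≤ ‖x‖ / r := by
  classical
  obtain ⟨p, z, hz, hTz⟩ := exists_mem_cell n T
  obtain ⟨p', z', hz', hTz'⟩ := exists_mem_cell n (T.shift x hT)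
  rw [rokhlinFun_apply D r hz hTz, rokhlinFun_apply D r hz' hTz', ← Complex.ofReal_sub,
    Complex.norm_real, Real.norm_eq_abs]
  by_cases hne : (p, z) = (p', z' + x)
  · rw [Prod.mk.injEq] at hne
    obtain ⟨rfl, rfl⟩ := hne
    split_ifs
    · have := abs_weight_sub_le (S := S) hr n p (z' + x) z'
      rwa [add_sub_cancel_left] at this
    · rw [sub_self, abs_zero]; positivity
  · have key : ∀ {p : ι} {z : Euc d}, Metric.infDist z (S.supp (S.supertile n p))ᶜ ≤ ‖x‖ →
        0 ≤ (if p ∈ D then S.weight r n p z else 0) ∧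
          (if p ∈ D then S.weight r n p z else 0) ≤ ‖x‖ / r := by
      intro p z h
      split_ifs
      · exact ⟨weight_nonneg hr _ _ _,
          (min_le_right _ _).trans ((div_le_div_iff_of_pos_right hr).2 h)⟩
      · exact ⟨le_rfl, by positivity⟩
    have h1 := key (infDist_le_of_mem_cell rfl hTz hTz' hz' hne)
    have h2 := key (p := p') (z := z') (by
      rw [← norm_neg x]
      refine infDist_le_of_mem_cell (T := T.shift x hT) (T' := T) ?_ hTz' hTz hz ?_
      · exact (translate_neg_translate x T.1).symm
      · intro he
        rw [Prod.mk.injEq] at he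
        refine hne (Prod.ext he.1.symm ?_)
        change z = z' + x
        rw [he.2, neg_add_cancel_right])
    exact abs_sub_le_of_nonneg_of_le h1.1 h1.2 h2.1 h2.2

variable {G : Subgroup (OrthGroup d)} [MulAction G ι]

/-- The function moved by `g` is nonzero only where the supertile type `p` satisfies `g⁻¹ p ∈ D`,
and a given `p` allows only one such `g`. -/
theorem IsSymmetryGroup.action_rokhlin_mul_action_rokhlin (hG : S.IsSymmetryGroup G) {D : Set ι}
    (hD : ∀ p, ∃! g : G, g • p ∈ D) (r : ℝ) (n : ℕ) {g h : G} (hgh : g ≠ h) :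
    hG.action g (diagElt (S.rokhlinFun D r n)) * hG.action h (diagElt (S.rokhlinFun D r n)) =
      0 := by
  rw [hG.action_diagElt, hG.action_diagElt, ← diagElt_mul, ← diagElt_zero]
  congr 1
  ext T
  obtain ⟨p, z, hz, hT⟩ := exists_mem_cell n T
  have key : ∀ g : G, S.rokhlinFun D r n (hG.rotT g⁻¹ T) ≠ 0 → g⁻¹ • p ∈ D := by
    intro g
    rw [rokhlinFun_apply D r (hG.mem_punctures_rotate g⁻¹ hz) (hG.mem_cell_rotate g⁻¹ rfl hT)]
    contrapose!
    intro hn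
    rw [if_neg hn, Complex.ofReal_zero]
  by_contra hne
  obtain ⟨h1, h2⟩ := mul_ne_zero_iff.1 hne
  exact hgh (inv_injective ((hD p).unique (key g h1) (key h h2)))

/-- With all weights equal to `1` the trace would be the mass of the types in `D`, which is exactly
`1 / #G` by invariance. The actual weights differ from `1` only at near punctures, a proportion at
most `ε` of each supertile, and the total mass is `1` for every trace. -/
theorem IsSymmetryGroup.norm_trace_rokhlin_sub_le [Finite G] (hG : S.IsSymmetryGroup G) {D : Set ι}
    (hD : ∀ p, ∃! g : G, g • p ∈ D) {r ε : ℝ} (hr : 0 < r) {n : ℕ}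
    (hn : ∀ p, ((S.nearPunctures n p r).card : ℝ) ≤ ε * (S.punctures n p).card)
    {τ : S.TilingAlgebra →ₗ[ℂ] ℂ} (hτ : IsNormalizedTrace τ) :
    ‖τ (diagElt (S.rokhlinFun D r n)) - (Nat.card G : ℂ)⁻¹‖ ≤ ε := by
  classical
  set m := frequency τ n
  have hm : ∀ p, 0 ≤ m p := frequency_nonneg hτ n
  have hsum : ∑ p, ((S.punctures n p).card : ℝ) * m p = 1 :=
    -- The normalization does not involve the step of the recursion, so `0` serves.
    (isFrequency_frequency hτ 0).sum_eq_one n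
  have hcard : (Nat.card G : ℝ) ≠ 0 := Nat.cast_ne_zero.2 Nat.card_pos.ne'
  have hG' : ∑ p, (if p ∈ D then ((S.punctures n p).card : ℝ) * m p else 0) =
      (Nat.card G : ℝ)⁻¹ := by
    have := sum_eq_card_mul_sum_ite hD (u := fun p => ((S.punctures n p).card : ℝ) * m p)
      fun g p => by simp only [m, hG.card_punctures_smul, hG.frequency_smul hτ]
    rw [hsum] at this
    exact (inv_eq_of_mul_eq_one_right this.symm).symm
  have htr : τ (diagElt (S.rokhlinFun D r n)) =
      ((∑ p, if p ∈ D then (∑ z ∈ S.punctures n p, S.weight r n p z) * m p else 0 : ℝ) : ℂ) := by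
    refine (trace_sum_cellInd hτ n fun p z =>
      ((if p ∈ D then S.weight r n p z else 0 : ℝ) : ℂ)).trans ?_
    rw [Complex.ofReal_sum]
    refine Finset.sum_congr rfl fun p _ => ?_
    split_ifs
    · rw [Finset.sum_mul, Complex.ofReal_sum]
      exact Finset.sum_congr rfl fun z _ => (Complex.ofReal_mul _ _).symm
    · simp
  have hw : ∀ p, |∑ z ∈ S.punctures n p, S.weight r n p z - (S.punctures n p).card| ≤
      ε * (S.punctures n p).card := by
    intro p
    refine le_trans ?_ (hn p)
    have hc : ((S.punctures n p).card : ℝ) = ∑ z ∈ S.punctures n p, 1 := by simp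
    rw [hc, ← Finset.sum_sub_distrib, ← Finset.sum_filter_of_ne
      (p := fun z => z ∈ S.nearPunctures n p r)]
    · refine (Finset.abs_sum_le_sum_abs _ _).trans ((Finset.sum_le_card_nsmul _ _ 1 ?_).trans ?_)
      · intro z _
        have h0 := weight_nonneg (S := S) hr n p z
        have h1 := weight_le_one (S := S) r n p z
        rw [abs_le]
        constructor <;> linarith
      · rw [nsmul_eq_mul, mul_one]
        exact_mod_cast Finset.card_le_card fun z hz => (Finset.mem_filter.1 hz).2
    · intro z hz hne
      by_contra hzn
      exact hne (by rw [weight_eq_one hr hz hzn, sub_self])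
  have hε : ε = ∑ p, ε * (S.punctures n p).card * m p := by
    simp only [mul_assoc]
    rw [← Finset.mul_sum, hsum, mul_one]
  have hinv : (Nat.card G : ℂ)⁻¹ = (((Nat.card G : ℝ)⁻¹ : ℝ) : ℂ) := by push_cast; rfl
  rw [htr, hinv, ← hG', ← Complex.ofReal_sub, Complex.norm_real, Real.norm_eq_abs,
    ← Finset.sum_sub_distrib]
  conv_rhs => rw [hε]
  refine (Finset.abs_sum_le_sum_abs _ _).trans (Finset.sum_le_sum fun p _ => ?_)
  split_ifs
  · rw [← sub_mul, abs_mul, abs_of_nonneg (hm p)]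
    exact mul_le_mul_of_nonneg_right (hw p) (hm p)
  · rw [sub_self, abs_zero]
    exact mul_nonneg ((abs_nonneg _).trans (hw p)) (hm p)

end Regular

end SubstitutionSystem
end SubstTiling

end

/-! ### Assembly of the Rokhlin sequence. -/

theorem mainTheorem4 {d : ℕ} {ι : Type*} [Finite ι] [Nonempty ι]
    (S : SubstTiling.SubstitutionSystem d ι)
    (h_primitive : S.IsPrimitive) (h_flc : S.HasFLC)
    (h_injective : S.IsInjective) (h_border : S.ForcesBorder)
    (G : Subgroup (SubstTiling.OrthGroup d)) [Finite G] [MulAction G ι]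
    (hG : S.IsSymmetryGroup G)
    (h_free : ∀ (g : G) (p : ι), g • p = p → g = 1) :
    SubstTiling.HasWeakRokhlinProperty hG.action := by
  have : S.IsRegular := ⟨h_primitive, h_flc, h_injective⟩
  have := Fintype.ofFinite ι
  obtain ⟨D, hD⟩ := SubstTiling.exists_existsUnique_smul_mem h_free
  have hr : ∀ k : ℕ, (0 : ℝ) < k + 1 := fun k => by positivity
  -- The scale `r = k + 1` makes commutators with the generators of order `1 / (k + 1)`. The order
  -- `n k` is then taken so large that at most a proportion `1 / (k + 1)` of the punctures of each
  -- supertile lies within `r` of its complement.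
  choose n hn using fun k : ℕ => (S.eventually_card_nearPunctures_le (k + 1)
    (ε := 1 / ((k : ℝ) + 1)) (by positivity)).exists
  refine ⟨SubstTiling.SubstitutionSystem.isSimpleRing_tilingAlgebra,
    SubstTiling.SubstitutionSystem.exists_isNormalizedTrace,
    fun k => SubstTiling.SubstitutionSystem.diagElt (S.rokhlinFun D (k + 1) (n k)),
    fun k => ⟨?_, ?_⟩, fun a => ?_, fun g h hgh => ?_, fun ε hε => ?_⟩
  · refine SubstTiling.SubstitutionSystem.isPositiveElement_diagElt fun T => ?_
    obtain ⟨c, h0, -, h⟩ :=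
      SubstTiling.SubstitutionSystem.exists_rokhlinFun_eq D (hr k) (n k) T
    exact ⟨c, h0, h⟩
  · rw [← SubstTiling.SubstitutionSystem.diagElt_one,
      ← SubstTiling.SubstitutionSystem.diagElt_sub]
    refine SubstTiling.SubstitutionSystem.isPositiveElement_diagElt fun T => ?_
    obtain ⟨c, -, h1, h⟩ :=
      SubstTiling.SubstitutionSystem.exists_rokhlinFun_eq D (hr k) (n k) T
    refine ⟨1 - c, sub_nonneg.2 h1, ?_⟩
    rw [ContinuousMap.sub_apply, ContinuousMap.one_apply, h, Complex.ofReal_sub,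
      Complex.ofReal_one]
  · exact SubstTiling.SubstitutionSystem.tendsto_norm_commutator
      (fun k => SubstTiling.SubstitutionSystem.norm_rokhlinFun_le D (hr k) (n k))
      (fun k => SubstTiling.SubstitutionSystem.norm_rokhlinFun_sub_le D (hr k) (n k)) a
  · simp only [hG.action_rokhlin_mul_action_rokhlin hD _ _ hgh, norm_zero]
    exact tendsto_const_nhds
  · obtain ⟨N, hN⟩ := exists_nat_one_div_lt hε
    refine ⟨N, fun k hk τ hτ => ?_⟩
    refine (hG.norm_trace_rokhlin_sub_le hD (hr k) (hn k) hτ).trans_lt (lt_of_le_of_lt ?_ hN)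
    have : (N : ℝ) ≤ k := by exact_mod_cast hk
    exact one_div_le_one_div_of_le (by positivity) (by linarith)
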